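/- Let $p$ be a prime, $n\ge 0$ an integer, and $F$ a CM field with maximal totally real subfield $F^+$ and complex conjugation $c$, such that every place of $F^+$ above $p$ splits in $F$. Choose a set $\tilde S$ of places of $F$ above $p$ with $S_p(F)=\tilde S\sqcup\tilde S^c$, where $S_p(F)$ is the set of all places of $F$ above $p$. Let $L/\mathbf Q_p$ be a finite extension that admits $[F:\mathbf Q]$ embeddings $F\hookrightarrow L$. For $\nu\in\tilde S$ and $\tau:F_\nu\hookrightarrow L$ we identify the pair $(\nu,\tau)$ with the embedding $\tau|_F:F\hookrightarrow L$. Let $\Psi_n$ be the antidiagonal $n\times n$ matrix with entries $1$, let $J_n=\begin{pmatrix}0&\Psi_n\\-\Psi_n&0\end{pmatrix}$, and let $\tilde{\mathfrak g}=\{X\in M_{2n}(F): {}^tXJ_n+J_nX^c=0\}$ be the Lie algebra of the quasi-split unitary group $\tilde G=U(n,n)$ over $F^+$. Let $\mathfrak g=\mathfrak{gl}_n(F)$, embedded in $\tilde{\mathfrak g}$ as the Levi factor of the Siegel parabolic (the block upper triangular matrices) by $D\mapsto \mathrm{diag}(-\Psi_n\,{}^t(D^c)\,\Psi_n,\,D)$,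 and let $\bar{\mathfrak n}\subset\tilde{\mathfrak g}$ be the nilradical of the opposite Siegel parabolic $\bar P$ (the matrices whose only non-zero $n\times n$ block is the lower left one). All these are viewed as Lie algebras over $\mathbf Q$; put $\tilde{\mathfrak g}_L=L\otimes_{\mathbf Q}\tilde{\mathfrak g}$ and $\mathfrak g_L=L\otimes_{\mathbf Q}\mathfrak g$, and let $Z(\tilde{\mathfrak g})_L$ and $Z(\mathfrak g)_L$ be the centres of $U(\tilde{\mathfrak g}_L)$ and $U(\mathfrak g_L)$. Let $\mathrm{HC}^{\bar P}:Z(\tilde{\mathfrak g})_L\to Z(\mathfrak g)_L$ be the unnormalized Harish-Chandra homomorphism: $\mathrm{HC}^{\bar P}(z)$ is the unique element with $z-\mathrm{HC}^{\bar P}(z)\in U(\tilde{\mathfrak g}_L)\,\bar{\mathfrak n}_L$. Let $$\gamma_{\tilde{\mathfrak g}}:Z(\tilde{\mathfrak g})_L\to\bigotimes_{\nu\in\tilde S,\tau}L[x_1,\dots,x_{2n}],\qquad \gamma_{\mathfrak g}:Z(\mathfrak g)_L\to\bigotimes_{\nu\in\tilde S,\tau}L[x_1,\dots,x_{2n}]$$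 be the normalized Harish-Chandra homomorphisms with respect to the lower triangular Borel subalgebras, that is, the unnormalized ones followed by the shifts $x_k\mapsto x_k-\delta_k$ with $\delta=(\frac{1-2n}2,\dots,\frac{2n-1}2)$ for $\tilde{\mathfrak g}$ and $\delta=(\frac{1-n}2,\dots,\frac{n-1}2,\frac{1-n}2,\dots,\frac{n-1}2)$ for $\mathfrak g$. Here, in the $(\nu,\tau)$-factor, $x_k$ is the $k$-th diagonal coordinate of $\tilde{\mathfrak g}_L\to\mathfrak{gl}_{2n}(L)$ for $\gamma_{\tilde{\mathfrak g}}$; for $\gamma_{\mathfrak g}$, $x_i$ and $x_{n+i}$ ($1\le i\le n$) are the $i$-th diagonal coordinates of $\mathfrak g_L\to\mathfrak{gl}_n(L)$ for the embeddings $\tau|_F\circ c$ and $\tau|_F$, respectively. Let $a=(-1,\dots,-1,1,\dots,1)$ ($n$ entries of each sign), and let $E_a$ be the $L$-algebra endomorphism of $\bigotimes_{\nu,\tau}L[x_1,\dots,x_{2n}]$ given in every factor by $x_i\mapsto -x_i-\frac n2+a_i$ and $x_{n+i}\mapsto x_{n+i}+\frac n2+a_{n+i}$ for $1\le i\le n$.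 Then these homomorphisms of $L$-algebras $\mathrm{HC}^{\bar P},\gamma_{\tilde{\mathfrak g}},\gamma_{\mathfrak g}$ exist and are unique, there is a unique homomorphism of $L$-algebras $\mathrm{HC}^{\bar P}_a:Z(\tilde{\mathfrak g})_L\to Z(\mathfrak g)_L$ with $\gamma_{\mathfrak g}\circ\mathrm{HC}^{\bar P}_a=E_a\circ\gamma_{\tilde{\mathfrak g}}$, and the homomorphism of $L$-algebras $$\mathrm{HC}^{\bar P}\otimes\mathrm{HC}^{\bar P}_a:\ Z(\tilde{\mathfrak g})_L\otimes_LZ(\tilde{\mathfrak g})_L\to Z(\mathfrak g)_L,\qquad z\otimes w\mapsto \mathrm{HC}^{\bar P}(z)\,\mathrm{HC}^{\bar P}_a(w),$$ is surjective. -/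

import Mathlib

open scoped TensorProduct NumberField

attribute [local instance 100] LieRing.ofAssociativeRing

noncomputable section

namespace HCSurj

/-! ### Harish-Chandra homomorphisms -/

/-- The base change `L ⊗ f` of a homomorphism of Lie algebras over `ℚ`. -/
def lieBaseChange (L : Type*) [Field L] [CharZero L] {𝔪 𝔤 : Type*} [LieRing 𝔪] [LieAlgebra ℚ 𝔪]
    [LieRing 𝔤] [LieAlgebra ℚ 𝔤] (f : 𝔪 →ₗ⁅ℚ⁆ 𝔤) : (L ⊗[ℚ] 𝔪) →ₗ⁅L⁆ (L ⊗[ℚ] 𝔤) :=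
  { LinearMap.baseChange L (f : 𝔪 →ₗ[ℚ] 𝔤) with
    map_lie' := fun {x y} => (LieAlgebra.ExtendScalars.map (AlgHom.id ℚ L) f).map_lie x y }

/-- The universal enveloping algebra `U(𝔤_L)` of `𝔤_L = L ⊗ 𝔤`. -/
abbrev U (L : Type*) [Field L] [CharZero L] (𝔤 : Type*) [LieRing 𝔤] [LieAlgebra ℚ 𝔤] : Type _ :=
  UniversalEnvelopingAlgebra L (L ⊗[ℚ] 𝔤)

/-- The centre `Z(𝔤)_L` of `U(𝔤_L)`. -/
abbrev Z (L : Type*) [Field L] [CharZero L] (𝔤 : Type*) [LieRing 𝔤] [LieAlgebra ℚ 𝔤] :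
    Subalgebra L (U L 𝔤) :=
  Subalgebra.center L (U L 𝔤)

/-- The map `U(𝔪_L) → U(𝔤_L)` induced by `j : 𝔪 → 𝔤`. -/
def mapU (L : Type*) [Field L] [CharZero L] {𝔪 𝔤 : Type*} [LieRing 𝔪] [LieAlgebra ℚ 𝔪]
    [LieRing 𝔤] [LieAlgebra ℚ 𝔤] (j : 𝔪 →ₗ⁅ℚ⁆ 𝔤) : U L 𝔪 →ₐ[L] U L 𝔤 :=
  UniversalEnvelopingAlgebra.lift L
    ((UniversalEnvelopingAlgebra.ι L).comp (lieBaseChange L j))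

/-- The left ideal `U(𝔤_L) 𝔲_L`. -/
def leftIdeal (L : Type*) [Field L] [CharZero L] {𝔤 : Type*} [LieRing 𝔤] [LieAlgebra ℚ 𝔤]
    (𝔲 : Submodule ℚ 𝔤) : Ideal (U L 𝔤) :=
  Ideal.span ((UniversalEnvelopingAlgebra.ι L : (L ⊗[ℚ] 𝔤) → U L 𝔤) '' (𝔲.baseChange L))

/-- `f : Z(𝔤)_L → Z(𝔪)_L` is the unnormalized Harish-Chandra homomorphism with respect to a
parabolic subalgebra with Levi factor `𝔪` (embedded by `j`) and nilradical `𝔲`: for each central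
`z`, `f z` is the component of `z` in `U(𝔪_L)` in the decomposition of `z` along
`U(𝔪_L) ⊕ U(𝔤_L) 𝔲_L`. -/
def IsHarishChandra (L : Type*) [Field L] [CharZero L] {𝔪 𝔤 : Type*} [LieRing 𝔪] [LieAlgebra ℚ 𝔪]
    [LieRing 𝔤] [LieAlgebra ℚ 𝔤] (j : 𝔪 →ₗ⁅ℚ⁆ 𝔤) (𝔲 : Submodule ℚ 𝔤)
    (f : Z L 𝔤 →ₐ[L] Z L 𝔪) : Prop :=
  ∀ z : Z L 𝔤, (z : U L 𝔤) - mapU L j (f z : U L 𝔪) ∈ leftIdeal L 𝔲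

/-- For an abelian Lie algebra `𝔱` and a linear map `f` from `𝔱` to a commutative `L`-algebra `A`,
the induced algebra homomorphism `U(𝔱_L) → A`. -/
def evalTorus (L : Type*) [Field L] [CharZero L] {𝔱 : Type*} [LieRing 𝔱] [LieAlgebra ℚ 𝔱]
    [IsLieAbelian 𝔱] {A : Type*} [CommRing A] [Algebra L A] [Algebra ℚ A] [IsScalarTower ℚ L A]
    (f : 𝔱 →ₗ[ℚ] A) : U L 𝔱 →ₐ[L] A :=
  UniversalEnvelopingAlgebra.lift L
    { LinearMap.liftBaseChange L f with
      map_lie' := fun {x y} => by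
        have h : ⁅x, y⁆ = 0 := by
          induction x using TensorProduct.induction_on with
          | zero => simp
          | add a b ha hb => rw [add_lie, ha, hb, add_zero]
          | tmul a s =>
            induction y using TensorProduct.induction_on with
            | zero => simp
            | add a b ha hb => rw [lie_add, ha, hb, add_zero]
            | tmul b t => rw [LieAlgebra.ExtendScalars.bracket_tmul, trivial_lie_zero, TensorProduct.tmul_zero]
        rw [h, LieRing.of_associative_ring_bracket, mul_comm, sub_self]
        exact map_zero (LinearMap.liftBaseChange L f) }

/-! ### The unitary Lie algebra and its Siegel Levi factor -/

/-- The antidiagonal matrix `Ψ_n`. -/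
def antidiag (n : ℕ) (F : Type*) [Field F] : Matrix (Fin n) (Fin n) F :=
  Matrix.of fun i j => if j = i.rev then 1 else 0

theorem antidiag_mul_self (n : ℕ) (F : Type*) [Field F] : antidiag n F * antidiag n F = 1 := by
  ext i j
  rw [Matrix.mul_apply, Finset.sum_eq_single i.rev]
  · simp [antidiag, Matrix.one_apply, eq_comm]
  · intro b _ hb
    simp [antidiag, hb]
  · simp

theorem antidiag_transpose (n : ℕ) (F : Type*) [Field F] :
    (antidiag n F).transpose = antidiag n F := by
  ext i j
  simp only [antidiag, Matrix.transpose_apply, Matrix.of_apply]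
  congr 1
  exact propext ⟨fun h => by rw [h, Fin.rev_rev], fun h => by rw [h, Fin.rev_rev]⟩

/-- The skew-symmetric matrix `J_n` with blocks `0, Ψ_n, -Ψ_n, 0`. -/
def formJ (n : ℕ) (F : Type*) [Field F] : Matrix (Fin n ⊕ Fin n) (Fin n ⊕ Fin n) F :=
  Matrix.fromBlocks 0 (antidiag n F) (-antidiag n F) 0

/-- Complex conjugation of the CM field `F`. -/
def conj (F : Type*) [Field F] [NumberField F] [NumberField.IsCMField F] : F →+* F :=
  (NumberField.IsCMField.complexConj F : F →+* F)

/-- Entrywise complex conjugation of matrices. -/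
abbrev conjM {F : Type*} [Field F] [NumberField F] [NumberField.IsCMField F] {m : Type*}
    (X : Matrix m m F) : Matrix m m F :=
  X.map (conj F)

/-- The Lie algebra `𝔤̃` of the quasi-split unitary group
`{g ∈ GL_{2n}(F) | ᵗg J_n g^c = J_n}` over the maximal totally real subfield of `F`, viewed as a
Lie algebra over `ℚ` (restriction of scalars). -/
def unitaryLie (n : ℕ) (F : Type*) [Field F] [NumberField F] [NumberField.IsCMField F] :
    LieSubalgebra ℚ (Matrix (Fin n ⊕ Fin n) (Fin n ⊕ Fin n) F) where
  carrier := {X | X.transpose * formJ n F + formJ n F * conjM X = 0}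
  zero_mem' := by simp [conjM]
  add_mem' {X Y} hX hY := by
    simp only [Set.mem_ofPred_eq, conjM] at *
    rw [Matrix.transpose_add, Matrix.map_add _ (map_add (conj F)), add_mul, mul_add,
      add_add_add_comm, hX, hY, add_zero]
  smul_mem' r X hX := by
    simp only [Set.mem_ofPred_eq, conjM] at *
    rw [Matrix.transpose_smul, Matrix.map_smul _ r (fun a => map_rat_smul (conj F) r a), smul_mul_assoc,
      mul_smul_comm, ← smul_add, hX, smul_zero]
  lie_mem' {X Y} hX hY := by
    simp only [Set.mem_ofPred_eq, conjM] at *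
    have hX' := eq_neg_of_add_eq_zero_left hX
    have hY' := eq_neg_of_add_eq_zero_left hY
    rw [LieRing.of_associative_ring_bracket, Matrix.transpose_sub, Matrix.transpose_mul,
      Matrix.transpose_mul, Matrix.map_sub _ (map_sub (conj F)), Matrix.map_mul, Matrix.map_mul,
      sub_mul, mul_sub, mul_assoc, mul_assoc, hX', hY', mul_neg, mul_neg, ← mul_assoc, ← mul_assoc,
      hX', hY']
    simp only [neg_mul, mul_assoc]
    abel

/-- The Lie algebra `𝔤 = 𝔤𝔩_n(F)` over `ℚ`, that is, the Lie algebra of `Res_{F/ℚ} GL_n`. -/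
abbrev glLie (n : ℕ) (F : Type*) : Type _ := Matrix (Fin n) (Fin n) F

/-- The block-diagonal matrix `diag(-Ψ ᵗ(D^c) Ψ, D)`. -/
def leviMatrix {n : ℕ} {F : Type*} [Field F] [NumberField F] [NumberField.IsCMField F]
    (D : glLie n F) : Matrix (Fin n ⊕ Fin n) (Fin n ⊕ Fin n) F :=
  Matrix.fromBlocks (-(antidiag n F * (conjM D).transpose * antidiag n F)) 0 0 D

theorem leviMatrix_mem {n : ℕ} {F : Type*} [Field F] [NumberField F] [NumberField.IsCMField F]
    (D : glLie n F) : leviMatrix D ∈ unitaryLie n F := by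
  change _ * _ + _ * _ = _
  have h1 : (antidiag n F).map (conj F) = antidiag n F := by
    ext i j; by_cases h : j = i.rev <;> simp [antidiag, h]
  have h2 : (D.map (conj F)).map (conj F) = D := by
    ext i j; exact NumberField.IsCMField.complexConj_apply_apply F _
  have h3 : ∀ X : Matrix (Fin n) (Fin n) F,
      (-X).map (conj F) = -(X.map (conj F)) := fun X => by ext; simp
  simp only [leviMatrix, formJ, conjM, Matrix.fromBlocks_transpose, Matrix.fromBlocks_map,
    Matrix.fromBlocks_multiply, Matrix.fromBlocks_add, ← Matrix.fromBlocks_zero]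
  congr 1
  · simp
  · simp [Matrix.transpose_mul, antidiag_transpose, mul_assoc, antidiag_mul_self]
  · simp [h1, h2, h3, Matrix.map_mul, Matrix.transpose_map, ← mul_assoc, antidiag_mul_self]
  · simp

/-- The identification of `𝔤 = 𝔤𝔩_n(F)` with the block-diagonal matrices in `𝔤̃`, which form the
standard Levi factor of the Siegel parabolic: `D ↦ diag(-Ψ ᵗ(D^c) Ψ, D)`. -/
def leviEmbedding (n : ℕ) (F : Type*) [Field F] [NumberField F] [NumberField.IsCMField F] :
    glLie n F →ₗ⁅ℚ⁆ unitaryLie n F where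
  toFun D := ⟨leviMatrix D, leviMatrix_mem D⟩
  map_add' X Y := by
    apply Subtype.ext
    change leviMatrix (X + Y) = leviMatrix X + leviMatrix Y
    simp only [leviMatrix, conjM]
    rw [Matrix.fromBlocks_add, Matrix.map_add _ (map_add (conj F)), Matrix.transpose_add,
      mul_add, add_mul, neg_add, add_zero]
  map_smul' r X := by
    apply Subtype.ext
    change leviMatrix (r • X) = r • leviMatrix X
    simp only [leviMatrix, conjM]
    rw [Matrix.fromBlocks_smul, Matrix.map_smul _ r (fun a => map_rat_smul (conj F) r a),
      Matrix.transpose_smul, mul_smul_comm, smul_mul_assoc, smul_neg, smul_zero]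
  map_lie' {X Y} := by
    apply Subtype.ext
    change leviMatrix ⁅X, Y⁆ = ⁅leviMatrix X, leviMatrix Y⁆
    have h : ∀ A B : Matrix (Fin n) (Fin n) F,
        antidiag n F * A * antidiag n F * (antidiag n F * B * antidiag n F) =
          antidiag n F * (A * B) * antidiag n F := fun A B => by
      rw [show antidiag n F * A * antidiag n F * (antidiag n F * B * antidiag n F) =
        antidiag n F * A * (antidiag n F * antidiag n F) * B * antidiag n F by
          simp only [mul_assoc], antidiag_mul_self]
      simp only [mul_assoc, one_mul]
    simp only [leviMatrix, LieRing.of_associative_ring_bracket, Matrix.fromBlocks_multiply, conjM,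
      Matrix.map_sub _ (map_sub (conj F)), Matrix.map_mul, Matrix.transpose_sub,
      Matrix.transpose_mul, neg_mul_neg, h, mul_zero, zero_mul, add_zero,
      zero_add, mul_sub, sub_mul, neg_sub]
    simp [sub_eq_add_neg, Matrix.fromBlocks_neg, Matrix.fromBlocks_add]

/-- The nilradical of the opposite Siegel parabolic of `𝔤̃`: only the lower left `n × n` block is
non-zero. -/
def siegelNilradicalOpp (n : ℕ) (F : Type*) [Field F] [NumberField F] [NumberField.IsCMField F] :
    Submodule ℚ (unitaryLie n F) where
  carrier := {X | X.1.toBlocks₁₁ = 0 ∧ X.1.toBlocks₁₂ = 0 ∧ X.1.toBlocks₂₂ = 0}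
  zero_mem' := ⟨rfl, rfl, rfl⟩
  add_mem' {X Y} hX hY := by
    refine ⟨?_, ?_, ?_⟩
    · change X.1.toBlocks₁₁ + Y.1.toBlocks₁₁ = 0
      rw [hX.1, hY.1, add_zero]
    · change X.1.toBlocks₁₂ + Y.1.toBlocks₁₂ = 0
      rw [hX.2.1, hY.2.1, add_zero]
    · change X.1.toBlocks₂₂ + Y.1.toBlocks₂₂ = 0
      rw [hX.2.2, hY.2.2, add_zero]
  smul_mem' r X hX := by
    refine ⟨?_, ?_, ?_⟩
    · change r • X.1.toBlocks₁₁ = 0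
      rw [hX.1, smul_zero]
    · change r • X.1.toBlocks₁₂ = 0
      rw [hX.2.1, smul_zero]
    · change r • X.1.toBlocks₂₂ = 0
      rw [hX.2.2, smul_zero]

/-! ### Opposite standard Borel subalgebras -/

/-- The position in `{0, …, 2n-1}` of an index of a block matrix. -/
def pos {n : ℕ} : Fin n ⊕ Fin n → ℕ
  | Sum.inl i => i
  | Sum.inr i => n + i

theorem lie_eq_zero_of_isDiag {m F : Type*} [Fintype m] [DecidableEq m] [Field F]
    {X Y : Matrix m m F} (hX : X.IsDiag) (hY : Y.IsDiag) : ⁅X, Y⁆ = 0 := by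
  rw [LieRing.of_associative_ring_bracket, ← hX.diagonal_diag, ← hY.diagonal_diag,
    Matrix.diagonal_mul_diagonal, Matrix.diagonal_mul_diagonal]
  simp [mul_comm]

/-- The diagonal torus of `𝔤̃`. -/
def torusUnitary (n : ℕ) (F : Type*) [Field F] [NumberField F] [NumberField.IsCMField F] :
    LieSubalgebra ℚ (unitaryLie n F) where
  carrier := {X | X.1.IsDiag}
  zero_mem' := Matrix.isDiag_zero
  add_mem' hX hY := Matrix.IsDiag.add hX hY
  smul_mem' r _ hX := Matrix.IsDiag.smul r hX
  lie_mem' {X Y} hX hY := by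
    change Matrix.IsDiag ⁅X.1, Y.1⁆
    rw [lie_eq_zero_of_isDiag hX hY]
    exact Matrix.isDiag_zero

/-- The strictly lower triangular matrices in `𝔤̃`. -/
def lowerUnitary (n : ℕ) (F : Type*) [Field F] [NumberField F] [NumberField.IsCMField F] :
    Submodule ℚ (unitaryLie n F) where
  carrier := {X | ∀ i j, pos i ≤ pos j → X.1 i j = 0}
  zero_mem' := fun _ _ _ => rfl
  add_mem' {X Y} hX hY i j h := by
    change X.1 i j + Y.1 i j = 0
    rw [hX i j h, hY i j h, add_zero]
  smul_mem' r X hX i j h := by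
    change r • X.1 i j = 0
    rw [hX i j h, smul_zero]

/-- The diagonal torus of `𝔤𝔩_n(F)`. -/
def torusGl (n : ℕ) (F : Type*) [Field F] [NumberField F] : LieSubalgebra ℚ (glLie n F) where
  carrier := {X | X.IsDiag}
  zero_mem' := Matrix.isDiag_zero
  add_mem' hX hY := Matrix.IsDiag.add hX hY
  smul_mem' r _ hX := Matrix.IsDiag.smul r hX
  lie_mem' {X Y} hX hY := by
    change Matrix.IsDiag ⁅X, Y⁆
    rw [lie_eq_zero_of_isDiag hX hY]
    exact Matrix.isDiag_zero

/-- The strictly lower triangular matrices in `𝔤𝔩_n(F)`. -/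
def lowerGl (n : ℕ) (F : Type*) [Field F] [NumberField F] : Submodule ℚ (glLie n F) where
  carrier := {X | ∀ i j, i ≤ j → X i j = 0}
  zero_mem' := fun _ _ _ => rfl
  add_mem' {X Y} hX hY i j h := by
    change X i j + Y i j = 0
    rw [hX i j h, hY i j h, add_zero]
  smul_mem' r X hX i j h := by
    change r • X i j = 0
    rw [hX i j h, smul_zero]

instance (n : ℕ) (F : Type*) [Field F] [NumberField F] [NumberField.IsCMField F] :
    IsLieAbelian (torusUnitary n F) :=
  ⟨fun X Y => Subtype.ext (Subtype.ext (lie_eq_zero_of_isDiag X.2 Y.2))⟩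

instance (n : ℕ) (F : Type*) [Field F] [NumberField F] : IsLieAbelian (torusGl n F) :=
  ⟨fun X Y => Subtype.ext (lie_eq_zero_of_isDiag X.2 Y.2)⟩

/-! ### Normalized Harish-Chandra homomorphisms

`Φ` is the set of embeddings `σ : F → L` which correspond to the pairs `(ν, τ)`. The polynomial ring
`MvPolynomial (Φ × (Fin n ⊕ Fin n)) L` is the tensor product over `σ ∈ Φ` of the rings
`L[x_1, …, x_{2n}]`. -/

/-- The polynomial ring `⨂_{σ ∈ Φ} L[x_1, …, x_{2n}]`. -/
abbrev Poly (n : ℕ) {F L : Type*} [Field F] [Field L] (Φ : Finset (F →+* L)) : Type _ :=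
  MvPolynomial (Φ × (Fin n ⊕ Fin n)) L

/-- The `k`-th entry (`0 ≤ k < m`) of half the sum of the roots of the lower triangular Borel
subalgebra of `𝔤𝔩_m`, namely of `((1-m)/2, …, (m-1)/2)`. -/
def delta (L : Type*) [Field L] (m k : ℕ) : L := (1 - (m : L)) / 2 + (k : L)

/-- The identification `𝔱_L ≅ ⨁_{σ ∈ Φ} L^{2n}` for the torus of `𝔤̃`, composed with the shift
`x_k ↦ x_k - δ_k`. -/
def torusUnitaryPoly (n : ℕ) {F L : Type*} [Field F] [NumberField F] [NumberField.IsCMField F]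
    [Field L] [CharZero L] (Φ : Finset (F →+* L)) : torusUnitary n F →ₗ[ℚ] Poly n Φ :=
  AddMonoidHom.toRatLinearMap
    { toFun := fun X => ∑ σ : Φ, ∑ k : Fin n ⊕ Fin n,
        MvPolynomial.C (σ.1 (X.1.1 k k)) *
          (MvPolynomial.X (σ, k) - MvPolynomial.C (delta L (2 * n) (pos k)))
      map_zero' := by simp
      map_add' := fun X Y => by
        rw [← Finset.sum_add_distrib]
        refine Finset.sum_congr rfl fun σ _ => ?_
        rw [← Finset.sum_add_distrib]
        refine Finset.sum_congr rfl fun k _ => ?_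
        rw [show (X + Y).1.1 k k = X.1.1 k k + Y.1.1 k k from rfl, map_add, map_add, add_mul] }

/-- The identification `𝔱_L ≅ ⨁_{σ ∈ Φ} (L^n ⊕ L^n)` for the torus of `𝔤𝔩_n(F)`, in which the first
copy of `L^n` belongs to the embedding `σ ∘ c` and the second one to `σ`, composed with the shift by
`((1-n)/2, …, (n-1)/2)` in each copy. -/
def torusGlPoly (n : ℕ) {F L : Type*} [Field F] [NumberField F] [NumberField.IsCMField F]
    [Field L] [CharZero L] (Φ : Finset (F →+* L)) : torusGl n F →ₗ[ℚ] Poly n Φ :=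
  AddMonoidHom.toRatLinearMap
    { toFun := fun X => ∑ σ : Φ, ∑ i : Fin n,
        (MvPolynomial.C (σ.1 (conj F (X.1 i i))) *
            (MvPolynomial.X (σ, Sum.inl i) - MvPolynomial.C (delta L n i)) +
          MvPolynomial.C (σ.1 (X.1 i i)) *
            (MvPolynomial.X (σ, Sum.inr i) - MvPolynomial.C (delta L n i)))
      map_zero' := by simp
      map_add' := fun X Y => by
        rw [← Finset.sum_add_distrib]
        refine Finset.sum_congr rfl fun σ _ => ?_
        rw [← Finset.sum_add_distrib]
        refine Finset.sum_congr rfl fun i _ => ?_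
        rw [show (X + Y).1 i i = X.1 i i + Y.1 i i from rfl]
        simp only [map_add]
        ring }

/-- `γ` is the normalized Harish-Chandra homomorphism of `𝔤̃_L` with respect to the lower triangular
Borel subalgebra: the unnormalized one, followed by the shift `x_k ↦ x_k - δ_k`. -/
def IsNormalizedHCUnitary (n : ℕ) {F L : Type*} [Field F] [NumberField F]
    [NumberField.IsCMField F] [Field L] [CharZero L] (Φ : Finset (F →+* L))
    (γ : Z L (unitaryLie n F) →ₐ[L] Poly n Φ) : Prop :=
  ∃ f : Z L (unitaryLie n F) →ₐ[L] Z L (torusUnitary n F),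
    IsHarishChandra L (torusUnitary n F).incl (lowerUnitary n F) f ∧
      ∀ z, γ z = evalTorus L (torusUnitaryPoly n Φ) (f z : U L (torusUnitary n F))

/-- `γ` is the normalized Harish-Chandra homomorphism of `𝔤𝔩_n(F)_L` with respect to the lower
triangular Borel subalgebra. -/
def IsNormalizedHCGl (n : ℕ) {F L : Type*} [Field F] [NumberField F]
    [NumberField.IsCMField F] [Field L] [CharZero L] (Φ : Finset (F →+* L))
    (γ : Z L (glLie n F) →ₐ[L] Poly n Φ) : Prop :=
  ∃ f : Z L (glLie n F) →ₐ[L] Z L (torusGl n F),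
    IsHarishChandra L (torusGl n F).incl (lowerGl n F) f ∧
      ∀ z, γ z = evalTorus L (torusGlPoly n Φ) (f z : U L (torusGl n F))

/-- `f` is the Harish-Chandra homomorphism `Z(𝔤̃)_L → Z(𝔤)_L` with respect to the opposite Siegel
parabolic. -/
def IsSiegelHC (n : ℕ) (F L : Type*) [Field F] [NumberField F]
    [NumberField.IsCMField F] [Field L] [CharZero L]
    (f : Z L (unitaryLie n F) →ₐ[L] Z L (glLie n F)) : Prop :=
  IsHarishChandra L (leviEmbedding n F) (siegelNilradicalOpp n F) f

/-- The substitution `x_i ↦ -x_i - n/2 + a_i`, `x_{n+i} ↦ x_{n+i} + n/2 + a_{n+i}` (`1 ≤ i ≤ n`). -/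
def twistSubst (n : ℕ) {F L : Type*} [Field F] [Field L] (Φ : Finset (F →+* L))
    (a : Φ → Fin n ⊕ Fin n → L) : Poly n Φ →ₐ[L] Poly n Φ :=
  MvPolynomial.aeval fun s => match s with
    | (σ, Sum.inl i) =>
      -MvPolynomial.X (σ, Sum.inl i) - MvPolynomial.C ((n : L) / 2) +
        MvPolynomial.C (a σ (Sum.inl i))
    | (σ, Sum.inr i) =>
      MvPolynomial.X (σ, Sum.inr i) + MvPolynomial.C ((n : L) / 2) +
        MvPolynomial.C (a σ (Sum.inr i))

/-- The vector `(-1, …, -1, 1, …, 1)`, for every `σ`. -/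
def twistVector (n : ℕ) {F L : Type*} [Field F] [Field L] (Φ : Finset (F →+* L)) :
    Φ → Fin n ⊕ Fin n → L :=
  fun _ => Sum.elim (fun _ => -1) (fun _ => 1)

/-! ### Places above `p` and embeddings -/

/-- The set `S_p(F)` of places of `F` above `p`, as prime ideals of the ring of integers. -/
def placesAbove (p : ℕ) (F : Type*) [Field F] [NumberField F] : Set (Ideal (𝓞 F)) :=
  {P | P.IsPrime ∧ (p : 𝓞 F) ∈ P}

/-- The complex conjugate `ν^c` of a place `ν`. -/
def conjPlace {F : Type*} [Field F] [NumberField F] [NumberField.IsCMField F]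
    (P : Ideal (𝓞 F)) : Ideal (𝓞 F) :=
  P.map (NumberField.IsCMField.ringOfIntegersComplexConj F : 𝓞 F →+* 𝓞 F)

open Classical in
/-- The embeddings `F → L` which induce a place in `S`; these are the pairs `(ν, τ)` of a place
`ν ∈ S` and a (continuous) embedding `τ : F_ν → L`. -/
def embeddingsOver (p : ℕ) [Fact p.Prime] {F : Type*} (L : Type*) [Field F] [NumberField F]
    [Field L] [CharZero L] [Algebra ℚ_[p] L] (S : Set (Ideal (𝓞 F))) : Finset (F →+* L) :=
  {σ | ∃ P ∈ S, ∀ x : 𝓞 F, x ∈ P ↔ spectralNorm ℚ_[p] L (σ x) < 1}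

end HCSurj

end

/-! The surjectivity is a statement about power sums. For `σ ∈ Φ` put `u_i = -x_i - n/2` and `v_i =
x_{n+i} + n/2`. The image of `γt` is generated by the power sums of the `2n` variables attached to
each `σ`, while `γ` is injective and its image is generated by the power sums of the two groups of
`n` variables separately. Harish-Chandra homomorphisms are transitive, so `γ ∘ HC` is `γt` followed
by a substitution which turns the `k`-th power sum into `p_k(u) + p_k(v)`; by definition `γ ∘ HCa`
turns it into `p_k(u - 1) + p_k(v + 1)`. The difference of these two in exponent `k + 1` is `(k +
1)(p_k(v) - p_k(u))` plus a combination of the `p_m(u)` and `p_m(v)` with `m < k`. In characteristic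
zero, induction on `k` therefore recovers `p_k(u)` and `p_k(v)` (`sum_pow_mem_of_twist`), and these
generate the image of `γ` (`leviPsumAlgebra_le`).

What remains is Harish-Chandra's theorem for products of general linear algebras. Because `L`
contains all conjugates of `F`, the algebra `L ⊗ F` splits, and both Lie algebras acquire matrix
units over `L`: one factor for each embedding in the case of `𝔤𝔩_n(F)`, one for each element of `Φ`
in the unitary case. The condition on places enters only through the fact that `Φ` contains exactly
one of `σ` and `σ ∘ c`.

The ingredients for an algebra with matrix units are these. Ordered monomials form a basis of the
enveloping algebra: they span by straightening, and they are independent because the algebra acts on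
polynomial functions on matrices by vector fields which are the coordinate fields at the identity
(`pbwMap_injective_of_derivations`). For a grading by `ad h`, a central element has weight zero, so
modulo the left ideal generated by positive weights it comes from the weight-zero part
(`exists_harishChandra`). The normalized image is symmetric because `F ^ (r + 1)` produces a
singular vector in a Verma module of suitable integral weight, and integral weights are Zariski
dense (`eval_swap_simple`). It contains all power sums because traces of powers of the matrix
`(E_ij)` are central with power sums as leading terms (`exists_central_leading_psum`). Finally, the
leading symbol of a central element is an invariant polynomial on matrices, and such a polynomial is
zero once it vanishes on diagonal matrices (`eq_zero_of_invariant`); this gives injectivity. -/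

noncomputable section

namespace HCSurj

/-! ### Ordered monomials and straightening -/

section Straightening

variable {K A B : Type*} [Field K] [Ring A] [Algebra K A] (e : B → A)

/-- The span of the products of non-empty lists over `C` with fewer than `k` factors. -/
def shorter (K : Type*) [Field K] [Algebra K A] (C : Set B) (k : ℕ) : Submodule K A :=
  Submodule.span K {a | ∃ l : List B, l ≠ [] ∧ (∀ b ∈ l, b ∈ C) ∧ l.length < k ∧ (l.map e).prod = a}

variable {e}

theorem prod_mem_shorter {C : Set B} {k : ℕ} {l : List B} (hl : l ≠ []) (hC : ∀ b ∈ l, b ∈ C)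
    (hk : l.length < k) : (l.map e).prod ∈ shorter e K C k :=
  Submodule.subset_span ⟨l, hl, hC, hk, rfl⟩

theorem shorter_mono {C : Set B} {k k' : ℕ} (h : k ≤ k') : shorter e K C k ≤ shorter e K C k' :=
  Submodule.span_mono fun _ ⟨l, h1, h2, h3, h4⟩ => ⟨l, h1, h2, h3.trans_le h, h4⟩

theorem mul_mem_shorter {C : Set B} {k : ℕ} {b : B} (hb : b ∈ C) {x : A}
    (hx : x ∈ shorter e K C k) : e b * x ∈ shorter e K C (k + 1) := by
  induction hx using Submodule.span_induction with
  | mem x hx =>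
    obtain ⟨l, -, h2, h3, rfl⟩ := hx
    rw [← List.prod_cons, ← List.map_cons]
    refine prod_mem_shorter (by simp) ?_ (by simpa using h3)
    simpa using ⟨hb, h2⟩
  | zero => simp
  | add x y _ _ hx hy => rw [mul_add]; exact add_mem hx hy
  | smul c x _ hx => rw [mul_smul_comm]; exact Submodule.smul_mem _ _ hx

theorem mul_prod_mem_shorter {C : Set B} {x : A} (hx : x ∈ Submodule.span K (e '' C)) {l : List B}
    (hl : ∀ b ∈ l, b ∈ C) : x * (l.map e).prod ∈ shorter e K C (l.length + 2) := by
  induction hx using Submodule.span_induction with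
  | mem x hx =>
    obtain ⟨b, hb, rfl⟩ := hx
    rw [← List.prod_cons, ← List.map_cons]
    refine prod_mem_shorter (by simp) ?_ (by simp)
    simpa using ⟨hb, hl⟩
  | zero => simp
  | add x y _ _ hx hy => rw [add_mul]; exact add_mem hx hy
  | smul c x _ hx => rw [smul_mul_assoc]; exact Submodule.smul_mem _ _ hx

/-- Reordering a product changes it by a combination of shorter products. -/
theorem prod_sub_prod_mem_shorter {C : Set B}
    (hC : ∀ a ∈ C, ∀ b ∈ C, e a * e b - e b * e a ∈ Submodule.span K (e '' C))
    {l l' : List B} (h : l.Perm l') (hl : ∀ b ∈ l, b ∈ C) :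
    (l.map e).prod - (l'.map e).prod ∈ shorter e K C l.length := by
  induction h with
  | nil => simp
  | cons x _ ih =>
    simp only [List.map_cons, List.prod_cons, ← mul_sub, List.length_cons]
    exact mul_mem_shorter (hl x (by simp)) (ih fun b hb => hl b (by simp [hb]))
  | swap x y l =>
    simp only [List.map_cons, List.prod_cons, List.length_cons]
    rw [← mul_assoc, ← mul_assoc, ← sub_mul]
    exact mul_prod_mem_shorter (hC _ (hl _ (by simp)) _ (hl _ (by simp)))
      fun b hb => hl b (by simp [hb])
  | trans h1 h2 ih1 ih2 =>
    rw [← sub_add_sub_cancel]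
    refine add_mem (ih1 hl) ?_
    rw [h1.length_eq]
    exact ih2 fun b hb => hl b (h1.mem_iff.2 hb)

variable (e)

/-- The ordered monomial with exponent `m`, in the order of the list `bs`. -/
def ordMonomial (bs : List B) (m : B →₀ ℕ) : A := (bs.map fun b => e b ^ m b).prod

/-- The linear map which sends a monomial to the corresponding ordered monomial. -/
def pbwMap (K : Type*) [Field K] [Algebra K A] (bs : List B) : MvPolynomial B K →ₗ[K] A :=
  (MvPolynomial.basisMonomials B K).constr K (ordMonomial e bs)

variable {e}

theorem pbwMap_monomial (bs : List B) (m : B →₀ ℕ) (c : K) :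
    pbwMap e K bs (MvPolynomial.monomial m c) = c • ordMonomial e bs m := by
  have := (MvPolynomial.basisMonomials B K).constr_basis K (ordMonomial e bs) m
  rw [MvPolynomial.coe_basisMonomials] at this
  rw [← this, pbwMap, ← map_smul, MvPolynomial.smul_monomial, smul_eq_mul, mul_one]

theorem ordMonomial_append (bs bs' : List B) (m : B →₀ ℕ) :
    ordMonomial e (bs ++ bs') m = ordMonomial e bs m * ordMonomial e bs' m := by
  simp [ordMonomial]

theorem ordMonomial_eq_one {bs : List B} {m : B →₀ ℕ} (h : ∀ b ∈ bs, m b = 0) :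
    ordMonomial e bs m = 1 := by
  refine List.prod_eq_one fun x hx => ?_
  obtain ⟨b, hb, rfl⟩ := List.mem_map.1 hx
  rw [h b hb, pow_zero]

theorem ordMonomial_congr {bs : List B} {m m' : B →₀ ℕ} (h : ∀ b ∈ bs, m b = m' b) :
    ordMonomial e bs m = ordMonomial e bs m' := by
  unfold ordMonomial
  congr 1
  exact List.map_congr_left fun b hb => by rw [h b hb]

/-- The sorted list with exponent vector `m`. -/
def expList (bs : List B) (m : B →₀ ℕ) : List B := bs.flatMap fun b => List.replicate (m b) b

theorem ordMonomial_eq_prod (bs : List B) (m : B →₀ ℕ) :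
    ordMonomial e bs m = ((expList bs m).map e).prod := by
  induction bs with
  | nil => simp [ordMonomial, expList]
  | cons b bs ih =>
    simp only [ordMonomial, expList, List.map_cons, List.prod_cons, List.flatMap_cons,
      List.map_append, List.prod_append, List.map_replicate, List.prod_replicate] at ih ⊢
    rw [ih]

theorem perm_expList [DecidableEq B] {bs : List B} (hbs : bs.Nodup) (l : List B)
    (hl : ∀ b ∈ l, b ∈ bs) : l.Perm (expList bs (Multiset.toFinsupp (l : Multiset B))) := by
  rw [List.perm_iff_count]
  intro a
  simp only [expList, List.count_flatMap, Function.comp_def, List.count_replicate,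
    Multiset.toFinsupp_apply, Multiset.coe_count]
  rw [List.sum_map_eq_nsmul_single a _ fun a' h _ => by simp [h]]
  by_cases ha : a ∈ bs
  · simp [List.count_eq_one_of_mem hbs ha]
  · simp [List.count_eq_zero.2 fun h => ha (hl a h), List.count_eq_zero.2 ha]

theorem list_prod_X [DecidableEq B] (l : List B) :
    (l.map (MvPolynomial.X : B → MvPolynomial B K)).prod =
      MvPolynomial.monomial (Multiset.toFinsupp (l : Multiset B)) 1 := by
  induction l with
  | nil => simp
  | cons b l ih =>
    rw [List.map_cons, List.prod_cons, ih, ← Multiset.cons_coe, ← Multiset.singleton_add, map_add,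
      Multiset.toFinsupp_singleton, MvPolynomial.X, MvPolynomial.monomial_mul, mul_one]

theorem degree_toFinsupp [DecidableEq B] (l : List B) :
    (Multiset.toFinsupp (l : Multiset B)).degree = l.length := by
  rw [← Multiset.coe_card, ← Multiset.toFinsupp_toMultiset (l : Multiset B),
    Finsupp.card_toMultiset, Multiset.toFinsupp_toMultiset]
  rfl

/-- The exponents which are non-zero, supported on `C`, and of degree less than `k`. -/
def expSet (C : Set B) (k : ℕ) : Set (B →₀ ℕ) :=
  {m | m ≠ 0 ∧ (∀ b ∈ m.support, b ∈ C) ∧ m.degree < k}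

theorem toFinsupp_mem_expSet [DecidableEq B] {C : Set B} {l : List B} (hl : l ≠ [])
    (hC : ∀ b ∈ l, b ∈ C) {k : ℕ} (hk : l.length < k) :
    Multiset.toFinsupp (l : Multiset B) ∈ expSet C k := by
  refine ⟨?_, ?_, ?_⟩
  · intro h
    exact hl (by simpa using h)
  · intro b hb
    exact hC b (by simpa using hb)
  · rw [degree_toFinsupp]
    exact hk

theorem prod_sub_pbwMap_mem_shorter {bs : List B} (hbs : bs.Nodup) {C : Set B}
    (hCbs : ∀ b ∈ C, b ∈ bs)
    (hC : ∀ a ∈ C, ∀ b ∈ C, e a * e b - e b * e a ∈ Submodule.span K (e '' C))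
    (l : List B) (hl : ∀ b ∈ l, b ∈ C) :
    (l.map e).prod - pbwMap e K bs (l.map MvPolynomial.X).prod ∈ shorter e K C l.length := by
  classical
  rw [list_prod_X, pbwMap_monomial, one_smul, ordMonomial_eq_prod]
  exact prod_sub_prod_mem_shorter hC (perm_expList hbs l fun b hb => hCbs b (hl b hb)) hl

/-- Straightening by induction on the length: sorting a word costs only shorter words. Closure of
the span of `C` under commutators keeps every correction inside `C`, and since empty words never
occur no constant term is created. Both features are needed when `C` consists of the vectors of
positive weight. -/
theorem shorter_le_map_pbwMap {bs : List B} (hbs : bs.Nodup) {C : Set B}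
    (hCbs : ∀ b ∈ C, b ∈ bs)
    (hC : ∀ a ∈ C, ∀ b ∈ C, e a * e b - e b * e a ∈ Submodule.span K (e '' C)) (k : ℕ) :
    shorter e K C k ≤ (MvPolynomial.restrictSupport K (expSet C k)).map (pbwMap e K bs) := by
  classical
  induction k with
  | zero =>
    refine Submodule.span_le.2 ?_
    rintro a ⟨l, -, -, h, -⟩
    simp at h
  | succ k ih =>
    refine Submodule.span_le.2 ?_
    rintro a ⟨l, h1, h2, h3, rfl⟩
    have h := prod_sub_pbwMap_mem_shorter (K := K) hbs hCbs hC l h2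
    have h4 := ih (shorter_mono (Nat.lt_succ_iff.1 h3) h)
    rw [SetLike.mem_coe, ← sub_add_cancel (l.map e).prod
      (pbwMap e K bs (l.map MvPolynomial.X).prod)]
    refine add_mem (Submodule.map_mono (MvPolynomial.restrictSupport_mono _ ?_) h4)
      (Submodule.mem_map_of_mem ?_)
    · exact fun m hm => ⟨hm.1, hm.2.1, hm.2.2.trans (Nat.lt_succ_self k)⟩
    · rw [list_prod_X, MvPolynomial.monomial_mem_restrictSupport]
      exact Or.inl (toFinsupp_mem_expSet h1 h2 h3)

theorem pbwMap_one (bs : List B) : pbwMap e K bs 1 = 1 := by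
  rw [← MvPolynomial.C_1, MvPolynomial.C_apply, pbwMap_monomial, one_smul]
  exact ordMonomial_eq_one fun b _ => rfl

theorem pbwMap_X_pow {bs : List B} (hbs : bs.Nodup) {b : B} (hb : b ∈ bs) (k : ℕ) :
    pbwMap e K bs (MvPolynomial.X b ^ k) = e b ^ k := by
  classical
  rw [MvPolynomial.X_pow_eq_monomial, pbwMap_monomial, one_smul, ordMonomial,
    List.prod_map_eq_pow_single b _ fun a ha _ => by simp [ha.symm],
    List.count_eq_one_of_mem hbs hb]
  simp

theorem pbwMap_X {bs : List B} (hbs : bs.Nodup) {b : B} (hb : b ∈ bs) :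
    pbwMap e K bs (MvPolynomial.X b) = e b := by
  simpa using pbwMap_X_pow (e := e) (K := K) hbs hb 1

theorem mem_span_list_prod {k : ℕ} {P : MvPolynomial B K} (hP : P.totalDegree ≤ k) :
    P ∈ Submodule.span K
      {Q | ∃ l : List B, l.length ≤ k ∧ (l.map MvPolynomial.X).prod = Q} := by
  classical
  rw [P.as_sum]
  refine sum_mem fun m hm => ?_
  rw [← mul_one (MvPolynomial.coeff m P), ← smul_eq_mul, ← MvPolynomial.smul_monomial]
  refine Submodule.smul_mem _ _ (Submodule.subset_span ⟨(Finsupp.toMultiset m).toList, ?_, ?_⟩)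
  · rw [Multiset.length_toList, Finsupp.card_toMultiset]
    exact (MvPolynomial.le_totalDegree hm).trans hP
  · rw [list_prod_X, Multiset.coe_toList, Finsupp.toMultiset_toFinsupp]

/-! ### Multiplication and commutators up to terms of lower degree -/

section Full

variable {bs : List B} (hbs : bs.Nodup) (hall : ∀ b, b ∈ bs)
  (hB : ∀ a b, e a * e b - e b * e a ∈ Submodule.span K (Set.range e))

include hbs hall hB

theorem prod_sub_pbwMap_mem_shorter_univ (l : List B) :
    (l.map e).prod - pbwMap e K bs (l.map MvPolynomial.X).prod ∈
      shorter e K Set.univ l.length :=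
  prod_sub_pbwMap_mem_shorter hbs (fun b _ => hall b)
    (fun a _ b _ => by rw [Set.image_univ]; exact hB a b) l fun b _ => Set.mem_univ b

/-- For a monomial `Q` both terms are sorted forms of the same word of length at most `k + 1`, so
each differs from that word by shorter words only. -/
theorem pbwMap_X_mul_sub_mem (c : B) {k : ℕ} {Q : MvPolynomial B K} (hQ : Q.totalDegree ≤ k) :
    pbwMap e K bs (MvPolynomial.X c * Q) - e c * pbwMap e K bs Q ∈
      shorter e K Set.univ (k + 1) := by
  have h := mem_span_list_prod hQ
  clear hQ
  induction h using Submodule.span_induction with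
  | mem Q hQ =>
    obtain ⟨l, hl, rfl⟩ := hQ
    have h1 := prod_sub_pbwMap_mem_shorter_univ (K := K) hbs hall hB (c :: l)
    have h2 := mul_mem_shorter (Set.mem_univ c)
      (prod_sub_pbwMap_mem_shorter_univ (K := K) hbs hall hB l)
    have h3 := sub_mem h2 h1
    simp only [List.map_cons, List.prod_cons, mul_sub, sub_sub_sub_cancel_left] at h3
    exact shorter_mono (by omega) h3
  | zero => simp
  | add x y _ _ hx hy => simp only [mul_add, map_add, add_sub_add_comm]; exact add_mem hx hy
  | smul r x _ hx =>
    simp only [mul_smul_comm, map_smul, ← smul_sub]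
    exact Submodule.smul_mem _ _ hx

theorem pbwMap_linear_mul_sub_mem {s : MvPolynomial B K}
    (hs : s ∈ Submodule.span K (Set.range MvPolynomial.X)) {k : ℕ} {Q : MvPolynomial B K}
    (hQ : Q.totalDegree ≤ k) :
    pbwMap e K bs (s * Q) - pbwMap e K bs s * pbwMap e K bs Q ∈ shorter e K Set.univ (k + 1) := by
  induction hs using Submodule.span_induction with
  | mem s hs =>
    obtain ⟨c, rfl⟩ := hs
    rw [pbwMap_X hbs (hall c)]
    exact pbwMap_X_mul_sub_mem hbs hall hB c hQ
  | zero => simp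
  | add x y _ _ hx hy => simp only [add_mul, map_add, add_sub_add_comm]; exact add_mem hx hy
  | smul r x _ hx =>
    simp only [smul_mul_assoc, map_smul, ← smul_sub]
    exact Submodule.smul_mem _ _ hx

omit hbs hall hB in
theorem totalDegree_linear_le {s : MvPolynomial B K}
    (hs : s ∈ Submodule.span K (Set.range MvPolynomial.X)) : s.totalDegree ≤ 1 := by
  induction hs using Submodule.span_induction with
  | mem s hs => obtain ⟨c, rfl⟩ := hs; rw [MvPolynomial.totalDegree_X]
  | zero => simp
  | add x y _ _ hx hy => exact (MvPolynomial.totalDegree_add x y).trans (max_le hx hy)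
  | smul r x _ hx => exact (MvPolynomial.totalDegree_smul_le r x).trans hx

omit hbs hall hB in
theorem totalDegree_list_prod_X_le (l : List B) :
    (l.map (MvPolynomial.X : B → MvPolynomial B K)).prod.totalDegree ≤ l.length := by
  classical
  rw [list_prod_X, MvPolynomial.totalDegree_monomial _ one_ne_zero]
  exact (degree_toFinsupp l).le

omit hbs hall hB in
theorem totalDegree_mkDerivation_list_prod_le {s : B → MvPolynomial B K}
    (hs : ∀ a, s a ∈ Submodule.span K (Set.range MvPolynomial.X)) (l : List B) :
    (MvPolynomial.mkDerivation K s (l.map MvPolynomial.X).prod).totalDegree ≤ l.length := by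
  induction l with
  | nil => simp
  | cons a l ih =>
    rw [List.map_cons, List.prod_cons, Derivation.leibniz, MvPolynomial.mkDerivation_X,
      smul_eq_mul, smul_eq_mul]
    refine (MvPolynomial.totalDegree_add _ _).trans (max_le ?_ ?_)
    · refine (MvPolynomial.totalDegree_mul _ _).trans ?_
      rw [MvPolynomial.totalDegree_X, List.length_cons, add_comm]
      exact Nat.add_le_add_right ih 1
    · refine (MvPolynomial.totalDegree_mul _ _).trans ?_
      rw [List.length_cons]
      exact Nat.add_le_add (totalDegree_list_prod_X_le l) (totalDegree_linear_le (hs a))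

/-- Up to terms of lower degree, `pbwMap` intertwines a derivation of the polynomial ring with a
commutator. -/
theorem commutator_pbwMap_sub_mem {s : B → MvPolynomial B K}
    (hs : ∀ a, s a ∈ Submodule.span K (Set.range MvPolynomial.X)) {x : A}
    (hx : ∀ a, x * e a - e a * x = pbwMap e K bs (s a)) {k : ℕ} {P : MvPolynomial B K}
    (hP : P.totalDegree ≤ k) :
    x * pbwMap e K bs P - pbwMap e K bs P * x -
      pbwMap e K bs (MvPolynomial.mkDerivation K s P) ∈ shorter e K Set.univ k := by
  -- Bracketing with `x` preserves the span of the generators, and hence, by the Leibniz rule, the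
  -- filtration by word length (`hxs`).
  have hxl : ∀ y ∈ Submodule.span K (Set.range e),
      x * y - y * x ∈ Submodule.span K (Set.range e) := by
    intro y hy
    induction hy using Submodule.span_induction with
    | mem y hy =>
      obtain ⟨a, rfl⟩ := hy
      rw [hx a]
      have h := Submodule.mem_map_of_mem (f := pbwMap e K bs) (hs a)
      rw [Submodule.map_span, ← Set.range_comp] at h
      convert h using 3
      funext a
      exact (pbwMap_X hbs (hall a)).symm
    | zero => simp
    | add x y _ _ hx hy => rw [mul_add, add_mul, add_sub_add_comm]; exact add_mem hx hy
    | smul r x _ hx =>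
      rw [mul_smul_comm, smul_mul_assoc, ← smul_sub]
      exact Submodule.smul_mem _ _ hx
  have hxs : ∀ {k : ℕ} {y : A}, y ∈ shorter e K Set.univ k →
      x * y - y * x ∈ shorter e K Set.univ k := by
    intro k y hy
    induction hy using Submodule.span_induction with
    | mem y hy =>
      obtain ⟨l, -, -, h, rfl⟩ := hy
      refine shorter_mono (Nat.succ_le_of_lt h) ?_
      clear h
      induction l with
      | nil => simp
      | cons a l ih =>
        have h1 : x * ((a :: l).map e).prod - ((a :: l).map e).prod * x =
          (x * e a - e a * x) * (l.map e).prod +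
            e a * (x * (l.map e).prod - (l.map e).prod * x) := by
          simp only [List.map_cons, List.prod_cons]
          noncomm_ring
        rw [h1]
        refine add_mem ?_ (mul_mem_shorter (Set.mem_univ a) ih)
        refine mul_prod_mem_shorter ?_ fun b _ => Set.mem_univ b
        rw [Set.image_univ]
        exact hxl _ (Submodule.subset_span ⟨a, rfl⟩)
    | zero => simp
    | add x y _ _ hx hy => rw [mul_add, add_mul, add_sub_add_comm]; exact add_mem hx hy
    | smul r x _ hx =>
      rw [mul_smul_comm, smul_mul_assoc, ← smul_sub]
      exact Submodule.smul_mem _ _ hx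
  have h := mem_span_list_prod hP
  clear hP
  induction h using Submodule.span_induction with
  | mem Q hQ =>
    obtain ⟨l, hl, rfl⟩ := hQ
    refine shorter_mono hl ?_
    clear hl
    induction l with
    | nil => simp [pbwMap_one]
    | cons a l ih =>
      set Q := (l.map (MvPolynomial.X : B → MvPolynomial B K)).prod with hQ
      have hQd : Q.totalDegree ≤ l.length := totalDegree_list_prod_X_le l
      have h1 := pbwMap_X_mul_sub_mem (K := K) hbs hall hB a hQd
      have h2 := hxs h1
      have h3 := mul_mem_shorter (Set.mem_univ a) ih
      have h4 := pbwMap_linear_mul_sub_mem hbs hall hB (hs a) hQd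
      have h5 := pbwMap_X_mul_sub_mem (K := K) hbs hall hB a
        (totalDegree_mkDerivation_list_prod_le hs l)
      rw [← hQ] at h5
      rw [List.map_cons, List.prod_cons, ← hQ, Derivation.leibniz, MvPolynomial.mkDerivation_X,
        smul_eq_mul, smul_eq_mul, map_add, mul_comm Q (s a), List.length_cons]
      -- Expanding the commutator with `e a * Q` by the Leibniz rule leaves four errors: the bracket
      -- of `x` with the error in splitting off `e a`, the errors for the products `s a * Q` and `X
      -- a * D Q`, and `e a` times the inductive error.
      have := add_mem (sub_mem (sub_mem h2 h4) h5) h3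
      rw [← hx a] at this
      convert this using 1
      noncomm_ring
  | zero => simp
  | add x y _ _ hx hy =>
    simp only [mul_add, add_mul, map_add, add_sub_add_comm]; exact add_mem hx hy
  | smul r x _ hx =>
    simp only [mul_smul_comm, smul_mul_assoc, map_smul, Derivation.map_smul, ← smul_sub]
    exact Submodule.smul_mem _ _ hx

end Full

end Straightening

/-! ### Linear independence of ordered monomials -/

section Independence

variable {K A B : Type*} [Field K] [Ring A] [Algebra K A] {e : B → A}

theorem derivation_mem_pow {R S : Type*} [CommRing R] [CommRing S] [Algebra R S] (J : Ideal S)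
    (D : Derivation R S S) {k : ℕ} {f : S} (hf : f ∈ J ^ (k + 1)) : D f ∈ J ^ k := by
  induction k generalizing f with
  | zero => simp
  | succ k ih =>
    rw [pow_succ] at hf
    induction hf using Submodule.mul_induction_on' with
    | mem_mul_mem a ha b hb =>
      rw [Derivation.leibniz, smul_eq_mul, smul_eq_mul]
      refine add_mem (Ideal.mul_mem_right _ _ ha) ?_
      rw [pow_succ, mul_comm b]
      exact Ideal.mul_mem_mul (ih ha) hb
    | add x _ y _ hx hy => rw [map_add]; exact add_mem hx hy

theorem derivation_mem_pow_of_stable {R S : Type*} [CommRing R] [CommRing S] [Algebra R S]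
    (J : Ideal S) (D : Derivation R S S) (hD : ∀ f ∈ J, D f ∈ J) {k : ℕ} {f : S}
    (hf : f ∈ J ^ k) : D f ∈ J ^ k := by
  induction k generalizing f with
  | zero => simp
  | succ k ih =>
    rw [pow_succ] at hf
    induction hf using Submodule.mul_induction_on' with
    | mem_mul_mem a ha b hb =>
      rw [Derivation.leibniz, smul_eq_mul, smul_eq_mul, pow_succ]
      refine add_mem (Ideal.mul_mem_mul ha (hD b hb)) ?_
      rw [mul_comm b]
      exact Ideal.mul_mem_mul (ih ha) hb
    | add x _ y _ hx hy => rw [map_add]; exact add_mem hx hy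

theorem toFinsupp_expList [DecidableEq B] {bs : List B} (hbs : bs.Nodup) (hall : ∀ b, b ∈ bs)
    (m : B →₀ ℕ) : Multiset.toFinsupp (expList bs m : Multiset B) = m := by
  have h := perm_expList hbs (Finsupp.toMultiset m).toList fun b _ => hall b
  rw [Multiset.coe_toList, Finsupp.toMultiset_toFinsupp] at h
  rw [← Multiset.coe_eq_coe.2 h, Multiset.coe_toList, Finsupp.toMultiset_toFinsupp]

/-- The constant collects the exponents brought down by differentiation, hence is non-zero in
characteristic zero. At `n = 0` this says that monomials pair diagonally with iterated partial
derivatives. -/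
theorem coeff_list_pderiv [CharZero K] [DecidableEq B] (l : List B) (n : B →₀ ℕ) :
    ∃ c : K, c ≠ 0 ∧ ∀ f : MvPolynomial B K,
      MvPolynomial.coeff n ((l.map fun b => (MvPolynomial.pderiv b :
        Derivation K (MvPolynomial B K) (MvPolynomial B K)).toLinearMap).prod f) =
        c * MvPolynomial.coeff (n + Multiset.toFinsupp (l : Multiset B)) f := by
  induction l generalizing n with
  | nil => exact ⟨1, one_ne_zero, fun f => by simp⟩
  | cons a l ih =>
    obtain ⟨c, hc, h⟩ := ih (n + Finsupp.single a 1)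
    refine ⟨c * (n a + 1), mul_ne_zero hc (by exact_mod_cast (n a).succ_ne_zero), fun f => ?_⟩
    rw [List.map_cons, List.prod_cons, Module.End.mul_apply]
    change MvPolynomial.coeff n (MvPolynomial.pderiv a _) = _
    rw [MvPolynomial.coeff_pderiv, h, ← Multiset.cons_coe,
      ← Multiset.singleton_add, map_add, Multiset.toFinsupp_singleton, add_assoc]
    ring

variable [DecidableEq B] {D : B → Derivation K (MvPolynomial B K) (MvPolynomial B K)}
  (hD : ∀ b c, D b (MvPolynomial.X c) - (if b = c then 1 else 0) ∈ MvPolynomial.idealOfVars B K)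

include hD

/-- The derivation `D b - ∂_b` sends every variable into the ideal of the origin, so it preserves
that ideal and all its powers; a single derivation alone may lower the order by one. -/
theorem derivation_sub_pderiv_mem (b : B) {k : ℕ} {f : MvPolynomial B K}
    (hf : f ∈ MvPolynomial.idealOfVars B K ^ k) :
    D b f - MvPolynomial.pderiv b f ∈ MvPolynomial.idealOfVars B K ^ k := by
  refine derivation_mem_pow_of_stable _ (D b - MvPolynomial.pderiv b) (fun f hf => ?_) hf
  rw [MvPolynomial.idealOfVars] at hf
  induction hf using Submodule.span_induction with
  | mem x hx =>
    obtain ⟨c, rfl⟩ := hx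
    convert hD b c using 1
    rw [Derivation.sub_apply, MvPolynomial.pderiv_X, Pi.single_apply]
    simp only [eq_comm]
  | zero => simp
  | add x y _ _ hx hy => rw [map_add]; exact add_mem hx hy
  | smul r x hx' hx =>
    rw [smul_eq_mul, Derivation.leibniz, smul_eq_mul, smul_eq_mul]
    exact add_mem (Ideal.mul_mem_left _ _ hx) (Ideal.mul_mem_right _ _ hx')

/-- Each derivation lowers the order of vanishing by at most one, while replacing one `D b` by `∂_b`
costs a term whose order is not lowered. The two composites therefore agree to one order more than
expected. -/
theorem list_derivation_mem (l : List B) (q : ℕ) {f : MvPolynomial B K}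
    (hf : f ∈ MvPolynomial.idealOfVars B K ^ (q + l.length)) :
    (l.map fun b => (D b).toLinearMap).prod f ∈ MvPolynomial.idealOfVars B K ^ q ∧
    (l.map fun b => (MvPolynomial.pderiv b :
        Derivation K (MvPolynomial B K) (MvPolynomial B K)).toLinearMap).prod f ∈
        MvPolynomial.idealOfVars B K ^ q ∧
    (l.map fun b => (D b).toLinearMap).prod f -
      (l.map fun b => (MvPolynomial.pderiv b :
        Derivation K (MvPolynomial B K) (MvPolynomial B K)).toLinearMap).prod f ∈
        MvPolynomial.idealOfVars B K ^ (q + 1) := by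
  induction l generalizing q with
  | nil => simpa using hf
  | cons a l ih =>
    obtain ⟨h1, h2, h3⟩ := ih (q + 1) (by rwa [add_assoc, add_comm 1])
    simp only [List.map_cons, List.prod_cons, Module.End.mul_apply]
    refine ⟨derivation_mem_pow _ _ h1, derivation_mem_pow _ _ h2, ?_⟩
    have h4 := derivation_mem_pow _ (D a) h3
    have h5 := derivation_sub_pderiv_mem hD a h2
    have := add_mem h4 h5
    rw [map_sub, sub_add_sub_cancel] at this
    exact this

/-- If the ring `A` acts on polynomials in such a way that `e b` acts by a derivation which agrees
with the partial derivative at the origin, then the ordered monomials are linearly independent. -/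
theorem pbwMap_injective_of_derivations [CharZero K]
    (π : A →ₐ[K] Module.End K (MvPolynomial B K)) (hπ : ∀ b, π (e b) = (D b).toLinearMap)
    {bs : List B} (hbs : bs.Nodup) (hall : ∀ b, b ∈ bs) :
    Function.Injective (pbwMap e K bs) := by
  rw [injective_iff_map_eq_zero]
  intro P hP
  by_contra hne
  -- The test function is the monomial of an exponent `m` of top degree in `P`. The constant term of
  -- the result of applying `pbwMap P` to it will be a non-zero multiple of the coefficient of `m`.
  obtain ⟨m, hm, hmd⟩ := Finset.exists_mem_eq_sup P.support
    (MvPolynomial.support_nonempty.2 hne) fun m => m.degree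
  have hmax : ∀ m' ∈ P.support, m'.degree ≤ m.degree := fun m' hm' => by
    rw [← hmd]; exact Finset.le_sup (f := fun m => m.degree) hm'
  have hlen : ∀ m' : B →₀ ℕ, (expList bs m').length = m'.degree := fun m' => by
    rw [← degree_toFinsupp, toFinsupp_expList hbs hall]
  have hmem : MvPolynomial.monomial m (1 : K) ∈ MvPolynomial.idealOfVars B K ^ m.degree := by
    rw [MvPolynomial.mem_pow_idealOfVars_iff]
    intro x hx
    rw [Finset.mem_singleton.1 (MvPolynomial.support_monomial_subset hx)]
  have hop : ∀ m', π (ordMonomial e bs m') =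
      ((expList bs m').map fun b => (D b).toLinearMap).prod := fun m' => by
    rw [ordMonomial_eq_prod, map_list_prod, List.map_map]
    congr 2
    funext b
    exact hπ b
  have hzero : ∀ {f : MvPolynomial B K} {q : ℕ}, f ∈ MvPolynomial.idealOfVars B K ^ (q + 1) →
      MvPolynomial.coeff 0 f = 0 := fun {f q} hf =>
    (MvPolynomial.mem_pow_idealOfVars_iff' _ _).1 hf 0 (by simp)
  have heq : ∀ m' : B →₀ ℕ, m'.degree = m.degree → ∃ c : K, c ≠ 0 ∧
      MvPolynomial.coeff 0 (π (ordMonomial e bs m') (MvPolynomial.monomial m 1)) =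
        c * MvPolynomial.coeff m' (MvPolynomial.monomial m 1) := by
    intro m' hm'
    obtain ⟨c, hc, h⟩ := coeff_list_pderiv (K := K) (expList bs m') 0
    refine ⟨c, hc, ?_⟩
    have h1 := (list_derivation_mem hD (expList bs m') 0 (f := MvPolynomial.monomial m 1)
      (by rw [hlen, hm', zero_add]; exact hmem)).2.2
    have h2 := hzero h1
    rw [MvPolynomial.coeff_sub, sub_eq_zero] at h2
    rw [hop, h2, h, zero_add, toFinsupp_expList hbs hall]
  -- Exponents of smaller degree do not differentiate often enough to leave a constant term; those
  -- of equal degree act on leading terms by partial derivatives, whose pairing with `m` is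
  -- diagonal.
  have key : ∀ m' ∈ P.support, m' ≠ m →
      MvPolynomial.coeff 0 (π (ordMonomial e bs m') (MvPolynomial.monomial m 1)) = 0 := by
    intro m' hm' hne'
    rcases (hmax m' hm').lt_or_eq with hlt | heq'
    · obtain ⟨q, hq⟩ := Nat.exists_eq_add_of_lt hlt
      rw [hop]
      refine hzero (q := q) (list_derivation_mem hD (expList bs m') (q + 1) ?_).1
      rw [hlen, show q + 1 + m'.degree = m.degree by omega]
      exact hmem
    · obtain ⟨c, -, h⟩ := heq m' heq'
      rw [h, MvPolynomial.coeff_monomial, if_neg (Ne.symm hne'), mul_zero]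
  obtain ⟨c, hc, h⟩ := heq m rfl
  rw [MvPolynomial.coeff_monomial, if_pos rfl, mul_one] at h
  have h0 : MvPolynomial.coeff 0 (π (pbwMap e K bs P) (MvPolynomial.monomial m 1)) = 0 := by
    rw [hP, map_zero, LinearMap.zero_apply, MvPolynomial.coeff_zero]
  rw [P.as_sum, map_sum, map_sum, LinearMap.sum_apply, MvPolynomial.coeff_sum,
    Finset.sum_eq_single m] at h0
  · rw [pbwMap_monomial, map_smul, LinearMap.smul_apply, MvPolynomial.coeff_smul, h] at h0
    exact mul_ne_zero (MvPolynomial.mem_support_iff.1 hm) hc h0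
  · intro m' hm' hne'
    rw [pbwMap_monomial, map_smul, LinearMap.smul_apply, MvPolynomial.coeff_smul,
      key m' hm' hne', smul_zero]
  · exact fun h => absurd hm h

end Independence

/-! ### Lie algebras with matrix units -/

/-- A basis of matrix units identifies a Lie algebra with a product, indexed by `I`, of copies of
`𝔤𝔩_κ`. -/
structure MatrixUnits (K 𝔤 I κ : Type*) [Field K] [LieRing 𝔤] [LieAlgebra K 𝔤] [DecidableEq I]
    [DecidableEq κ] where
  /-- The basis; the vector with index `(s, i, j)` is the matrix unit `E_ij` in the factor `s`. -/
  basis : Module.Basis (I × κ × κ) K 𝔤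
  lie_basis : ∀ s i j t k l, ⁅basis (s, i, j), basis (t, k, l)⁆ =
    if s = t then (if j = k then basis (s, i, l) else 0) - (if l = i then basis (s, k, j) else 0)
    else 0

theorem map_lie_of_basis {K 𝔤 𝔥 B : Type*} [Field K] [LieRing 𝔤] [LieAlgebra K 𝔤] [LieRing 𝔥]
    [LieAlgebra K 𝔥] (b : Module.Basis B K 𝔤) (f : 𝔤 →ₗ[K] 𝔥)
    (h : ∀ i j, f ⁅b i, b j⁆ = ⁅f (b i), f (b j)⁆) (x y : 𝔤) : f ⁅x, y⁆ = ⁅f x, f y⁆ := by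
  have := LinearMap.ext_basis b b
    (B := (LieModule.toEnd K 𝔤 𝔤 : 𝔤 →ₗ[K] Module.End K 𝔤).compr₂ f)
    (B' := (LieModule.toEnd K 𝔥 𝔥 : 𝔥 →ₗ[K] Module.End K 𝔥).compl₁₂ f f) h
  exact LinearMap.congr_fun₂ this x y

namespace MatrixUnits

variable {K 𝔤 I κ : Type*} [Field K] [LieRing 𝔤] [LieAlgebra K 𝔤] [DecidableEq I]
    [DecidableEq κ] (M : MatrixUnits K 𝔤 I κ)

/-- The image of a matrix unit in the universal enveloping algebra. -/
def e (b : I × κ × κ) : UniversalEnvelopingAlgebra K 𝔤 :=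
  UniversalEnvelopingAlgebra.ι K (M.basis b)

/-- The action of matrix units on polynomial functions on matrices, in coordinates centred at the
identity matrix. -/
def der (b : I × κ × κ) : Derivation K (MvPolynomial (I × κ × κ) K) (MvPolynomial (I × κ × κ) K) :=
  MvPolynomial.mkDerivation K fun c => if b.1 = c.1 ∧ c.2.2 = b.2.2 then
    MvPolynomial.X (b.1, c.2.1, b.2.1) + (if c.2.1 = b.2.1 then 1 else 0) else 0

/-- The coordinate functions of a matrix. -/
def coord (K : Type*) [Field K] (c : I × κ × κ) : MvPolynomial (I × κ × κ) K :=
  MvPolynomial.X c + (if c.2.1 = c.2.2 then 1 else 0)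

theorem der_X (s : I) (i j : κ) (t : I) (a m : κ) :
    (der (s, i, j) : Derivation K (MvPolynomial (I × κ × κ) K) _) (MvPolynomial.X (t, a, m)) =
      if s = t ∧ m = j then coord K (s, a, i) else 0 :=
  MvPolynomial.mkDerivation_X _ _ _

theorem der_coord (s : I) (i j : κ) (t : I) (a m : κ) :
    (der (s, i, j) : Derivation K (MvPolynomial (I × κ × κ) K) _) (coord K (t, a, m)) =
      if s = t ∧ m = j then coord K (s, a, i) else 0 := by
  rw [coord, map_add, der_X]
  split_ifs <;> simp

/-- The derivation `der (s, i, j)` is differentiation of a function of `g` in the direction `g *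
E_ij`, a left-invariant vector field. These fields bracket as matrix units do, and it is enough to
check this on coordinates. -/
theorem lie_der (s : I) (i j : κ) (t : I) (k l : κ) :
    ⁅(der (s, i, j) : Derivation K (MvPolynomial (I × κ × κ) K) (MvPolynomial (I × κ × κ) K)),
      (der (t, k, l) : Derivation K (MvPolynomial (I × κ × κ) K) (MvPolynomial (I × κ × κ) K))⁆ =
      if s = t then (if j = k then der (s, i, l) else 0) - (if l = i then der (s, k, j) else 0)
      else 0 := by
  refine MvPolynomial.derivation_ext fun c => ?_
  obtain ⟨u, a, m⟩ := c
  have h0 : ∀ (r : I) (p q : κ) (P : Prop) [Decidable P] (f : MvPolynomial (I × κ × κ) K),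
      (der (r, p, q) : Derivation K (MvPolynomial (I × κ × κ) K) _) (if P then f else 0) =
        if P then der (r, p, q) f else 0 := by
    intro r p q P _ f
    split_ifs <;> simp
  have h1 : ∀ (P : Prop) [Decidable P]
      (d : Derivation K (MvPolynomial (I × κ × κ) K) (MvPolynomial (I × κ × κ) K))
      (f : MvPolynomial (I × κ × κ) K), (if P then d else 0) f = if P then d f else 0 := by
    intro P _ d f
    split_ifs <;> simp
  rw [Derivation.commutator_apply, der_X, der_X, h0, h0, der_coord, der_coord, h1,
    Derivation.sub_apply, h1, h1, der_X, der_X]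
  by_cases hst : s = t
  · subst hst
    by_cases hsu : s = u
    · subst hsu
      simp only [true_and, if_true]
      grind
    · simp [hsu]
  · simp [hst, Ne.symm hst]

/-- The representation of the Lie algebra on polynomial functions. -/
def polyRep : 𝔤 →ₗ⁅K⁆ Module.End K (MvPolynomial (I × κ × κ) K) :=
  { toFun := fun x => (M.basis.constr K der x).toLinearMap
    map_add' := fun x y => by rw [map_add]; rfl
    map_smul' := fun r x => by rw [map_smul]; rfl
    map_lie' := fun {x y} => by
      have h := map_lie_of_basis M.basis (M.basis.constr K (der (K := K))) (fun b c => by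
        obtain ⟨s, i, j⟩ := b
        obtain ⟨t, k, l⟩ := c
        rw [M.lie_basis, M.basis.constr_basis, M.basis.constr_basis, lie_der]
        split_ifs <;> simp [M.basis.constr_basis]) x y
      change (M.basis.constr K der ⁅x, y⁆).toLinearMap = _
      rw [h]
      exact Derivation.commutator_coe_linear_map }

theorem commutator_mem_span (a b : I × κ × κ) :
    M.e a * M.e b - M.e b * M.e a ∈ Submodule.span K (Set.range M.e) := by
  obtain ⟨s, i, j⟩ := a
  obtain ⟨t, k, l⟩ := b
  have hm : ∀ b, UniversalEnvelopingAlgebra.ι K (M.basis b) ∈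
    Submodule.span K (Set.range M.e) := fun b => Submodule.subset_span ⟨b, rfl⟩
  rw [← LieRing.of_associative_ring_bracket, e, e, ← LieHom.map_lie, M.lie_basis]
  split_ifs <;> simp only [map_sub, map_neg, map_zero, sub_zero, zero_sub, sub_self]
  · exact sub_mem (hm _) (hm _)
  · exact hm _
  · exact neg_mem (hm _)
  · exact zero_mem _
  · exact zero_mem _

/-- At the identity matrix, which is the origin of the coordinates, the invariant field of `E_ij` is
the partial derivative in the entry `(i, j)`. This is the hypothesis of
`pbwMap_injective_of_derivations`. -/
theorem pbwMap_injective [CharZero K] {bs : List (I × κ × κ)} (hbs : bs.Nodup)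
    (hall : ∀ b, b ∈ bs) : Function.Injective (pbwMap M.e K bs) := by
  refine pbwMap_injective_of_derivations (D := der) ?_
    (UniversalEnvelopingAlgebra.lift K M.polyRep) ?_ hbs hall
  · rintro ⟨s, i, j⟩ ⟨t, k, l⟩
    rw [der_X, coord]
    have hX : ∀ b, (MvPolynomial.X b : MvPolynomial (I × κ × κ) K) ∈
      MvPolynomial.idealOfVars (I × κ × κ) K := fun b => Ideal.subset_span ⟨b, rfl⟩
    by_cases h : s = t ∧ l = j
    · obtain ⟨rfl, rfl⟩ := h
      simpa [Prod.ext_iff, eq_comm] using hX _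
    · rw [if_neg h, if_neg, sub_zero]
      · exact zero_mem _
      · rintro ⟨⟩
        exact h ⟨rfl, rfl⟩
  · intro b
    rw [e, UniversalEnvelopingAlgebra.lift_ι_apply]
    change (M.basis.constr K der (M.basis b)).toLinearMap = _
    rw [M.basis.constr_basis]

end MatrixUnits

/-! ### Generation of the universal enveloping algebra -/

section Generation

variable {K 𝔤 B : Type*} [Field K] [LieRing 𝔤] [LieAlgebra K 𝔤]

/-- By the universal property the inclusion of the generated subalgebra has a right inverse, so it
is onto. -/
theorem adjoin_range_ι : Algebra.adjoin K
    (Set.range (UniversalEnvelopingAlgebra.ι K : 𝔤 → UniversalEnvelopingAlgebra K 𝔤)) = ⊤ := by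
  set S := Algebra.adjoin K
    (Set.range (UniversalEnvelopingAlgebra.ι K : 𝔤 → UniversalEnvelopingAlgebra K 𝔤)) with hS
  let g : 𝔤 →ₗ⁅K⁆ S :=
    { toFun := fun x => ⟨UniversalEnvelopingAlgebra.ι K x, Algebra.subset_adjoin ⟨x, rfl⟩⟩
      map_add' := fun x y => Subtype.ext (map_add _ _ _)
      map_smul' := fun r x => Subtype.ext (map_smul _ _ _)
      map_lie' := fun {x y} => Subtype.ext (LieHom.map_lie _ _ _) }
  have h : S.val.comp (UniversalEnvelopingAlgebra.lift K g) = AlgHom.id K _ := by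
    apply UniversalEnvelopingAlgebra.hom_ext
    ext x
    change ((UniversalEnvelopingAlgebra.lift K g) (UniversalEnvelopingAlgebra.ι K x) :
      UniversalEnvelopingAlgebra K 𝔤) = UniversalEnvelopingAlgebra.ι K x
    rw [UniversalEnvelopingAlgebra.lift_ι_apply]
    rfl
  rw [eq_top_iff]
  intro x _
  have := AlgHom.congr_fun h x
  rw [AlgHom.id_apply] at this
  rw [← this]
  exact (UniversalEnvelopingAlgebra.lift K g x).2

/-- A left-stable subspace which contains `1` is everything. -/
theorem mem_of_left_stable (b : Module.Basis B K 𝔤)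
    (V : Submodule K (UniversalEnvelopingAlgebra K 𝔤))
    (h1 : 1 ∈ V) (hV : ∀ i, ∀ x ∈ V, UniversalEnvelopingAlgebra.ι K (b i) * x ∈ V)
    (x : UniversalEnvelopingAlgebra K 𝔤) : x ∈ V := by
  have h2 : ∀ y : 𝔤, ∀ x ∈ V, UniversalEnvelopingAlgebra.ι K y * x ∈ V := by
    intro y x hx
    have hy : y ∈ Submodule.span K (Set.range b) := by rw [b.span_eq]; trivial
    induction hy using Submodule.span_induction with
    | mem y hy => obtain ⟨i, rfl⟩ := hy; exact hV i x hx
    | zero => simp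
    | add y z _ _ hy hz => rw [map_add, add_mul]; exact add_mem hy hz
    | smul r y _ hy => rw [map_smul, smul_mul_assoc]; exact V.smul_mem _ hy
  have h3 : ∀ u : UniversalEnvelopingAlgebra K 𝔤, ∀ x ∈ V, u * x ∈ V := by
    intro u
    have hu : u ∈ Algebra.adjoin K
      (Set.range (UniversalEnvelopingAlgebra.ι K : 𝔤 → UniversalEnvelopingAlgebra K 𝔤)) := by
      rw [adjoin_range_ι]; trivial
    induction hu using Algebra.adjoin_induction with
    | mem u hu => obtain ⟨y, rfl⟩ := hu; exact h2 y
    | algebraMap r => intro x hx; rw [← Algebra.smul_def]; exact V.smul_mem _ hx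
    | add u v _ _ hu hv => intro x hx; rw [add_mul]; exact add_mem (hu x hx) (hv x hx)
    | mul u v _ _ hu hv => intro x hx; rw [mul_assoc]; exact hu _ (hv x hx)
  simpa using h3 x 1 h1

theorem mem_center_of_commute (b : Module.Basis B K 𝔤) {u : UniversalEnvelopingAlgebra K 𝔤}
    (hu : ∀ i, UniversalEnvelopingAlgebra.ι K (b i) * u =
      u * UniversalEnvelopingAlgebra.ι K (b i)) :
    u ∈ Subalgebra.center K (UniversalEnvelopingAlgebra K 𝔤) := by
  rw [Subalgebra.mem_center_iff]
  let V : Submodule K (UniversalEnvelopingAlgebra K 𝔤) :=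
    LinearMap.ker (LinearMap.mulRight K u - LinearMap.mulLeft K u)
  have hV : ∀ x, x ∈ V ↔ x * u = u * x := fun x => by
    rw [LinearMap.mem_ker, LinearMap.sub_apply, sub_eq_zero]; rfl
  intro x
  rw [← hV]
  refine mem_of_left_stable b V (by rw [hV]; simp) (fun i x hx => ?_) x
  rw [hV] at hx ⊢
  rw [mul_assoc, hx, ← mul_assoc, hu, mul_assoc]

theorem commutator_basis_mem_span (b : Module.Basis B K 𝔤) (i j : B) :
    UniversalEnvelopingAlgebra.ι K (b i) * UniversalEnvelopingAlgebra.ι K (b j) -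
      UniversalEnvelopingAlgebra.ι K (b j) * UniversalEnvelopingAlgebra.ι K (b i) ∈
      Submodule.span K (Set.range fun i => UniversalEnvelopingAlgebra.ι K (b i)) := by
  rw [← LieRing.of_associative_ring_bracket, ← LieHom.map_lie]
  have h : ⁅b i, b j⁆ ∈ Submodule.span K (Set.range b) := by rw [b.span_eq]; trivial
  have h2 := Submodule.mem_map_of_mem
    (f := (UniversalEnvelopingAlgebra.ι K : 𝔤 →ₗ⁅K⁆ UniversalEnvelopingAlgebra K 𝔤).toLinearMap) h
  rw [Submodule.map_span, ← Set.range_comp] at h2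
  exact h2

/-- The range contains `1` and is stable under left multiplication by basis vectors, since `e i`
times an ordered combination is ordered up to shorter words, which straighten in turn. -/
theorem pbwMap_surjective (b : Module.Basis B K 𝔤) {bs : List B} (hbs : bs.Nodup)
    (hall : ∀ i, i ∈ bs) :
    Function.Surjective (pbwMap (fun i => UniversalEnvelopingAlgebra.ι K (b i)) K bs) := by
  rw [← LinearMap.range_eq_top, eq_top_iff]
  rintro x -
  refine mem_of_left_stable b _ (LinearMap.mem_range.2 ⟨1, pbwMap_one bs⟩) ?_ x
  rintro i _ ⟨Q, rfl⟩
  have h1 := pbwMap_X_mul_sub_mem (K := K) hbs hall (commutator_basis_mem_span b) i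
    (le_refl Q.totalDegree)
  have h2 := shorter_le_map_pbwMap hbs (fun b _ => hall b)
    (fun a _ c _ => by rw [Set.image_univ]; exact commutator_basis_mem_span b a c) _ h1
  have h3 := LinearMap.map_le_range h2
  have := sub_mem (LinearMap.mem_range_self
    (pbwMap (fun i => UniversalEnvelopingAlgebra.ι K (b i)) K bs) (MvPolynomial.X i * Q)) h3
  rwa [sub_sub_cancel] at this

end Generation

/-! ### The Harish-Chandra homomorphism of a graded Lie algebra -/

/-- A basis of eigenvectors of `ad h` with integral eigenvalues, for which the ordered monomials in
the universal enveloping algebra are linearly independent. -/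
structure WeightBasis (K 𝔤 B : Type*) [Field K] [LieRing 𝔤] [LieAlgebra K 𝔤] where
  /-- The basis. -/
  basis : Module.Basis B K 𝔤
  /-- The grading element. -/
  h : 𝔤
  /-- The weights. -/
  w : B → ℤ
  lie_h : ∀ b, ⁅h, basis b⁆ = (w b : K) • basis b
  pbw : ∀ bs : List B, bs.Nodup → (∀ b, b ∈ bs) →
    Function.Injective (pbwMap (fun b => UniversalEnvelopingAlgebra.ι K (basis b)) K bs)

namespace WeightBasis

variable {K 𝔤 B : Type*} [Field K] [LieRing 𝔤] [LieAlgebra K 𝔤]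
  (W : WeightBasis K 𝔤 B)

/-- The basis vectors in the universal enveloping algebra. -/
def e (b : B) : UniversalEnvelopingAlgebra K 𝔤 := UniversalEnvelopingAlgebra.ι K (W.basis b)

/-- The left ideal generated by the elements of positive weight. -/
def nil : Ideal (UniversalEnvelopingAlgebra K 𝔤) := Ideal.span (W.e '' {b | 0 < W.w b})

theorem repr_lie_h (x : 𝔤) (c : B) : W.basis.repr ⁅W.h, x⁆ c = W.w c * W.basis.repr x c := by
  have hx : x ∈ Submodule.span K (Set.range W.basis) := by rw [W.basis.span_eq]; trivial
  induction hx using Submodule.span_induction with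
  | mem x hx =>
    obtain ⟨b, rfl⟩ := hx
    classical
    rw [W.lie_h, map_smul, Finsupp.smul_apply, W.basis.repr_self, Finsupp.single_apply]
    split_ifs with h <;> simp [h]
  | zero => simp
  | add x y _ _ hx hy => rw [lie_add, map_add, map_add, Finsupp.add_apply, hx, hy]; simp [mul_add]
  | smul r x _ hx =>
    rw [lie_smul, map_smul, map_smul, Finsupp.smul_apply, hx]
    simp [mul_left_comm]

theorem span_le_nil {x : UniversalEnvelopingAlgebra K 𝔤}
    (hx : x ∈ Submodule.span K (W.e '' {b | 0 < W.w b})) : x ∈ W.nil :=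
  Submodule.span_le_restrictScalars K (UniversalEnvelopingAlgebra K 𝔤) _ hx

theorem nil_induction {p : UniversalEnvelopingAlgebra K 𝔤 → Prop} (h0 : p 0)
    (hadd : ∀ x y, p x → p y → p (x + y))
    (h : ∀ u b, 0 < W.w b → p (u * W.e b)) {x} (hx : x ∈ W.nil) : p x := by
  refine Submodule.closure_induction (p := fun x _ => p x) h0 (fun x y _ _ => hadd x y) ?_ hx
  rintro r _ ⟨b, hb, rfl⟩
  exact h r b hb

theorem prod_mem_nil {l : List B} (hl : l ≠ []) (h : ∀ b ∈ l, 0 < W.w b) :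
    (l.map W.e).prod ∈ W.nil := by
  rw [← List.dropLast_append_getLast hl, List.map_append, List.prod_append]
  refine Ideal.mul_mem_left _ _ ?_
  simp only [List.map_cons, List.map_nil, List.prod_cons, List.prod_nil, mul_one]
  exact Ideal.subset_span ⟨_, h _ (List.getLast_mem hl), rfl⟩

variable [CharZero K]

/-- By the Jacobi identity the bracket is an eigenvector of `ad h` with eigenvalue `w a + w b`;
characteristic zero lets integral weights be compared through their images in `K`. -/
theorem lie_mem_span (a b : B) :
    ⁅W.basis a, W.basis b⁆ ∈ Submodule.span K (W.basis '' {c | W.w c = W.w a + W.w b}) := by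
  rw [W.basis.mem_span_image]
  intro c hc
  have h1 := W.repr_lie_h ⁅W.basis a, W.basis b⁆ c
  rw [leibniz_lie, W.lie_h, W.lie_h, smul_lie, lie_smul, ← add_smul, map_smul, Finsupp.smul_apply,
    smul_eq_mul] at h1
  have h2 := mul_right_cancel₀ (Finsupp.mem_support_iff.1 hc) h1
  change W.w c = _
  exact_mod_cast h2.symm

theorem commutator_mem (a b : B) : W.e a * W.e b - W.e b * W.e a ∈
    Submodule.span K (W.e '' {c | W.w c = W.w a + W.w b}) := by
  rw [← LieRing.of_associative_ring_bracket, e, e, ← LieHom.map_lie]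
  have h2 := Submodule.mem_map_of_mem
    (f := (UniversalEnvelopingAlgebra.ι K : 𝔤 →ₗ⁅K⁆ UniversalEnvelopingAlgebra K 𝔤).toLinearMap)
    (W.lie_mem_span a b)
  rw [Submodule.map_span, ← Set.image_comp] at h2
  exact h2

theorem commutator_mem_pos (a : B) (ha : 0 < W.w a) (b : B) (hb : 0 ≤ W.w b) :
    W.e a * W.e b - W.e b * W.e a ∈ Submodule.span K (W.e '' {b | 0 < W.w b}) := by
  refine Submodule.span_mono (Set.image_mono ?_) (W.commutator_mem a b)
  intro c hc
  change 0 < W.w c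
  rw [hc]
  omega

/-- A positive vector moves to the right past `e b` at the cost of a commutator which still has
positive weight. -/
theorem nil_mul_mem {x : UniversalEnvelopingAlgebra K 𝔤} (hx : x ∈ W.nil) {b : B}
    (hb : 0 ≤ W.w b) : x * W.e b ∈ W.nil := by
  refine W.nil_induction (p := fun x => x * W.e b ∈ W.nil) (by simp)
    (fun x y hx hy => by rw [add_mul]; exact add_mem hx hy) (fun u a ha => ?_) hx
  rw [mul_assoc, ← sub_add_cancel (W.e a * W.e b) (W.e b * W.e a), mul_add]
  refine add_mem (Ideal.mul_mem_left _ _ (W.span_le_nil (W.commutator_mem_pos a ha b hb))) ?_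
  rw [← mul_assoc]
  exact Ideal.mul_mem_left _ _ (Ideal.subset_span ⟨a, ha, rfl⟩)

variable [Fintype B]

/-- An enumeration of the basis, by increasing sign of the weight: the part of non-positive
weight. -/
def enumNonpos : List B :=
  (Finset.univ.filter fun b => W.w b < 0).toList ++ (Finset.univ.filter fun b => W.w b = 0).toList

/-- The enumeration of the basis vectors of positive weight. -/
def enumPos : List B := (Finset.univ.filter fun b => 0 < W.w b).toList

/-- The enumeration of the basis by increasing sign of the weight. -/
def enum : List B := W.enumNonpos ++ W.enumPos

omit [CharZero K] in
theorem mem_enumPos {b : B} : b ∈ W.enumPos ↔ 0 < W.w b := by simp [enumPos]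

omit [CharZero K] in
theorem mem_enumNonpos {b : B} : b ∈ W.enumNonpos ↔ W.w b ≤ 0 := by
  simp [enumNonpos, le_iff_lt_or_eq]

omit [CharZero K] in
theorem mem_enum (b : B) : b ∈ W.enum := by
  rw [enum, List.mem_append, mem_enumPos, mem_enumNonpos]
  exact le_or_gt _ _

omit [CharZero K] in
theorem nodup_enum : W.enum.Nodup := by
  rw [enum, List.nodup_append', enumNonpos, List.nodup_append']
  refine ⟨⟨Finset.nodup_toList _, Finset.nodup_toList _, ?_⟩, Finset.nodup_toList _, ?_⟩
  · intro b h1 h2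
    simp only [Finset.mem_toList, Finset.mem_filter] at h1 h2
    omega
  · intro b h1 h2
    change b ∈ W.enumNonpos at h1
    rw [mem_enumPos] at h2
    rw [mem_enumNonpos] at h1
    omega

/-- The linear bijection between polynomials and the universal enveloping algebra given by ordered
monomials. -/
def theta : MvPolynomial B K ≃ₗ[K] UniversalEnvelopingAlgebra K 𝔤 :=
  LinearEquiv.ofBijective (pbwMap W.e K W.enum)
    ⟨W.pbw _ W.nodup_enum W.mem_enum, pbwMap_surjective W.basis W.nodup_enum W.mem_enum⟩

omit [CharZero K] in
theorem theta_apply (P : MvPolynomial B K) : W.theta P = pbwMap W.e K W.enum P := rfl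

omit [CharZero K] in
theorem theta_monomial (m : B →₀ ℕ) (c : K) :
    W.theta (MvPolynomial.monomial m c) = c • ordMonomial W.e W.enum m := pbwMap_monomial _ _ _

omit [CharZero K] in
theorem ordMonomial_mem_nil {m : B →₀ ℕ} (hm : ∃ b, m b ≠ 0 ∧ 0 < W.w b) :
    ordMonomial W.e W.enum m ∈ W.nil := by
  rw [enum, ordMonomial_append]
  refine Ideal.mul_mem_left _ _ ?_
  rw [ordMonomial_eq_prod]
  refine W.prod_mem_nil ?_ ?_
  · obtain ⟨b, hb, hw⟩ := hm
    exact List.ne_nil_of_mem (a := b) (List.mem_flatMap.2 ⟨b, W.mem_enumPos.2 hw,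
      List.mem_replicate.2 ⟨hb, rfl⟩⟩)
  · intro b hb
    obtain ⟨c, hc, hb⟩ := List.mem_flatMap.1 hb
    rw [(List.mem_replicate.1 hb).2]
    exact W.mem_enumPos.1 hc

omit [CharZero K] in
theorem ordMonomial_mul {m m' : B →₀ ℕ} (hm' : ∀ b ∈ m'.support, 0 < W.w b) :
    ordMonomial W.e W.enumNonpos m * ordMonomial W.e W.enum m' =
      ordMonomial W.e W.enum (m.filter (fun b => W.w b ≤ 0) + m') := by
  have h0 : ∀ b ∈ W.enumNonpos, m' b = 0 := fun b hb => by
    by_contra h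
    exact absurd (hm' b (Finsupp.mem_support_iff.2 h)) (not_lt.2 (W.mem_enumNonpos.1 hb))
  rw [enum, ordMonomial_append, ordMonomial_append, ordMonomial_eq_one h0, one_mul]
  congr 1
  · refine ordMonomial_congr fun b hb => ?_
    rw [Finsupp.add_apply, h0 b hb, add_zero, Finsupp.filter_apply, if_pos (W.mem_enumNonpos.1 hb)]
  · refine ordMonomial_congr fun b hb => ?_
    rw [Finsupp.add_apply, Finsupp.filter_apply, if_neg (not_le.2 (W.mem_enumPos.1 hb)), zero_add]

/-- With positive vectors ordered last, the left ideal becomes the span of those ordered monomials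
which contain a positive factor. Membership can then be read off coefficient by coefficient. -/
theorem nil_eq_map_theta (x : UniversalEnvelopingAlgebra K 𝔤) : x ∈ W.nil ↔
    W.theta.symm x ∈ MvPolynomial.restrictSupport K {m | ∃ b, m b ≠ 0 ∧ 0 < W.w b} := by
  constructor
  · intro hx
    refine W.nil_induction (p := fun x => W.theta.symm x ∈
      MvPolynomial.restrictSupport K {m | ∃ b, m b ≠ 0 ∧ 0 < W.w b}) (by simp)
      (fun x y hx hy => by rw [map_add]; exact add_mem hx hy) (fun u a ha => ?_) hx
    obtain ⟨P, rfl⟩ := W.theta.surjective u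
    rw [P.as_sum, map_sum, Finset.sum_mul, map_sum]
    refine sum_mem fun m _ => ?_
    rw [W.theta_monomial, smul_mul_assoc, map_smul]
    refine Submodule.smul_mem _ _ ?_
    rw [enum, ordMonomial_append, mul_assoc, ordMonomial_eq_prod W.enumPos]
    -- The positive tail times `e a` is a non-empty word in positive vectors. It straightens to
    -- ordered monomials in positive vectors, none of them constant, which can be attached to the
    -- non-positive head.
    have h1 : ((expList W.enumPos m).map W.e).prod * W.e a ∈
        shorter W.e K {b | 0 < W.w b} ((expList W.enumPos m).length + 2) := by
      have : ((expList W.enumPos m).map W.e).prod * W.e a =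
        ((expList W.enumPos m ++ [a]).map W.e).prod := by simp
      rw [this]
      refine prod_mem_shorter (by simp) ?_ (by simp)
      intro b hb
      rcases List.mem_append.1 hb with hb | hb
      · obtain ⟨c, hc, hb⟩ := List.mem_flatMap.1 hb
        rw [(List.mem_replicate.1 hb).2]
        exact W.mem_enumPos.1 hc
      · rw [List.mem_singleton.1 hb]; exact ha
    have h2 := shorter_le_map_pbwMap W.nodup_enum (fun b _ => W.mem_enum b)
      (fun a ha b hb => W.commutator_mem_pos a ha b (le_of_lt hb)) _ h1
    obtain ⟨Q, hQ, hQ'⟩ := h2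
    rw [← hQ']
    rw [SetLike.mem_coe, MvPolynomial.mem_restrictSupport_iff] at hQ
    rw [Q.as_sum, map_sum, Finset.mul_sum, map_sum]
    refine sum_mem fun m' hm' => ?_
    have hm'' := hQ hm'
    rw [pbwMap_monomial, mul_smul_comm, map_smul]
    refine Submodule.smul_mem _ _ ?_
    rw [W.ordMonomial_mul hm''.2.1, ← one_smul K (ordMonomial _ _ _), ← W.theta_monomial,
      LinearEquiv.symm_apply_apply, MvPolynomial.monomial_mem_restrictSupport]
    left
    obtain ⟨b, hb⟩ := Finsupp.support_nonempty_iff.2 hm''.1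
    refine ⟨b, ?_, hm''.2.1 b hb⟩
    rw [Finsupp.add_apply]
    have := Finsupp.mem_support_iff.1 hb
    omega
  · intro hx
    rw [← W.theta.apply_symm_apply x, (W.theta.symm x).as_sum, map_sum]
    refine sum_mem fun m hm => ?_
    rw [W.theta_monomial, Algebra.smul_def]
    exact Ideal.mul_mem_left _ _ (W.ordMonomial_mem_nil (hx hm))

/-- The weight of an exponent vector. -/
def wt (m : B →₀ ℕ) : ℤ := m.sum fun b k => k * W.w b

omit [CharZero K] [Fintype B] in
theorem h_mul_list (l : List B) : UniversalEnvelopingAlgebra.ι K W.h * (l.map W.e).prod -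
    (l.map W.e).prod * UniversalEnvelopingAlgebra.ι K W.h =
      ((l.map W.w).sum : K) • (l.map W.e).prod := by
  induction l with
  | nil => simp
  | cons b l ih =>
    have hb : UniversalEnvelopingAlgebra.ι K W.h * W.e b -
        W.e b * UniversalEnvelopingAlgebra.ι K W.h = (W.w b : K) • W.e b := by
      rw [← LieRing.of_associative_ring_bracket, e, ← LieHom.map_lie, W.lie_h, map_smul]
    simp only [List.map_cons, List.prod_cons, List.sum_cons, Int.cast_add, add_smul]
    rw [← smul_mul_assoc, ← hb, ← mul_smul_comm, ← ih]
    noncomm_ring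

omit [CharZero K] [Fintype B] in
theorem wt_toFinsupp [DecidableEq B] (l : List B) :
    W.wt (Multiset.toFinsupp (l : Multiset B)) = (l.map W.w).sum := by
  induction l with
  | nil => simp [wt]
  | cons b l ih =>
    rw [← Multiset.cons_coe, ← Multiset.singleton_add, map_add, Multiset.toFinsupp_singleton]
    unfold wt at ih ⊢
    rw [Finsupp.sum_add_index' (by simp) (by intros; push_cast; ring), ih]
    simp

omit [CharZero K] in
theorem h_mul_theta_monomial (m : B →₀ ℕ) (c : K) :
    UniversalEnvelopingAlgebra.ι K W.h * W.theta (MvPolynomial.monomial m c) -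
    W.theta (MvPolynomial.monomial m c) * UniversalEnvelopingAlgebra.ι K W.h =
      W.theta (MvPolynomial.monomial m ((W.wt m : K) * c)) := by
  classical
  rw [W.theta_monomial, W.theta_monomial, mul_smul_comm, smul_mul_assoc, ← smul_sub,
    ordMonomial_eq_prod, W.h_mul_list, mul_comm, mul_smul]
  congr 3
  rw [← W.wt_toFinsupp, toFinsupp_expList W.nodup_enum W.mem_enum]

/-- The operator `ad h` is diagonal on ordered monomials with their weights as eigenvalues, and
these monomials are independent. -/
theorem wt_eq_zero_of_commute {z : UniversalEnvelopingAlgebra K 𝔤}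
    (hz : UniversalEnvelopingAlgebra.ι K W.h * z = z * UniversalEnvelopingAlgebra.ι K W.h)
    {m : B →₀ ℕ} (hm : m ∈ (W.theta.symm z).support) : W.wt m = 0 := by
  set P := W.theta.symm z with hP
  have hz' : z = W.theta P := by simp [hP]
  have h1 : W.theta (∑ m ∈ P.support, MvPolynomial.monomial m ((W.wt m : K) * P.coeff m)) = 0 := by
    rw [map_sum]
    rw [hz', P.as_sum, map_sum, Finset.mul_sum, Finset.sum_mul, ← sub_eq_zero,
      ← Finset.sum_sub_distrib] at hz
    rw [← hz]
    exact Finset.sum_congr rfl fun m _ => (W.h_mul_theta_monomial m _).symm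
  rw [LinearEquiv.map_eq_zero_iff] at h1
  have h2 := congrArg (MvPolynomial.coeff m) h1
  classical
  simp only [MvPolynomial.coeff_sum, MvPolynomial.coeff_monomial, Finset.sum_ite_eq', hm, if_true,
    MvPolynomial.coeff_zero] at h2
  exact_mod_cast (mul_eq_zero.1 h2).resolve_right (MvPolynomial.mem_support_iff.1 hm)

omit [CharZero K] in
theorem exists_pos_of_wt_eq_zero {m : B →₀ ℕ} (h : W.wt m = 0) {b : B} (hb : m b ≠ 0)
    (hw : W.w b ≠ 0) : ∃ b, m b ≠ 0 ∧ 0 < W.w b := by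
  by_contra! hcon
  have h2 : ∀ c ∈ m.support, (m c : ℤ) * W.w c ≤ 0 := fun c hc =>
    mul_nonpos_of_nonneg_of_nonpos (Int.natCast_nonneg _)
      (hcon c (Finsupp.mem_support_iff.1 hc))
  have h3 := (Finset.sum_eq_zero_iff_of_nonpos h2).1 h b (Finsupp.mem_support_iff.2 hb)
  rcases mul_eq_zero.1 h3 with h4 | h4
  · exact hb (by exact_mod_cast h4)
  · exact hw h4

/-! ### Projection to the enveloping algebra of the weight-zero part -/

section Levi

variable {𝔪 : Type*} [LieRing 𝔪] [LieAlgebra K 𝔪] (j : 𝔪 →ₗ⁅K⁆ 𝔤)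

/-- The homomorphism of enveloping algebras induced by a homomorphism of Lie algebras. -/
abbrev mapEnv : UniversalEnvelopingAlgebra K 𝔪 →ₐ[K] UniversalEnvelopingAlgebra K 𝔤 :=
  UniversalEnvelopingAlgebra.lift K ((UniversalEnvelopingAlgebra.ι K).comp j)

omit [CharZero K] [Fintype B] in
theorem exists_levi_basis (hj : Function.Injective j)
    (hr : LinearMap.range (j : 𝔪 →ₗ[K] 𝔤) = Submodule.span K (W.basis '' {b | W.w b = 0})) :
    ∃ b' : Module.Basis {b // W.w b = 0} K 𝔪, ∀ b, j (b' b) = W.basis b := by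
  have hex : ∀ b : {b // W.w b = 0}, ∃ x : 𝔪, j x = W.basis b := fun b => by
    have : W.basis b ∈ LinearMap.range (j : 𝔪 →ₗ[K] 𝔤) := by
      rw [hr]; exact Submodule.subset_span ⟨b, b.2, rfl⟩
    exact this
  choose v hv using hex
  have hli : LinearIndependent K v := by
    refine LinearIndependent.of_comp (j : 𝔪 →ₗ[K] 𝔤) ?_
    have : (j : 𝔪 →ₗ[K] 𝔤) ∘ v = fun b : {b // W.w b = 0} => W.basis b := funext hv
    rw [this]
    exact W.basis.linearIndependent.comp _ Subtype.val_injective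
  refine ⟨Module.Basis.mk hli ?_, fun b => by rw [Module.Basis.mk_apply, hv]⟩
  intro x _
  have hx : (j : 𝔪 →ₗ[K] 𝔤) x ∈ (Submodule.span K (Set.range v)).map (j : 𝔪 →ₗ[K] 𝔤) := by
    rw [Submodule.map_span, ← Set.range_comp]
    have h1 : (j : 𝔪 →ₗ[K] 𝔤) x ∈ LinearMap.range (j : 𝔪 →ₗ[K] 𝔤) := ⟨x, rfl⟩
    rw [hr] at h1
    refine Submodule.span_mono ?_ h1
    rintro _ ⟨b, hb, rfl⟩
    exact ⟨⟨b, hb⟩, hv ⟨b, hb⟩⟩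
  obtain ⟨y, hy, hyx⟩ := hx
  rwa [← hj hyx]

variable {j} (hj : Function.Injective j)
    (hr : LinearMap.range (j : 𝔪 →ₗ[K] 𝔤) = Submodule.span K (W.basis '' {b | W.w b = 0}))

include hj hr

/-- The enveloping algebra of the part of weight zero meets the left ideal generated by the elements
of positive weight in zero. -/
theorem eq_zero_of_mapEnv_mem_nil {u : UniversalEnvelopingAlgebra K 𝔪}
    (hu : mapEnv j u ∈ W.nil) : u = 0 := by
  obtain ⟨b', hb'⟩ := W.exists_levi_basis j hj hr
  -- The weight-zero vectors are listed exactly as in the middle segment of `enum`, so ordered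
  -- monomials of the subalgebra map to ordered monomials of the whole algebra.
  set zl := (Finset.univ.filter fun b => W.w b = 0).toList with hzl
  set bs : List {b // W.w b = 0} := zl.attachWith _ (by simp [hzl]) with hbs
  have hval : bs.map Subtype.val = zl := List.attachWith_map_subtype_val _
  have hnd : bs.Nodup := List.Nodup.of_map Subtype.val (by rw [hval]; exact Finset.nodup_toList _)
  have hall : ∀ b, b ∈ bs := fun b => by
    rw [hbs, List.mem_attachWith, hzl]
    simpa using b.2
  obtain ⟨Q, rfl⟩ := pbwMap_surjective b' hnd hall u
  have hmap : mapEnv j (pbwMap (fun i => UniversalEnvelopingAlgebra.ι K (b' i)) K bs Q) =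
      pbwMap W.e K (bs.map Subtype.val) (MvPolynomial.rename Subtype.val Q) := by
    rw [Q.as_sum]
    simp only [map_sum]
    refine Finset.sum_congr rfl fun m _ => ?_
    rw [MvPolynomial.rename_monomial, pbwMap_monomial, pbwMap_monomial, map_smul, ordMonomial,
      ordMonomial, map_list_prod, List.map_map, List.map_map]
    congr 3
    funext b
    simp only [Function.comp_apply, map_pow]
    rw [UniversalEnvelopingAlgebra.lift_ι_apply, Finsupp.mapDomain_apply Subtype.val_injective]
    change (UniversalEnvelopingAlgebra.ι K (j (b' b))) ^ _ = _
    rw [hb', e]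
  have hsupp : ∀ m ∈ (MvPolynomial.rename Subtype.val Q : MvPolynomial B K).support,
      ∀ b, W.w b ≠ 0 → m b = 0 := by
    intro m hm b hb
    obtain ⟨d, rfl, -⟩ := MvPolynomial.coeff_rename_ne_zero _ _ _
      (MvPolynomial.mem_support_iff.1 hm)
    refine Finsupp.mapDomain_of_notMem_range _ _ ?_
    rintro ⟨c, rfl⟩
    exact hb c.2
  have htheta : pbwMap W.e K (bs.map Subtype.val) (MvPolynomial.rename Subtype.val Q) =
      W.theta (MvPolynomial.rename Subtype.val Q) := by
    rw [(MvPolynomial.rename Subtype.val Q : MvPolynomial B K).as_sum, map_sum, map_sum]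
    refine Finset.sum_congr rfl fun m hm => ?_
    rw [pbwMap_monomial, W.theta_monomial, hval, enum, enumNonpos, ordMonomial_append,
      ordMonomial_append, ordMonomial_eq_one (bs := W.enumPos), mul_one, ordMonomial_eq_one
        (bs := (Finset.univ.filter fun b => W.w b < 0).toList), one_mul]
    · intro b hb
      simp only [Finset.mem_toList, Finset.mem_filter] at hb
      exact hsupp m hm b hb.2.ne
    · intro b hb
      exact hsupp m hm b (W.mem_enumPos.1 hb).ne'
  rw [hmap, htheta, W.nil_eq_map_theta, LinearEquiv.symm_apply_apply] at hu
  have h0 : (MvPolynomial.rename Subtype.val Q : MvPolynomial B K) = 0 := by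
    by_contra hne
    obtain ⟨m, hm⟩ := MvPolynomial.support_nonempty.2 hne
    obtain ⟨b, hb, hw⟩ := hu hm
    exact hb (hsupp m hm b hw.ne')
  rw [MvPolynomial.rename_eq_zero_iff_of_injective _ Subtype.val_injective] at h0
  rw [h0, map_zero]

omit [Fintype B] in
theorem nil_mul_mapEnv_mem {x : UniversalEnvelopingAlgebra K 𝔤} (hx : x ∈ W.nil)
    (u : UniversalEnvelopingAlgebra K 𝔪) : x * mapEnv j u ∈ W.nil := by
  obtain ⟨b', hb'⟩ := W.exists_levi_basis j hj hr
  have hu : u ∈ Algebra.adjoin K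
    (Set.range (UniversalEnvelopingAlgebra.ι K : 𝔪 → UniversalEnvelopingAlgebra K 𝔪)) := by
    rw [adjoin_range_ι]; trivial
  induction hu using Algebra.adjoin_induction generalizing x with
  | mem u hu =>
    obtain ⟨y, rfl⟩ := hu
    have hy : y ∈ Submodule.span K (Set.range b') := by rw [b'.span_eq]; trivial
    induction hy using Submodule.span_induction with
    | mem y hy =>
      obtain ⟨i, rfl⟩ := hy
      rw [UniversalEnvelopingAlgebra.lift_ι_apply, LieHom.comp_apply, hb']
      exact W.nil_mul_mem hx i.2.ge
    | zero => simp
    | add y z _ _ hy hz => rw [map_add, map_add, mul_add]; exact add_mem hy hz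
    | smul r y _ hy =>
      rw [map_smul, map_smul, mul_smul_comm, Algebra.smul_def]
      exact Ideal.mul_mem_left _ _ hy
  | algebraMap r => rw [AlgHom.commutes, ← Algebra.commutes]; exact Ideal.mul_mem_left _ _ hx
  | add u v _ _ hu hv => rw [map_add, mul_add]; exact add_mem (hu hx) (hv hx)
  | mul u v _ _ hu hv => rw [map_mul, ← mul_assoc]; exact hv (hu hx)

/-- Every ordered monomial in `z` has total weight zero. If it involves a vector of non-zero weight
it must also involve one of positive weight and lies in `nil`; otherwise it comes from the
weight-zero subalgebra. -/
theorem exists_sub_mapEnv_mem_nil {z : UniversalEnvelopingAlgebra K 𝔤}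
    (hz : UniversalEnvelopingAlgebra.ι K W.h * z = z * UniversalEnvelopingAlgebra.ι K W.h) :
    ∃ u, z - mapEnv j u ∈ W.nil := by
  obtain ⟨b', hb'⟩ := W.exists_levi_basis j hj hr
  have key : ∀ m ∈ (W.theta.symm z).support,
      ∃ u, ordMonomial W.e W.enum m - mapEnv j u ∈ W.nil := by
    intro m hm
    by_cases h : ∃ b, m b ≠ 0 ∧ W.w b ≠ 0
    · obtain ⟨b, hb, hw⟩ := h
      refine ⟨0, ?_⟩
      rw [map_zero, sub_zero]
      exact W.ordMonomial_mem_nil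
        (W.exists_pos_of_wt_eq_zero (W.wt_eq_zero_of_commute hz hm) hb hw)
    · push Not at h
      have : ordMonomial W.e W.enum m ∈ (mapEnv j).range := by
        refine list_prod_mem fun x hx => ?_
        obtain ⟨b, -, rfl⟩ := List.mem_map.1 hx
        by_cases hb : m b = 0
        · rw [hb, pow_zero]; exact one_mem _
        · refine pow_mem ?_ _
          refine ⟨UniversalEnvelopingAlgebra.ι K (b' ⟨b, h b hb⟩), ?_⟩
          change mapEnv j _ = _
          rw [UniversalEnvelopingAlgebra.lift_ι_apply, LieHom.comp_apply, hb', e]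
      obtain ⟨u, hu⟩ := this
      exact ⟨u, by rw [← hu]; simp⟩
  choose! u hu using key
  refine ⟨∑ m ∈ (W.theta.symm z).support, (W.theta.symm z).coeff m • u m, ?_⟩
  have hz' : z = ∑ m ∈ (W.theta.symm z).support,
      W.theta (MvPolynomial.monomial m ((W.theta.symm z).coeff m)) := by
    rw [← map_sum, ← (W.theta.symm z).as_sum, W.theta.apply_symm_apply]
  have hsub := congrArg (· - mapEnv j (∑ m ∈ (W.theta.symm z).support,
    (W.theta.symm z).coeff m • u m)) hz'
  rw [hsub, map_sum, ← Finset.sum_sub_distrib]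
  refine sum_mem fun m hm => ?_
  rw [W.theta_monomial, map_smul, ← smul_sub, Algebra.smul_def]
  exact Ideal.mul_mem_left _ _ (hu m hm)

/-- The Harish-Chandra homomorphism. -/
theorem exists_harishChandra :
    ∃ f : Subalgebra.center K (UniversalEnvelopingAlgebra K 𝔤) →ₐ[K]
      Subalgebra.center K (UniversalEnvelopingAlgebra K 𝔪),
      ∀ z : Subalgebra.center K (UniversalEnvelopingAlgebra K 𝔤),
        (z : UniversalEnvelopingAlgebra K 𝔤) - mapEnv j (f z : UniversalEnvelopingAlgebra K 𝔪) ∈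
        W.nil := by
  have hc : ∀ (z : Subalgebra.center K (UniversalEnvelopingAlgebra K 𝔤)) x,
    x * (z : UniversalEnvelopingAlgebra K 𝔤) = z * x := fun z =>
      Subalgebra.mem_center_iff.1 z.2
  choose u hu using fun z : Subalgebra.center K (UniversalEnvelopingAlgebra K 𝔤) =>
    W.exists_sub_mapEnv_mem_nil hj hr (hc z (UniversalEnvelopingAlgebra.ι K W.h))
  have huniq : ∀ {z : UniversalEnvelopingAlgebra K 𝔤} {v v' : UniversalEnvelopingAlgebra K 𝔪},
      z - mapEnv j v ∈ W.nil → z - mapEnv j v' ∈ W.nil → v = v' := by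
    intro z v v' h h'
    have := sub_mem h' h
    rw [sub_sub_sub_cancel_left, ← map_sub] at this
    exact sub_eq_zero.1 (W.eq_zero_of_mapEnv_mem_nil hj hr this)
  obtain ⟨b', hb'⟩ := W.exists_levi_basis j hj hr
  have hcent : ∀ z, u z ∈ Subalgebra.center K (UniversalEnvelopingAlgebra K 𝔪) := by
    intro z
    refine mem_center_of_commute b' fun i => ?_
    set y := UniversalEnvelopingAlgebra.ι K (b' i)
    refine sub_eq_zero.1 (W.eq_zero_of_mapEnv_mem_nil hj hr ?_)
    -- The commutator of `u z` with `y` equals, up to sign, that of `z - u z`, because `z` is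
    -- central. It lies in `nil`, which is stable under multiplication by `y` on both sides, and
    -- `nil` meets the subalgebra in zero.
    have h1 := W.nil.mul_mem_left (mapEnv j y) (hu z)
    have h2 := W.nil_mul_mapEnv_mem hj hr (hu z) y
    have h3 := sub_mem h2 h1
    rw [mul_sub, sub_mul, hc z, sub_sub_sub_cancel_left, ← map_mul, ← map_mul, ← map_sub] at h3
    exact h3
  refine ⟨AlgHom.ofLinearMap
    { toFun := fun z => ⟨u z, hcent z⟩, map_add' := fun z z' => ?_, map_smul' := fun r z => ?_ }
    ?_ fun z z' => ?_, hu⟩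
  · refine Subtype.ext (huniq (hu _) ?_)
    change (z : UniversalEnvelopingAlgebra K 𝔤) + z' - mapEnv j (u z + u z') ∈ _
    rw [map_add, add_sub_add_comm]
    exact add_mem (hu z) (hu z')
  · refine Subtype.ext (huniq (hu _) ?_)
    change r • (z : UniversalEnvelopingAlgebra K 𝔤) - mapEnv j (r • u z) ∈ _
    rw [map_smul, ← smul_sub, Algebra.smul_def]
    exact Ideal.mul_mem_left _ _ (hu z)
  · refine Subtype.ext (huniq (hu _) ?_)
    change (1 : UniversalEnvelopingAlgebra K 𝔤) - mapEnv j 1 ∈ _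
    simp
  · refine Subtype.ext (huniq (hu _) ?_)
    change (z : UniversalEnvelopingAlgebra K 𝔤) * z' - mapEnv j (u z * u z') ∈ _
    -- Multiplicativity: `z z' - u(z) u(z') = z' (z - u(z)) + u(z) (z' - u(z'))`, by centrality of
    -- `z'`, and both summands lie in a left ideal.
    have h1 := W.nil.mul_mem_left z' (hu z)
    have h2 := W.nil.mul_mem_left (mapEnv j (u z)) (hu z')
    have h3 := add_mem h1 h2
    convert h3 using 1
    rw [map_mul, mul_sub, mul_sub, hc z, hc z', hc z']
    abel

end Levi

end WeightBasis

theorem ordMonomial_mul_of_commute {A B : Type*} [Ring A] {e : B → A} {bs : List B}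
    (hbs : bs.Nodup) {b : B} (hb : b ∈ bs) (hcomm : ∀ c ∈ bs, Commute (e c) (e b)) (m : B →₀ ℕ) :
    ordMonomial e bs m * e b = ordMonomial e bs (m + Finsupp.single b 1) := by
  classical
  induction bs with
  | nil => simp at hb
  | cons c bs ih =>
    have h1 : ∀ m' : B →₀ ℕ,
        ordMonomial e (c :: bs) m' = e c ^ m' c * ordMonomial e bs m' := fun m' => by
      simp [ordMonomial]
    rw [h1, h1]
    have hnd := List.nodup_cons.1 hbs
    by_cases hcb : c = b
    · subst hcb
      have h2 : Commute (ordMonomial e bs m) (e c) := by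
        refine Commute.list_prod_left _ _ fun x hx => ?_
        obtain ⟨d, hd, rfl⟩ := List.mem_map.1 hx
        exact (hcomm d (List.mem_cons_of_mem _ hd)).pow_left _
      have h3 : ordMonomial e bs (m + Finsupp.single c 1) = ordMonomial e bs m := by
        refine ordMonomial_congr fun d hd => ?_
        rw [Finsupp.add_apply, Finsupp.single_apply, if_neg, add_zero]
        rintro rfl
        exact hnd.1 hd
      rw [h3, mul_assoc, h2.eq, ← mul_assoc, ← pow_succ]
      simp
    · have hb' : b ∈ bs := (List.mem_cons.1 hb).resolve_left (Ne.symm hcb)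
      rw [mul_assoc, ih hnd.2 hb' fun d hd => hcomm d (List.mem_cons_of_mem _ hd)]
      simp [Ne.symm hcb]

/-! ### Verma functionals and the Weyl group symmetry of Harish-Chandra images -/

namespace MatrixUnits

variable {K 𝔤 I κ : Type*} [Field K] [CharZero K] [LieRing 𝔤] [LieAlgebra K 𝔤] [DecidableEq I]
    [DecidableEq κ] [Fintype I] [Fintype κ] (M : MatrixUnits K 𝔤 I κ)

/-- The grading in which the matrix unit `E_ij` has weight `r i - r j`. -/
def weight (r : κ → ℤ) : WeightBasis K 𝔤 (I × κ × κ) where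
  basis := M.basis
  h := ∑ s : I, ∑ i : κ, (r i : K) • M.basis (s, i, i)
  w b := r b.2.1 - r b.2.2
  lie_h := by
    rintro ⟨t, k, l⟩
    simp only [sum_lie, smul_lie, M.lie_basis]
    rw [Finset.sum_eq_single t (fun s _ hs => by simp [hs]) (by simp)]
    simp only [if_true, smul_sub, smul_ite, smul_zero, Finset.sum_sub_distrib, Finset.sum_ite_eq',
      Finset.sum_ite_eq, Finset.mem_univ]
    push_cast
    rw [sub_smul]
  pbw _ := M.pbwMap_injective

omit [CharZero K] [Fintype I] [Fintype κ] in
theorem commutator_e (s : I) (i j : κ) (t : I) (k l : κ) :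
    M.e (s, i, j) * M.e (t, k, l) - M.e (t, k, l) * M.e (s, i, j) =
    if s = t then (if j = k then M.e (s, i, l) else 0) - (if l = i then M.e (s, k, j) else 0)
    else 0 := by
  rw [← LieRing.of_associative_ring_bracket, e, e, ← LieHom.map_lie, M.lie_basis]
  split_ifs <;> simp [e]

variable {p : κ → ℕ} (hp : Function.Injective p)

/-- The grading for which the strictly lower triangular matrices (with respect to the order defined
by `p`) have positive weight. -/
abbrev lower (p : κ → ℕ) : WeightBasis K 𝔤 (I × κ × κ) := M.weight fun i => (p i : ℤ)

/-- The point at which polynomials are evaluated to obtain the functional `chi`. -/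
def chiPoint (p : κ → ℕ) (lam : I × κ → K) (b : I × κ × κ) : K :=
  if b.2.1 = b.2.2 then lam (b.1, b.2.1) else if p b.2.1 < p b.2.2 then 1 else 0

/-- A linear functional on the Verma module of highest weight `lam`. -/
def chi (p : κ → ℕ) (lam : I × κ → K) : UniversalEnvelopingAlgebra K 𝔤 →ₗ[K] K :=
  (MvPolynomial.aeval (chiPoint p lam)).toLinearMap ∘ₗ (M.lower p).theta.symm.toLinearMap

theorem chi_theta (lam : I × κ → K) (P : MvPolynomial (I × κ × κ) K) :
    M.chi p lam ((M.lower p).theta P) = MvPolynomial.aeval (chiPoint p lam) P := by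
  simp [chi]

theorem chi_nil (lam : I × κ → K) {x : UniversalEnvelopingAlgebra K 𝔤}
    (hx : x ∈ (M.lower p).nil) : M.chi p lam x = 0 := by
  rw [WeightBasis.nil_eq_map_theta] at hx
  rw [← (M.lower p).theta.apply_symm_apply x, chi_theta,
    ((M.lower p).theta.symm x).as_sum, map_sum]
  refine Finset.sum_eq_zero fun m hm => ?_
  obtain ⟨b, hb, hw⟩ := hx hm
  rw [MvPolynomial.aeval_monomial, Finsupp.prod,
    Finset.prod_eq_zero (Finsupp.mem_support_iff.2 hb), mul_zero]
  change (0 : ℤ) < (p b.2.1 : ℤ) - p b.2.2 at hw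
  rw [chiPoint, if_neg, if_neg, zero_pow hb]
  · omega
  · intro h
    rw [h] at hw
    omega

-- Monomials with a positive factor are killed on both sides. In the others the diagonal vectors
-- come last and commute with each other, so right multiplication by one of them merely raises its
-- exponent, and the evaluation point contributes `lam (s, i)`.
include hp in
theorem chi_mul_diag (lam : I × κ → K) (u : UniversalEnvelopingAlgebra K 𝔤) (s : I) (i : κ) :
    M.chi p lam (u * M.e (s, i, i)) = lam (s, i) * M.chi p lam u := by
  obtain ⟨P, rfl⟩ := (M.lower p).theta.surjective u
  rw [P.as_sum, map_sum, Finset.sum_mul, map_sum, map_sum, Finset.mul_sum]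
  refine Finset.sum_congr rfl fun m _ => ?_
  rw [WeightBasis.theta_monomial, smul_mul_assoc, map_smul, map_smul, mul_smul_comm]
  congr 1
  by_cases hm : ∃ b, m b ≠ 0 ∧ 0 < (M.lower p).w b
  · have h1 := (M.lower p).ordMonomial_mem_nil hm
    rw [chi_nil M lam h1, mul_zero]
    exact chi_nil M lam ((M.lower p).nil_mul_mem (b := (s, i, i)) h1 (sub_self _).ge)
  · push Not at hm
    have h1 : ordMonomial (M.lower p).e (M.lower p).enum m * M.e (s, i, i) =
        ordMonomial (M.lower p).e (M.lower p).enum (m + Finsupp.single (s, i, i) 1) := by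
      have hpos : ∀ b ∈ (M.lower p).enumPos, b ≠ (s, i, i) := by
        rintro b hb rfl
        rw [WeightBasis.mem_enumPos] at hb
        exact absurd hb (by simp [weight])
      rw [WeightBasis.enum, ordMonomial_append, ordMonomial_append,
        ordMonomial_eq_one (bs := (M.lower p).enumPos), mul_one,
        ordMonomial_eq_one (bs := (M.lower p).enumPos), mul_one,
        WeightBasis.enumNonpos, ordMonomial_append, ordMonomial_append, mul_assoc]
      · congr 1
        · refine ordMonomial_congr fun b hb => ?_
          rw [Finsupp.add_apply, Finsupp.single_apply, if_neg, add_zero]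
          rintro rfl
          simp [weight] at hb
        · refine ordMonomial_mul_of_commute (e := (M.lower p).e) (Finset.nodup_toList _) ?_ ?_ m
          · simp [weight]
          · rintro ⟨t, k, l⟩ hb
            simp only [weight, Finset.mem_toList, Finset.mem_filter, Finset.mem_univ,
              true_and, sub_eq_zero, Nat.cast_inj] at hb
            obtain rfl := hp hb
            refine sub_eq_zero.1 ((M.commutator_e t k k s i i).trans ?_)
            by_cases hki : k = i
            · subst hki; simp
            · simp [hki, Ne.symm hki]
      · intro b hb
        rw [Finsupp.add_apply, Finsupp.single_apply, if_neg (Ne.symm (hpos b hb)), add_zero]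
        by_contra h
        exact absurd (hm b h) (not_le.2 ((M.lower p).mem_enumPos.1 hb))
      · intro b hb
        by_contra h
        exact absurd (hm b h) (not_le.2 ((M.lower p).mem_enumPos.1 hb))
    have h2 : ∀ m, ordMonomial (M.lower p).e (M.lower p).enum m =
        (M.lower p).theta (MvPolynomial.monomial m 1) := fun m => by
      rw [WeightBasis.theta_monomial, one_smul]
    rw [h1, h2, h2, chi_theta, chi_theta, MvPolynomial.monomial_add_single, pow_one, map_mul,
      MvPolynomial.aeval_X, mul_comm, chiPoint, if_pos rfl]

/-- This is why `chiPoint` takes the value `1` at the negative root vectors: the functional must not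
vanish on the vectors `F ^ r` of the Verma module. -/
theorem chi_pow (lam : I × κ → K) (s : I) {k l : κ} (hkl : p k < p l) (r : ℕ) :
    M.chi p lam (M.e (s, k, l) ^ r) = 1 := by
  have h : M.e (s, k, l) ^ r = (M.lower p).theta (MvPolynomial.X (s, k, l) ^ r) :=
    (pbwMap_X_pow (M.lower p).nodup_enum ((M.lower p).mem_enum _) r).symm
  rw [h, chi_theta, map_pow, MvPolynomial.aeval_X, chiPoint, if_neg, if_pos hkl, one_pow]
  rintro h
  exact hkl.ne (by rw [show k = l from h])

section Torus

variable {T : MvPolynomial (I × κ) K →ₐ[K] UniversalEnvelopingAlgebra K 𝔤}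
  (hT : ∀ s i, T (MvPolynomial.X (s, i)) = M.e (s, i, i))

include hp hT in
theorem chi_mul_torus (lam : I × κ → K) (u : UniversalEnvelopingAlgebra K 𝔤)
    (Q : MvPolynomial (I × κ) K) :
    M.chi p lam (u * T Q) = MvPolynomial.eval lam Q * M.chi p lam u := by
  induction Q using MvPolynomial.induction_on generalizing u with
  | C a =>
    rw [← MvPolynomial.algebraMap_eq, AlgHom.commutes, ← Algebra.commutes, ← Algebra.smul_def,
      map_smul, MvPolynomial.algebraMap_eq, MvPolynomial.eval_C, smul_eq_mul]
  | add P Q hP hQ => rw [map_add, mul_add, map_add, hP, hQ, map_add, add_mul]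
  | mul_X P b hP =>
    obtain ⟨s, i⟩ := b
    rw [map_mul T, ← mul_assoc, hT, M.chi_mul_diag hp, hP, map_mul, MvPolynomial.eval_X]
    ring

theorem chi_one (lam : I × κ → K) : M.chi p lam 1 = 1 := by
  have h : (M.lower p).theta 1 = 1 := pbwMap_one _
  rw [← h, chi_theta, map_one]

-- Applying the functionals `chi` for all weights evaluates `Q` at every point, and the infinite
-- field `K` separates polynomials.
include hp hT in
theorem eq_zero_of_torus_mem_nil {Q : MvPolynomial (I × κ) K} (h : T Q ∈ (M.lower p).nil) :
    Q = 0 := by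
  refine MvPolynomial.funext fun lam => ?_
  have h1 := M.chi_mul_torus hp hT lam 1 Q
  rw [one_mul, M.chi_nil lam h, chi_one, mul_one] at h1
  rw [← h1, map_zero]

-- Since `E_kl` is a root vector of root `ε_k - ε_l`, moving a polynomial in the torus past it
-- translates the argument by that root.
omit [CharZero K] [Fintype I] [Fintype κ] in
include hT in
theorem torus_mul_e (Q : MvPolynomial (I × κ) K) (s : I) (k l : κ) :
    T Q * M.e (s, k, l) = M.e (s, k, l) * T (MvPolynomial.aeval
      (fun b => MvPolynomial.X b + MvPolynomial.C ((if b = (s, k) then 1 else 0) -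
        (if b = (s, l) then 1 else 0) : K)) Q) := by
  induction Q using MvPolynomial.induction_on with
  | C a =>
    rw [← MvPolynomial.algebraMap_eq, AlgHom.commutes, AlgHom.commutes, AlgHom.commutes,
      Algebra.commutes]
  | add P Q hP hQ => rw [map_add, add_mul, hP, hQ, map_add, map_add, mul_add]
  | mul_X P b hP =>
    obtain ⟨t, i⟩ := b
    have h1 : M.e (t, i, i) * M.e (s, k, l) = M.e (s, k, l) * T (MvPolynomial.X (t, i) +
        MvPolynomial.C ((if (t, i) = (s, k) then 1 else 0) -
        (if (t, i) = (s, l) then 1 else 0) : K)) := by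
      rw [map_add, hT, mul_add, ← sub_eq_iff_eq_add', M.commutator_e,
        ← MvPolynomial.algebraMap_eq, AlgHom.commutes, ← Algebra.commutes, ← Algebra.smul_def]
      by_cases hts : t = s
      · subst hts
        by_cases hik : i = k
        · subst hik
          by_cases hil : i = l
          · subst hil; simp
          · simp [hil, Ne.symm hil]
        · by_cases hil : i = l
          · subst hil; simp [hik]
          · simp [hik, hil, Ne.symm hil]
      · simp [hts]
    rw [map_mul T, hT, mul_assoc, h1, ← mul_assoc, hP, mul_assoc, ← map_mul T]
    simp only [map_mul, MvPolynomial.aeval_X]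

omit [CharZero K] [Fintype I] [Fintype κ] in
include hT in
theorem torus_mul_e_pow (Q : MvPolynomial (I × κ) K) (s : I) (k l : κ) (r : ℕ) :
    T Q * M.e (s, k, l) ^ r = M.e (s, k, l) ^ r * T (MvPolynomial.aeval
      (fun b => MvPolynomial.X b + MvPolynomial.C (r * ((if b = (s, k) then 1 else 0) -
        (if b = (s, l) then 1 else 0)) : K)) Q) := by
  induction r with
  | zero =>
    simp
  | succ r ih =>
    rw [pow_succ, ← mul_assoc, ih, mul_assoc, M.torus_mul_e hT, ← mul_assoc]
    congr 2
    rw [← AlgHom.comp_apply]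
    congr 1
    ext1 b
    simp only [AlgHom.comp_apply, MvPolynomial.aeval_X, map_add]
    rw [← MvPolynomial.algebraMap_eq, AlgHom.commutes, MvPolynomial.algebraMap_eq, add_assoc,
      ← map_add]
    congr 2
    push_cast
    ring

end Torus

/-- The commutation rule of `𝔰𝔩₂`. -/
theorem sl2_mul_pow {A : Type*} [Ring A] {E F H : A} (h1 : E * F - F * E = H)
    (h2 : H * F - F * H = -2 * F) (r : ℕ) :
    E * F ^ (r + 1) = F ^ (r + 1) * E + (r + 1 : ℕ) * (F ^ r * (H - r)) := by
  have hEF : E * F = F * E + H := by rw [← h1]; abel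
  have hHF : H * F = F * H - 2 * F := by
    rw [sub_eq_iff_eq_add'.1 h2]; noncomm_ring
  induction r with
  | zero => simp [hEF]
  | succ r ih =>
    have hr : (r : A) * F = F * r := (Nat.cast_commute r F).eq
    rw [pow_succ F (r + 1), ← mul_assoc, ih, add_mul, mul_assoc _ E F, hEF, mul_assoc _ _ F,
      mul_assoc _ _ F, sub_mul, hHF, hr]
    have : F * H - 2 * F - F * r = F * (H - 2 - r) := by noncomm_ring
    rw [this, ← mul_assoc (F ^ r) F, ← pow_succ, mul_add, ← mul_assoc _ F E, ← pow_succ]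
    have h3 : ∀ (k : ℕ) (x : A), (k : A) * (F ^ (r + 1) * x) = F ^ (r + 1) * (k * x) :=
        fun k x => by
      rw [← mul_assoc, (Nat.cast_commute k (F ^ (r + 1))).eq, mul_assoc]
    rw [h3, h3, add_assoc, ← mul_add]
    congr 2
    push_cast
    noncomm_ring

/-- In the Verma module of a weight with `lam(H) = r` for `H = E_ll - E_kk`, the vector `F ^ (r +
1)` applied to the highest weight vector is singular. The raising vector `E_lk` of the same `𝔰𝔩₂`
kills it by `sl2_mul_pow`, the other positive root vectors because the root is simple. -/
theorem nil_mul_pow_chi (lam : I × κ → K) (s : I) {k l : κ} (hkl : p l = p k + 1) (r : ℕ)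
    (hlam : lam (s, l) - lam (s, k) = r) (hp : Function.Injective p)
    {x : UniversalEnvelopingAlgebra K 𝔤} (hx : x ∈ (M.lower p).nil) :
    M.chi p lam (x * M.e (s, k, l) ^ (r + 1)) = 0 := by
  have hne : k ≠ l := by rintro rfl; omega
  set F := M.e (s, k, l) with hF
  refine (M.lower p).nil_induction (p := fun x => M.chi p lam (x * F ^ (r + 1)) = 0) (by simp)
    (fun x y hx hy => by rw [add_mul, map_add, hx, hy, add_zero]) (fun u b hb => ?_) hx
  change M.chi p lam (u * M.e b * F ^ (r + 1)) = 0
  by_cases hbE : b = (s, l, k)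
  · subst hbE
    have h1 : M.e (s, l, k) * F - F * M.e (s, l, k) = M.e (s, l, l) - M.e (s, k, k) := by
      rw [hF, M.commutator_e]; simp
    have h2 : (M.e (s, l, l) - M.e (s, k, k)) * F - F * (M.e (s, l, l) - M.e (s, k, k)) =
        -2 * F := by
      have h3 := M.commutator_e s l l s k l
      have h4 := M.commutator_e s k k s k l
      rw [← hF] at h3 h4
      simp only [if_true, Ne.symm hne, if_false, sub_zero, zero_sub] at h3 h4
      rw [sub_mul, mul_sub, sub_sub_sub_comm, h3, h4]
      noncomm_ring
    have h5 : M.e (s, l, k) ∈ (M.lower p).nil := Ideal.subset_span ⟨(s, l, k), hb, rfl⟩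
    rw [mul_assoc, sl2_mul_pow h1 h2, mul_add, map_add, ← mul_assoc,
      M.chi_nil lam (Ideal.mul_mem_left _ _ h5), zero_add,
      ← mul_assoc, ← mul_assoc, mul_sub, mul_sub, map_sub, map_sub, M.chi_mul_diag hp,
      M.chi_mul_diag hp, ← (Nat.cast_commute r _).eq, ← nsmul_eq_mul, map_nsmul, nsmul_eq_mul,
      ← sub_mul, ← sub_mul, hlam, sub_self, zero_mul]
  -- As `k` and `l` are adjacent, bracketing with `F` maps the positive root vectors other than
  -- `E_lk` to zero or to signed vectors of the same kind. The left ideal they generate is thus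
  -- stable under right multiplication by `F`.
  · let C : Set (I × κ × κ) := {b | p b.2.2 < p b.2.1 ∧ b ≠ (s, l, k)}
    have hstep : ∀ x ∈ Ideal.span (M.e '' C), x * F ∈ Ideal.span (M.e '' C) := by
      intro x hx
      refine Submodule.closure_induction (p := fun x _ => x * F ∈ Ideal.span (M.e '' C)) (by simp)
        (fun x y _ _ hx hy => by rw [add_mul]; exact add_mem hx hy) ?_ hx
      rintro v _ ⟨⟨t, i, j⟩, ⟨hij, hC⟩, rfl⟩
      have hij' : p j < p i := hij
      rw [smul_eq_mul, mul_assoc]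
      refine Ideal.mul_mem_left _ _ ?_
      rw [← sub_add_cancel (M.e (t, i, j) * F) (F * M.e (t, i, j))]
      refine add_mem ?_ (Ideal.mul_mem_left _ _ (Ideal.subset_span ⟨_, ⟨hij, hC⟩, rfl⟩))
      rw [hF, M.commutator_e]
      split_ifs with hts hjk hli hli
      · subst hts hjk hli
        exact absurd rfl hC
      · subst hts hjk
        have h6 : p i ≠ p l := fun h => hli (hp h).symm
        rw [sub_zero]
        refine Ideal.subset_span ⟨(t, i, l), ⟨?_, ?_⟩, rfl⟩
        · change p l < p i
          omega
        · rintro ⟨⟩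
          exact hli rfl
      · subst hts hli
        have h6 : p j ≠ p k := fun h => hjk (hp h)
        rw [zero_sub]
        refine neg_mem (Ideal.subset_span ⟨(t, k, j), ⟨?_, ?_⟩, rfl⟩)
        · change p j < p k
          omega
        · rintro ⟨⟩
          exact hne rfl
      · simp
      · exact zero_mem _
    have hpow : ∀ r : ℕ, u * M.e b * F ^ r ∈ Ideal.span (M.e '' C) := by
      intro r
      induction r with
      | zero =>
        rw [pow_zero, mul_one]
        refine Ideal.mul_mem_left _ _ (Ideal.subset_span ⟨b, ⟨?_, hbE⟩, rfl⟩)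
        change (0 : ℤ) < (p b.2.1 : ℤ) - p b.2.2 at hb
        omega
      | succ r ih => rw [pow_succ, ← mul_assoc]; exact hstep _ ih
    refine M.chi_nil lam (Ideal.span_mono (Set.image_mono ?_) (hpow _))
    rintro c ⟨hc, -⟩
    change (0 : ℤ) < (p c.2.1 : ℤ) - p c.2.2
    omega

section Weyl

variable {T : MvPolynomial (I × κ) K →ₐ[K] UniversalEnvelopingAlgebra K 𝔤}
  (hT : ∀ s i, T (MvPolynomial.X (s, i)) = M.e (s, i, i)) {z : UniversalEnvelopingAlgebra K 𝔤}
  (hz : z ∈ Subalgebra.center K (UniversalEnvelopingAlgebra K 𝔤)) {P : MvPolynomial (I × κ) K}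
  (hzP : z - T P ∈ (M.lower p).nil)

include hp hT hz hzP

/-- Compute `chi (z * F ^ (r + 1))` twice. Moving the central `z` to the right gives its value
`P(lam)` on the highest weight vector; writing `z` as `T P` plus an element of `nil`, which kills
the singular vector, gives `P` at the weight of that vector. -/
theorem eval_eq_of_integral (s : I) {k l : κ} (hkl : p l = p k + 1) (r : ℕ) (lam : I × κ → K)
    (hlam : lam (s, l) - lam (s, k) = r) :
    MvPolynomial.eval (fun b => lam b + ((r + 1 : ℕ) : K) * ((if b = (s, k) then 1 else 0) -
      (if b = (s, l) then 1 else 0))) P = MvPolynomial.eval lam P := by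
  set F := M.e (s, k, l) with hF
  have hFr : ∀ r, M.chi p lam (F ^ r) = 1 := M.chi_pow lam s (by omega)
  have h1 : M.chi p lam (z * F ^ (r + 1)) = MvPolynomial.eval lam P := by
    rw [← Subalgebra.mem_center_iff.1 hz, ← sub_add_cancel z (T P), mul_add, map_add,
      M.chi_nil lam (Ideal.mul_mem_left _ _ hzP), zero_add, M.chi_mul_torus hp hT, hFr, mul_one]
  rw [← h1]
  have h2 : z = (z - T P) + T P := by abel
  rw [h2, add_mul, map_add, M.nil_mul_pow_chi lam s hkl r hlam hp hzP, zero_add,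
    M.torus_mul_e_pow hT, M.chi_mul_torus hp hT, hFr, mul_one]
  rw [← MvPolynomial.coe_aeval_eq_eval, ← MvPolynomial.coe_aeval_eq_eval, RingHom.coe_coe,
    RingHom.coe_coe, ← AlgHom.comp_apply]
  congr 1
  ext1 b
  simp

/-- The shift by `d` of the Harish-Chandra image of a central element is invariant under simple
reflections. -/
theorem eval_swap_simple (d : ℕ → K) (hd : ∀ m, d (m + 1) = d m + 1) (s : I) {k l : κ}
    (hkl : p l = p k + 1) (mu : I × κ → K) :
    MvPolynomial.eval (fun b => mu (Equiv.swap (s, k) (s, l) b) - d (p b.2)) P =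
      MvPolynomial.eval (fun b => mu b - d (p b.2)) P := by
  have hne : k ≠ l := by rintro rfl; omega
  have hne' : (s, k) ≠ (s, l) := fun h => hne (Prod.ext_iff.1 h).2
  -- the difference, as a polynomial in the coordinate at `(s, l)`
  let v : Polynomial K → I × κ → Polynomial K := fun x b =>
    (if b = (s, l) then x else Polynomial.C (mu b))
  let R : Polynomial K :=
    MvPolynomial.aeval (fun b => v (Polynomial.X + Polynomial.C (mu (s, k)))
      (Equiv.swap (s, k) (s, l) b) - Polynomial.C (d (p b.2))) P -
    MvPolynomial.aeval (fun b => v (Polynomial.X + Polynomial.C (mu (s, k))) b -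
      Polynomial.C (d (p b.2))) P
  have hR : ∀ t : K, R.eval t =
      MvPolynomial.eval (fun b => (Function.update mu (s, l) (t + mu (s, k)))
        (Equiv.swap (s, k) (s, l) b) - d (p b.2)) P -
      MvPolynomial.eval (fun b => (Function.update mu (s, l) (t + mu (s, k))) b - d (p b.2)) P := by
    intro t
    have h1 : ∀ g : I × κ → Polynomial K, (MvPolynomial.aeval g P).eval t =
        MvPolynomial.eval (fun b => (g b).eval t) P := by
      intro g
      rw [← Polynomial.coe_evalRingHom, MvPolynomial.aeval_def, MvPolynomial.hom_eval₂]
      have : (Polynomial.evalRingHom t).comp (algebraMap K (Polynomial K)) = RingHom.id K := by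
        ext x; simp
      rw [this]
      rfl
    have h2 : ∀ b, (v (Polynomial.X + Polynomial.C (mu (s, k))) b).eval t =
        Function.update mu (s, l) (t + mu (s, k)) b := by
      intro b
      by_cases hb : b = (s, l)
      · subst hb; simp [v]
      · simp [v, hb]
    rw [Polynomial.eval_sub, h1, h1]
    simp only [Polynomial.eval_sub, Polynomial.eval_C, h2]
  -- The variable of `R` is `t = mu_l - mu_k`. For `t = r + 1` the unshifted weight `mu - d`
  -- satisfies the integrality condition with `r`, because `d` grows by one from `k` to `l`, and
  -- adding `(r + 1)(ε_k - ε_l)` interchanges `mu_k` and `mu_l`. So `R` has infinitely many roots.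
  have hR0 : R = 0 := by
    refine Polynomial.eq_zero_of_infinite_isRoot R ?_
    refine Set.Infinite.mono (s := Set.range fun r : ℕ => ((r + 1 : ℕ) : K)) ?_
      (Set.infinite_range_of_injective fun a b h => by simpa using h)
    rintro _ ⟨r, rfl⟩
    change R.eval _ = 0
    rw [hR, sub_eq_zero]
    set nu := Function.update mu (s, l) (((r + 1 : ℕ) : K) + mu (s, k)) with hnu
    have hnul : nu (s, l) = ((r + 1 : ℕ) : K) + mu (s, k) := by simp [hnu]
    have hnuk : nu (s, k) = mu (s, k) := by simp [hnu, hne]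
    rw [← M.eval_eq_of_integral hp hT hz hzP s hkl r (fun b => nu b - d (p b.2))]
    · congr 2
      funext b
      by_cases hbk : b = (s, k)
      · subst hbk
        rw [Equiv.swap_apply_left, hnul, hnuk]
        simp [hne]
        ring
      · by_cases hbl : b = (s, l)
        · subst hbl
          rw [Equiv.swap_apply_right, hnul, hnuk]
          simp [Ne.symm hne]
          ring
        · rw [Equiv.swap_apply_of_ne_of_ne hbk hbl]
          simp [hbk, hbl]
    · simp only [hnul, hnuk, hkl, hd]
      push_cast
      ring
  have := hR (mu (s, l) - mu (s, k))
  rw [hR0, Polynomial.eval_zero, sub_add_cancel, Function.update_eq_self] at this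
  exact (sub_eq_zero.1 this.symm)

/-- Any transposition is obtained from adjacent ones by conjugation; `hseg` says that the positions
have no gaps, so the intermediate indices exist. -/
theorem eval_swap (d : ℕ → K) (hd : ∀ m, d (m + 1) = d m + 1)
    (hseg : ∀ i, ∀ m < p i, ∃ j, p j = m) (s : I) (k l : κ) (mu : I × κ → K) :
    MvPolynomial.eval (fun b => mu (Equiv.swap (s, k) (s, l) b) - d (p b.2)) P =
      MvPolynomial.eval (fun b => mu b - d (p b.2)) P := by
  have key : ∀ (n : ℕ) (k l : κ), p l = p k + n → ∀ mu : I × κ → K,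
    MvPolynomial.eval (fun b => mu (Equiv.swap (s, k) (s, l) b) - d (p b.2)) P =
      MvPolynomial.eval (fun b => mu b - d (p b.2)) P := by
    intro n
    induction n with
    | zero =>
      intro k l h mu
      obtain rfl := hp h
      simp
    | succ n ih =>
      intro k l h mu
      obtain ⟨j, hj⟩ := hseg l (p k + n) (by omega)
      rcases n.eq_zero_or_pos with rfl | hn
      · exact M.eval_swap_simple hp hT hz hzP d hd s (by omega) mu
      have hkj : (s, k) ≠ (s, j) := fun h => by
        have := (Prod.ext_iff.1 h).2
        simp only at this
        rw [this] at hj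
        omega
      have hkl : (s, k) ≠ (s, l) := fun h' => by
        have := (Prod.ext_iff.1 h').2
        simp only at this
        rw [this] at h
        omega
      have hsw : Equiv.swap (s, k) (s, l) =
          Equiv.swap (s, j) (s, l) * Equiv.swap (s, k) (s, j) * Equiv.swap (s, j) (s, l) := by
        rw [Equiv.swap_mul_swap_mul_swap hkj hkl, Equiv.swap_comm]
      rw [hsw]
      have e1 := M.eval_swap_simple hp hT hz hzP d hd s (k := j) (l := l) (by omega)
      have e2 := ih k j hj
      simp only [Equiv.Perm.mul_apply]
      rw [e1 (fun b => mu (Equiv.swap (s, j) (s, l) (Equiv.swap (s, k) (s, j) b))),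
        e2 (fun b => mu (Equiv.swap (s, j) (s, l) b)), e1]
  rcases le_total (p k) (p l) with h | h
  · exact key (p l - p k) k l (by omega) mu
  · rw [Equiv.swap_comm]
    exact key (p k - p l) l k (by omega) mu

end Weyl

end MatrixUnits

/-! ### Gelfand invariants -/

namespace MatrixUnits

section Gelfand

variable {K 𝔤 I κ : Type*} [Field K] [LieRing 𝔤] [LieAlgebra K 𝔤] [DecidableEq I]
    [DecidableEq κ] [Fintype κ] (M : MatrixUnits K 𝔤 I κ)

/-- The entries of the powers of the matrix of the matrix units `E_ij` in the factor `s`. -/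
def gelfand (s : I) : ℕ → κ → κ → UniversalEnvelopingAlgebra K 𝔤
  | 0, i, j => if i = j then 1 else 0
  | k + 1, i, j => ∑ l, gelfand s k i l * M.e (s, l, j)

/-- The entries of every power of the matrix `(E_ij)` transform under the adjoint action like the
matrix units themselves. This passes from `k` to `k + 1` by the Leibniz rule, the two inner sums
cancelling. -/
theorem commutator_gelfand (s : I) (k : ℕ) (t : I) (a b i j : κ) :
    M.e (t, a, b) * M.gelfand s k i j - M.gelfand s k i j * M.e (t, a, b) =
      if t = s then (if b = i then M.gelfand s k a j else 0) -
        (if j = a then M.gelfand s k i b else 0) else 0 := by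
  induction k generalizing i j with
  | zero =>
    simp only [gelfand, mul_ite, mul_one, mul_zero, ite_mul, one_mul, zero_mul, sub_self]
    split_ifs <;> simp_all
  | succ k ih =>
    have h1 : M.e (t, a, b) * M.gelfand s (k + 1) i j - M.gelfand s (k + 1) i j * M.e (t, a, b) =
        ∑ l, ((M.e (t, a, b) * M.gelfand s k i l - M.gelfand s k i l * M.e (t, a, b)) *
          M.e (s, l, j) + M.gelfand s k i l *
          (M.e (t, a, b) * M.e (s, l, j) - M.e (s, l, j) * M.e (t, a, b))) := by
      rw [gelfand, Finset.mul_sum, Finset.sum_mul, ← Finset.sum_sub_distrib]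
      refine Finset.sum_congr rfl fun l _ => ?_
      noncomm_ring
    rw [h1]
    simp only [ih, M.commutator_e]
    by_cases hts : t = s
    · subst hts
      simp only [if_true, sub_mul, mul_sub, ite_mul, mul_ite, zero_mul, mul_zero,
        Finset.sum_add_distrib, Finset.sum_sub_distrib, Finset.sum_ite_eq, Finset.sum_ite_eq',
        Finset.mem_univ, gelfand]
      by_cases hbi : b = i <;> by_cases hja : j = a <;> simp [hbi, hja, ← sub_eq_neg_add]
    · simp [hts]

theorem trace_gelfand_mem_center (s : I) (k : ℕ) :
    ∑ i, M.gelfand s k i i ∈ Subalgebra.center K (UniversalEnvelopingAlgebra K 𝔤) := by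
  refine mem_center_of_commute M.basis ?_
  rintro ⟨t, a, b⟩
  refine sub_eq_zero.1 ?_
  change M.e (t, a, b) * _ - _ * M.e (t, a, b) = 0
  rw [Finset.mul_sum, Finset.sum_mul, ← Finset.sum_sub_distrib]
  simp only [commutator_gelfand]
  by_cases hts : t = s
  · simp [hts]
  · simp [hts]

variable [CharZero K] [Fintype I] {p : κ → ℕ} (hp : Function.Injective p)

include hp

/-- In each product of the sum for the next power, either the last factor is positive, or it is
diagonal, or it can be moved to the left; in the last case the correction is again the entry `(i,
j)` of the previous power. -/
theorem gelfand_mem_nil (s : I) (k : ℕ) {i j : κ} (hij : p j < p i) :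
    M.gelfand s k i j ∈ (M.lower p).nil := by
  induction k generalizing i j with
  | zero =>
    rw [gelfand, if_neg]
    · exact zero_mem _
    · rintro rfl; omega
  | succ k ih =>
    refine sum_mem fun l _ => ?_
    rcases lt_trichotomy (p j) (p l) with h | h | h
    · refine Ideal.mul_mem_left _ _ (Ideal.subset_span ⟨(s, l, j), ?_, rfl⟩)
      change (0 : ℤ) < (p l : ℤ) - p j
      omega
    · obtain rfl := hp h
      exact (M.lower p).nil_mul_mem (b := (s, j, j)) (ih hij) (sub_self _).ge
    · have h1 := M.commutator_gelfand s k s l j i l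
      rw [if_pos rfl, if_neg (by rintro rfl; omega), if_pos rfl] at h1
      rw [← sub_sub_cancel (M.e (s, l, j) * M.gelfand s k i l)
        (M.gelfand s k i l * M.e (s, l, j)), h1, zero_sub, sub_neg_eq_add]
      exact add_mem (Ideal.mul_mem_left _ _ (ih (by omega))) (ih hij)

variable {T : MvPolynomial (I × κ) K →ₐ[K] UniversalEnvelopingAlgebra K 𝔤}
  (hT : ∀ s i, T (MvPolynomial.X (s, i)) = M.e (s, i, i))

include hT

theorem exists_gelfand_diag (s : I) (k : ℕ) (i : κ) : ∃ y : MvPolynomial (I × κ) K,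
    M.gelfand s (k + 1) i i - T y ∈ (M.lower p).nil ∧
      (y - MvPolynomial.X (s, i) ^ (k + 1)).totalDegree ≤ k := by
  induction k generalizing i with
  | zero =>
    refine ⟨MvPolynomial.X (s, i), ?_, by simp⟩
    rw [hT]
    simp [gelfand]
  | succ k ih =>
    choose y hy hyd using ih
    have hydeg : ∀ i, (y i).totalDegree ≤ k + 1 := fun i => by
      rw [← sub_add_cancel (y i) (MvPolynomial.X (s, i) ^ (k + 1))]
      refine (MvPolynomial.totalDegree_add _ _).trans (max_le ((hyd i).trans (by omega)) ?_)
      rw [MvPolynomial.totalDegree_X_pow]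
    -- In the sum over `l` of the entry `(i, l)` of the previous power times `E_li`, the term `l =
    -- i` gives `y_i x_i` and the terms with `p l > p i` lie in `nil`. For `p l < p i`, moving
    -- `E_li` to the left leaves the commutator `y_i - y_l`, of lower degree.
    refine ⟨y i * MvPolynomial.X (s, i) +
      ∑ l, if p l < p i then y i - y l else 0, ?_, ?_⟩
    · have h1 : ∀ l, M.gelfand s (k + 1) i l * M.e (s, l, i) -
          T ((if l = i then y i * MvPolynomial.X (s, i) else 0) +
            if p l < p i then y i - y l else 0) ∈ (M.lower p).nil := by
        intro l
        rcases lt_trichotomy (p i) (p l) with h | h | h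
        · rw [if_neg (by rintro rfl; omega), if_neg (by omega), add_zero, map_zero, sub_zero]
          refine Ideal.mul_mem_left _ _ (Ideal.subset_span ⟨(s, l, i), ?_, rfl⟩)
          change (0 : ℤ) < (p l : ℤ) - p i
          omega
        · obtain rfl := hp h
          rw [if_pos rfl, if_neg (by omega), add_zero, map_mul, hT, ← sub_mul]
          exact (M.lower p).nil_mul_mem (b := (s, i, i)) (hy i) (sub_self _).ge
        · rw [if_neg (by rintro rfl; omega), if_pos h, zero_add, map_sub]
          have h1 := M.commutator_gelfand s (k + 1) s l i i l
          rw [if_pos rfl, if_pos rfl, if_pos rfl] at h1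
          rw [← sub_sub_cancel (M.e (s, l, i) * M.gelfand s (k + 1) i l)
            (M.gelfand s (k + 1) i l * M.e (s, l, i)), h1]
          have h2 := sub_mem (hy i) (hy l)
          have h3 := Ideal.mul_mem_left _ (M.e (s, l, i)) (M.gelfand_mem_nil hp s (k + 1) h)
          convert add_mem h2 h3 using 1
          abel
      have h2 := sum_mem (t := Finset.univ) fun l _ => h1 l
      rw [Finset.sum_sub_distrib, ← map_sum, Finset.sum_add_distrib, Finset.sum_ite_eq',
        if_pos (Finset.mem_univ _)] at h2
      exact h2
    · have h1 : y i * MvPolynomial.X (s, i) + (∑ l, if p l < p i then y i - y l else 0) -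
          MvPolynomial.X (s, i) ^ (k + 1 + 1) =
          (y i - MvPolynomial.X (s, i) ^ (k + 1)) * MvPolynomial.X (s, i) +
            ∑ l, if p l < p i then y i - y l else 0 := by ring
      rw [h1]
      refine (MvPolynomial.totalDegree_add _ _).trans (max_le ?_ ?_)
      · refine (MvPolynomial.totalDegree_mul _ _).trans ?_
        rw [MvPolynomial.totalDegree_X]
        exact Nat.add_le_add_right (hyd i) 1
      · refine MvPolynomial.totalDegree_finsetSum_le fun l _ => ?_
        split_ifs
        · exact (MvPolynomial.totalDegree_sub _ _).trans (max_le (hydeg i) (hydeg l))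
        · simp

/-- There are central elements whose Harish-Chandra images have the power sums as leading terms. -/
theorem exists_central_leading_psum (s : I) (k : ℕ) :
    ∃ z ∈ Subalgebra.center K (UniversalEnvelopingAlgebra K 𝔤), ∃ P : MvPolynomial (I × κ) K,
      z - T P ∈ (M.lower p).nil ∧
        (P - ∑ i, MvPolynomial.X (s, i) ^ (k + 1)).totalDegree ≤ k := by
  choose y hy hyd using M.exists_gelfand_diag hp hT s k
  refine ⟨_, M.trace_gelfand_mem_center s (k + 1), ∑ i, y i, ?_, ?_⟩
  · rw [map_sum, ← Finset.sum_sub_distrib]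
    exact sum_mem fun i _ => hy i
  · rw [← Finset.sum_sub_distrib]
    exact MvPolynomial.totalDegree_finsetSum_le fun i _ => hyd i

end Gelfand

end MatrixUnits

/-! ### Injectivity on the centre -/

section Chevalley

variable {K R V : Type*} [Field K] [CharZero K] [CommRing R] [IsDomain R] [Algebra K R]

/-- A polynomial without constant term which is annihilated by derivations close to multiples of the
partial derivatives vanishes. -/
theorem eq_zero_of_derivations {D : V → Derivation K (MvPolynomial V R) (MvPolynomial V R)}
    {c : V → R} (hc : ∀ v, c v ≠ 0)
    (hD : ∀ v w, D v (MvPolynomial.X w) - MvPolynomial.C (c v) * MvPolynomial.pderiv v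
      (MvPolynomial.X w) ∈ MvPolynomial.idealOfVars V R)
    {Q : MvPolynomial V R} (hQ : Q ∈ MvPolynomial.idealOfVars V R) (h0 : ∀ v, D v Q = 0) :
    Q = 0 := by
  have : CharZero R := charZero_of_injective_algebraMap (algebraMap K R).injective
  set J := MvPolynomial.idealOfVars V R with hJ
  -- The coefficients in `R` are only required to be moved `K`-linearly by `D v`, hence the
  -- restriction of scalars. The difference with `c v ∂_v` preserves the ideal `J` of the variables.
  let E : V → Derivation K (MvPolynomial V R) (MvPolynomial V R) := fun v =>
    D v - (MvPolynomial.C (c v) : MvPolynomial V R) •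
      (MvPolynomial.pderiv v : Derivation R (MvPolynomial V R) (MvPolynomial V R)).restrictScalars K
  have hE : ∀ v f, E v f = D v f - MvPolynomial.C (c v) * MvPolynomial.pderiv v f := fun v f => rfl
  have hEJ : ∀ v, ∀ f ∈ J, E v f ∈ J := by
    intro v f hf
    induction hf using Submodule.span_induction with
    | mem x hx => obtain ⟨w, rfl⟩ := hx; exact hD v w
    | zero => simp
    | add x y _ _ hx hy => rw [map_add]; exact add_mem hx hy
    | smul r x hx' hx =>
      rw [smul_eq_mul, Derivation.leibniz, smul_eq_mul, smul_eq_mul]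
      exact add_mem (Ideal.mul_mem_left _ _ hx) (Ideal.mul_mem_right _ _ hx')
  -- If `Q` has order at least `k + 1`, then so has `E v Q = -c v ∂_v Q`. Each `∂_v` of the part of
  -- degree `k + 1` therefore vanishes, and in characteristic zero so does that part.
  have key : ∀ k, Q ∈ J ^ (k + 1) := by
    intro k
    induction k with
    | zero => rwa [zero_add, pow_one]
    | succ k ih =>
      rw [MvPolynomial.mem_pow_idealOfVars_iff']
      intro m hm
      rcases (Nat.lt_succ_iff.1 hm).lt_or_eq with hlt | heq
      · exact (MvPolynomial.mem_pow_idealOfVars_iff' _ _).1 ih m hlt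
      · have hm0 : m ≠ 0 := by
          rintro rfl
          simp at heq
        obtain ⟨v, hv⟩ := Finsupp.support_nonempty_iff.2 hm0
        have h1 := derivation_mem_pow_of_stable J (E v) (hEJ v) ih
        rw [hE, h0, zero_sub, neg_mem_iff, MvPolynomial.mem_pow_idealOfVars_iff'] at h1
        have hle : Finsupp.single v 1 ≤ m := by
          rw [Finsupp.single_le_iff]
          exact Nat.one_le_iff_ne_zero.2 (Finsupp.mem_support_iff.1 hv)
        have h2 := h1 (m - Finsupp.single v 1) (by
          have := congrArg Finsupp.degree (tsub_add_cancel_of_le hle)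
          rw [map_add, Finsupp.degree_single] at this
          omega)
        rw [MvPolynomial.coeff_C_mul, MvPolynomial.coeff_pderiv, tsub_add_cancel_of_le hle] at h2
        rcases mul_eq_zero.1 h2 with h3 | h3
        · exact absurd h3 (hc v)
        · rcases mul_eq_zero.1 h3 with h4 | h4
          · exact h4
          · exact absurd h4 (Nat.cast_add_one_ne_zero _)
  ext m
  rw [MvPolynomial.coeff_zero]
  exact (MvPolynomial.mem_pow_idealOfVars_iff' _ _).1 (key m.degree) m (Nat.lt_succ_self _)

end Chevalley

namespace MatrixUnits

variable {K 𝔤 I κ : Type*} [Field K] [CharZero K] [LieRing 𝔤] [LieAlgebra K 𝔤] [DecidableEq I]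
    [DecidableEq κ] [Fintype I] [Fintype κ] (M : MatrixUnits K 𝔤 I κ)

/-- The linear form which represents the bracket of two matrix units. -/
def bracketForm (K : Type*) [Field K] (b c : I × κ × κ) : MvPolynomial (I × κ × κ) K :=
  if b.1 = c.1 then (if b.2.2 = c.2.1 then MvPolynomial.X (b.1, b.2.1, c.2.2) else 0) -
    (if c.2.2 = b.2.1 then MvPolynomial.X (b.1, c.2.1, b.2.2) else 0) else 0

omit [CharZero K] [Fintype I] [Fintype κ] in
theorem bracketForm_mem_span (b c : I × κ × κ) :
    bracketForm K b c ∈ Submodule.span K (Set.range MvPolynomial.X) := by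
  have h : ∀ (P : Prop) [Decidable P] (d : I × κ × κ), (if P then MvPolynomial.X d else 0) ∈
      Submodule.span K (Set.range (MvPolynomial.X : _ → MvPolynomial (I × κ × κ) K)) := by
    intro P _ d
    split_ifs
    · exact Submodule.subset_span ⟨d, rfl⟩
    · exact zero_mem _
  unfold bracketForm
  split_ifs
  · exact sub_mem (Submodule.subset_span ⟨_, rfl⟩) (Submodule.subset_span ⟨_, rfl⟩)
  · exact sub_mem (Submodule.subset_span ⟨_, rfl⟩) (zero_mem _)
  · exact sub_mem (zero_mem _) (Submodule.subset_span ⟨_, rfl⟩)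
  · exact sub_mem (zero_mem _) (zero_mem _)
  · exact zero_mem _

omit [CharZero K] in
theorem mkDerivation_eq_sum {B : Type*} [Fintype B] (f : B → MvPolynomial B K)
    (P : MvPolynomial B K) :
    MvPolynomial.mkDerivation K f P = ∑ b, f b * MvPolynomial.pderiv b P := by
  classical
  have hs : ∀ (t : Finset B) (D : B → Derivation K (MvPolynomial B K) (MvPolynomial B K))
      (x : MvPolynomial B K), (∑ b ∈ t, D b) x = ∑ b ∈ t, D b x := by
    intro t D x
    induction t using Finset.induction_on with
    | empty => simp
    | insert a t ha ih => rw [Finset.sum_insert ha, Finset.sum_insert ha, Derivation.add_apply, ih]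
  have h : MvPolynomial.mkDerivation K f = ∑ b, f b •
      (MvPolynomial.pderiv b : Derivation K (MvPolynomial B K) (MvPolynomial B K)) := by
    refine MvPolynomial.derivation_ext fun c => ?_
    simp [hs, MvPolynomial.mkDerivation_X, MvPolynomial.pderiv_X, Pi.single_apply]
  rw [h, hs]
  rfl

omit [CharZero K] in
theorem isHomogeneous_of_mem_span {B : Type*} {f : MvPolynomial B K}
    (hf : f ∈ Submodule.span K (Set.range MvPolynomial.X)) : f.IsHomogeneous 1 := by
  induction hf using Submodule.span_induction with
  | mem x hx => obtain ⟨i, rfl⟩ := hx; exact MvPolynomial.isHomogeneous_X _ _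
  | zero => exact MvPolynomial.isHomogeneous_zero _ _ _
  | add x y _ _ hx hy => exact hx.add hy
  | smul r x _ hx =>
    rw [MvPolynomial.smul_eq_C_mul]
    simpa using (MvPolynomial.isHomogeneous_C _ r).mul hx

omit [CharZero K] in
theorem isHomogeneous_mkDerivation {B : Type*} [Fintype B] {f : B → MvPolynomial B K}
    (hf : ∀ b, (f b).IsHomogeneous 1) {P : MvPolynomial B K} {d : ℕ}
    (hP : P.IsHomogeneous (d + 1)) :
    (MvPolynomial.mkDerivation K f P).IsHomogeneous (d + 1) := by
  rw [mkDerivation_eq_sum]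
  refine MvPolynomial.IsHomogeneous.sum _ _ _ fun b _ => ?_
  rw [add_comm d 1]
  exact (hf b).mul hP.pderiv

omit [CharZero K] in
theorem totalDegree_mkDerivation_le {B : Type*} [Fintype B] {f : B → MvPolynomial B K}
    (hf : ∀ b, f b ∈ Submodule.span K (Set.range MvPolynomial.X)) {P : MvPolynomial B K} {k : ℕ}
    (hP : P.totalDegree ≤ k) : (MvPolynomial.mkDerivation K f P).totalDegree ≤ k := by
  have h := mem_span_list_prod hP
  clear hP
  induction h using Submodule.span_induction with
  | mem Q hQ =>
    obtain ⟨l, hl, rfl⟩ := hQ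
    exact (totalDegree_mkDerivation_list_prod_le hf l).trans hl
  | zero => simp
  | add x y _ _ hx hy => rw [map_add]; exact (MvPolynomial.totalDegree_add _ _).trans (max_le hx hy)
  | smul r x _ hx => rw [Derivation.map_smul]; exact (MvPolynomial.totalDegree_smul_le _ _).trans hx

omit [CharZero K] in
/-- The leading symbol of a central element is invariant. -/
theorem mkDerivation_symbol_eq_zero {z : UniversalEnvelopingAlgebra K 𝔤}
    (hz : z ∈ Subalgebra.center K (UniversalEnvelopingAlgebra K 𝔤))
    (W : WeightBasis K 𝔤 (I × κ × κ))
    (hW : W.basis = M.basis) {d : ℕ} (hd : (W.theta.symm z).totalDegree ≤ d + 1)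
    (b : I × κ × κ) :
    MvPolynomial.mkDerivation K (bracketForm K b)
      (MvPolynomial.homogeneousComponent (d + 1) (W.theta.symm z)) = 0 := by
  have hWe : W.e = M.e := by funext c; rw [WeightBasis.e, hW]; rfl
  set P := W.theta.symm z with hP
  have hzP : z = pbwMap W.e K W.enum P := by
    rw [← WeightBasis.theta_apply, hP, LinearEquiv.apply_symm_apply]
  -- The commutator of `z` with `e b` is zero, so the derivation which models it sends `P` to a
  -- polynomial of degree at most `d`. Since the derivation respects degrees, it must annihilate the
  -- component of degree `d + 1`.
  have h1 := commutator_pbwMap_sub_mem (K := K) (e := W.e) W.nodup_enum W.mem_enum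
    (by rw [hWe]; exact M.commutator_mem_span) (s := bracketForm K b)
    (bracketForm_mem_span b) (x := W.e b) (fun c => by
      obtain ⟨s, i, j⟩ := b
      obtain ⟨t, k, l⟩ := c
      rw [hWe, M.commutator_e]
      simp only [bracketForm]
      have hX := fun c => pbwMap_X (K := K) (e := M.e) W.nodup_enum (W.mem_enum c)
      split_ifs <;> simp [hX]) hd
  rw [← hzP, Subalgebra.mem_center_iff.1 hz, sub_self, zero_sub, neg_mem_iff] at h1
  have h2 := shorter_le_map_pbwMap W.nodup_enum (fun c _ => W.mem_enum c)
    (fun a _ c _ => by rw [Set.image_univ, hWe]; exact M.commutator_mem_span a c) _ h1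
  obtain ⟨Q, hQ, hQ'⟩ := h2
  have h3 : Q = MvPolynomial.mkDerivation K (bracketForm K b) P := W.theta.injective hQ'
  have h4 : MvPolynomial.homogeneousComponent (d + 1)
      (MvPolynomial.mkDerivation K (bracketForm K b) P) = 0 := by
    refine MvPolynomial.homogeneousComponent_eq_zero' _ _ fun m hm => ?_
    rw [← h3] at hm
    exact (hQ hm).2.2.ne
  have h5 := isHomogeneous_mkDerivation
    (fun c => isHomogeneous_of_mem_span (bracketForm_mem_span b c))
    (MvPolynomial.homogeneousComponent_isHomogeneous (d + 1) P)
  have h6 : P = MvPolynomial.homogeneousComponent (d + 1) P +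
      (P - MvPolynomial.homogeneousComponent (d + 1) P) := by abel
  have h7 : (P - MvPolynomial.homogeneousComponent (d + 1) P).totalDegree ≤ d := by
    refine Finset.sup_le fun m hm => ?_
    have hm' := MvPolynomial.mem_support_iff.1 hm
    rw [MvPolynomial.coeff_sub, MvPolynomial.coeff_homogeneousComponent] at hm'
    by_contra hlt
    have h8 : m.degree = d + 1 := by
      refine le_antisymm ?_ (not_le.1 hlt)
      by_contra hgt
      refine hm' ?_
      rw [if_neg (by omega), sub_zero]
      by_contra hne
      exact hgt ((MvPolynomial.le_totalDegree (MvPolynomial.mem_support_iff.2 hne)).trans hd)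
    exact hm' (by rw [if_pos h8, sub_self])
  have h9 := totalDegree_mkDerivation_le (bracketForm_mem_span b) h7
  rw [h6, map_add, map_add, MvPolynomial.homogeneousComponent_of_mem h5, if_pos rfl,
    MvPolynomial.homogeneousComponent_eq_zero _ _ (Nat.lt_succ_of_le h9), add_zero] at h4
  exact h4

/-- Polynomials on matrices, as polynomials in the off-diagonal entries. -/
def offDiagEquiv (K I κ : Type*) [Field K] [DecidableEq κ] : MvPolynomial (I × κ × κ) K ≃ₐ[K]
    MvPolynomial {b : I × κ × κ // b.2.1 ≠ b.2.2}
      (MvPolynomial {b : I × κ × κ // ¬ b.2.1 ≠ b.2.2} K) :=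
  (MvPolynomial.renameEquiv K
    (Equiv.sumCompl fun b : I × κ × κ => b.2.1 ≠ b.2.2).symm).trans
    (MvPolynomial.sumAlgEquiv K _ _)

omit [CharZero K] [DecidableEq I] [Fintype I] [Fintype κ] in
theorem offDiagEquiv_X_of_ne {b : I × κ × κ} (hb : b.2.1 ≠ b.2.2) :
    offDiagEquiv K I κ (MvPolynomial.X b) = MvPolynomial.X ⟨b, hb⟩ := by
  simp [offDiagEquiv, Equiv.sumCompl_symm_apply_of_pos, hb]

omit [CharZero K] [DecidableEq I] [Fintype I] [Fintype κ] in
theorem offDiagEquiv_X_of_eq {b : I × κ × κ} (hb : ¬ b.2.1 ≠ b.2.2) :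
    offDiagEquiv K I κ (MvPolynomial.X b) = MvPolynomial.C (MvPolynomial.X ⟨b, hb⟩) := by
  simp [offDiagEquiv, Equiv.sumCompl_symm_apply_of_neg, hb]

-- An infinitesimal form of Chevalley restriction. The hypothesis on the support says that `Q`
-- vanishes on diagonal matrices. Modulo the off-diagonal entries, `ad E_ji` sends the entry `x_ij`
-- to `x_jj - x_ii` and every other off-diagonal entry to zero. Over the ring of polynomials in the
-- diagonal entries it is thus a non-zero multiple of `∂_ij` to first order, and
-- `eq_zero_of_derivations` applies.
omit [Fintype I] [Fintype κ] in
theorem eq_zero_of_invariant {Q : MvPolynomial (I × κ × κ) K}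
    (hQ : ∀ m ∈ Q.support, ∃ b : I × κ × κ, m b ≠ 0 ∧ b.2.1 ≠ b.2.2)
    (h : ∀ b, MvPolynomial.mkDerivation K (bracketForm K b) Q = 0) : Q = 0 := by
  set φ := offDiagEquiv K I κ with hφ
  set S := MvPolynomial {b : I × κ × κ // b.2.1 ≠ b.2.2}
      (MvPolynomial {b : I × κ × κ // ¬ b.2.1 ≠ b.2.2} K)
  let D : {b : I × κ × κ // b.2.1 ≠ b.2.2} → Derivation K S S := fun v =>
    Derivation.mk' (φ.toLinearMap ∘ₗ
      (MvPolynomial.mkDerivation K (bracketForm K (v.1.1, v.1.2.2, v.1.2.1))).toLinearMap ∘ₗ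
        φ.symm.toLinearMap) fun f g => by
      simp [Derivation.leibniz]
  have hD : ∀ v f, D v f = φ (MvPolynomial.mkDerivation K
      (bracketForm K (v.1.1, v.1.2.2, v.1.2.1)) (φ.symm f)) := fun v f => rfl
  let c : {b : I × κ × κ // b.2.1 ≠ b.2.2} →
      MvPolynomial {b : I × κ × κ // ¬ b.2.1 ≠ b.2.2} K := fun v =>
    MvPolynomial.X ⟨(v.1.1, v.1.2.2, v.1.2.2), by simp⟩ -
      MvPolynomial.X ⟨(v.1.1, v.1.2.1, v.1.2.1), by simp⟩
  have hφQ : φ Q = 0 := by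
    refine eq_zero_of_derivations (D := D) (c := c) ?_ ?_ ?_ ?_
    · rintro ⟨⟨s, i, j⟩, hij⟩ h0
      have h1 := MvPolynomial.X_injective (sub_eq_zero.1 h0)
      have h2 := congrArg (fun x => x.1.2.1) h1
      exact hij h2.symm
    · rintro ⟨⟨s, i, j⟩, hij⟩ ⟨⟨t, k, l⟩, hkl⟩
      have hmem : ∀ (a b : κ), a ≠ b → φ (MvPolynomial.X (s, a, b)) ∈
          MvPolynomial.idealOfVars {b : I × κ × κ // b.2.1 ≠ b.2.2}
            (MvPolynomial {b : I × κ × κ // ¬ b.2.1 ≠ b.2.2} K) := by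
        intro a b hab
        rw [hφ, offDiagEquiv_X_of_ne (b := (s, a, b)) hab]
        exact Ideal.subset_span ⟨_, rfl⟩
      rw [hD, ← offDiagEquiv_X_of_ne hkl, ← hφ, AlgEquiv.symm_apply_apply,
        MvPolynomial.mkDerivation_X, hφ, offDiagEquiv_X_of_ne hkl, ← hφ]
      simp only [bracketForm]
      change i ≠ j at hij
      change k ≠ l at hkl
      by_cases hst : s = t
      · subst hst
        by_cases hik : i = k
        · subst hik
          by_cases hjl : j = l
          · subst hjl
            rw [MvPolynomial.pderiv_X_self, mul_one, if_pos rfl, if_pos rfl, if_pos rfl, map_sub,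
              hφ, offDiagEquiv_X_of_eq (b := (s, j, j)) (by simp),
              offDiagEquiv_X_of_eq (b := (s, i, i)) (by simp)]
            simp [c]
          · rw [MvPolynomial.pderiv_X_of_ne, mul_zero, sub_zero, if_pos rfl, if_pos rfl, if_neg,
              sub_zero]
            · exact hmem _ _ hjl
            · exact Ne.symm hjl
            · intro h'
              exact hjl (congrArg (fun x => x.1.2.2) h').symm
        · rw [MvPolynomial.pderiv_X_of_ne, mul_zero, sub_zero, if_pos rfl, if_neg hik]
          · by_cases hjl : l = j
            · rw [if_pos hjl, zero_sub, map_neg, neg_mem_iff]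
              exact hmem _ _ (Ne.symm hik)
            · rw [if_neg hjl, sub_zero, map_zero]
              exact zero_mem _
          · intro h'
            exact hik (congrArg (fun x => x.1.2.1) h').symm
      · rw [MvPolynomial.pderiv_X_of_ne, mul_zero, sub_zero, if_neg hst, map_zero]
        · exact zero_mem _
        · intro h'
          exact hst (congrArg (fun x => x.1.1) h').symm
    · rw [Q.as_sum, map_sum]
      refine sum_mem fun m hm => ?_
      obtain ⟨b, hb, hne⟩ := hQ m hm
      have hdvd : (MvPolynomial.X b : MvPolynomial (I × κ × κ) K) ∣
          MvPolynomial.monomial m (Q.coeff m) :=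
        MvPolynomial.X_dvd_monomial.2 (Or.inr hb)
      obtain ⟨g, hg⟩ := hdvd
      rw [hg, map_mul, hφ, offDiagEquiv_X_of_ne hne]
      exact Ideal.mul_mem_right _ _ (Ideal.subset_span ⟨_, rfl⟩)
    · intro v
      rw [hD, AlgEquiv.symm_apply_apply, h, map_zero]
  rwa [map_eq_zero_iff φ φ.injective] at hφQ

/-- The Harish-Chandra homomorphism is injective on the centre. -/
theorem eq_zero_of_mem_center_of_mem_nil {p : κ → ℕ} {z : UniversalEnvelopingAlgebra K 𝔤}
    (hz : z ∈ Subalgebra.center K (UniversalEnvelopingAlgebra K 𝔤)) (hn : z ∈ (M.lower p).nil) :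
    z = 0 := by
  rw [WeightBasis.nil_eq_map_theta] at hn
  set P := (M.lower p).theta.symm z with hP
  have hP0 : P = 0 := by
    by_contra hne
    -- The component of top degree is an invariant symbol. All its monomials contain a strictly
    -- lower triangular variable, so it vanishes on the diagonal and must be zero, against the
    -- choice of `m`.
    obtain ⟨m, hm, hmd⟩ := Finset.exists_mem_eq_sup P.support
      (MvPolynomial.support_nonempty.2 hne) fun m => m.degree
    have hdeg : P.totalDegree = m.degree := hmd
    obtain ⟨b, hb, -⟩ := hn hm
    have hm0 : m.degree ≠ 0 := fun h => hb (by rw [(Finsupp.degree_eq_zero_iff m).1 h]; rfl)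
    obtain ⟨d, hd⟩ := Nat.exists_eq_succ_of_ne_zero hm0
    have h1 := M.mkDerivation_symbol_eq_zero hz (M.lower p) rfl (d := d)
      (by rw [← hP, hdeg, hd])
    have h2 := eq_zero_of_invariant ?_ h1
    · have h3 := congrArg (MvPolynomial.coeff m) h2
      rw [MvPolynomial.coeff_homogeneousComponent, if_pos hd, MvPolynomial.coeff_zero] at h3
      exact MvPolynomial.mem_support_iff.1 hm h3
    · intro m' hm'
      rw [MvPolynomial.mem_support_iff, MvPolynomial.coeff_homogeneousComponent] at hm'
      have hm'' : m' ∈ P.support := by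
        rw [MvPolynomial.mem_support_iff]
        intro h
        rw [← hP, h, ite_self] at hm'
        exact hm' rfl
      obtain ⟨b, hb, hw⟩ := hn hm''
      refine ⟨b, hb, fun h => ?_⟩
      change (0 : ℤ) < (p b.2.1 : ℤ) - p b.2.2 at hw
      rw [h] at hw
      omega
  rw [← (M.lower p).theta.apply_symm_apply z, ← hP, hP0, map_zero]

end MatrixUnits

/-! ### Polynomials which are symmetric in blocks of variables -/

section Symmetric

variable {K I κ : Type*} [Field K] [Fintype κ]

/-- The power sum of the variables in the block `s`. -/
def blockPsum (K : Type*) [Field K] (s : I) (k : ℕ) : MvPolynomial (I × κ) K :=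
  ∑ i, MvPolynomial.X (s, i) ^ k

/-- The algebra generated by the power sums of exponent at most `d`. -/
def psumAlgebra (K I κ : Type*) [Field K] [Fintype κ] (d : ℕ) :
    Subalgebra K (MvPolynomial (I × κ) K) :=
  Algebra.adjoin K {P | ∃ s, ∃ k ≤ d, P = blockPsum K s k}

theorem blockPsum_mem (s : I) {k d : ℕ} (h : k ≤ d) :
    (blockPsum K s k : MvPolynomial (I × κ) K) ∈ psumAlgebra K I κ d :=
  Algebra.subset_adjoin ⟨s, k, h, rfl⟩

open Classical in
/-- The sum of the monomials with exponents `lam` over all choices of distinct variables in the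
block `s`. -/
def monSum (K : Type*) [Field K] (s : I) {r : ℕ} (lam : Fin r → ℕ) : MvPolynomial (I × κ) K :=
  ∑ f : Fin r ↪ κ, ∏ j, MvPolynomial.X (s, f j) ^ lam j

/-- The index in the power sum is either new, which lengthens the embedding, or one of those already
chosen, which raises an exponent. -/
theorem blockPsum_mul_monSum (s : I) {r : ℕ} (a : ℕ) (lam : Fin r → ℕ) :
    (blockPsum K s a * monSum K s lam : MvPolynomial (I × κ) K) =
      monSum K s (Fin.cons a lam : Fin (r + 1) → ℕ) +
        ∑ j, monSum K s (Function.update lam j (lam j + a)) := by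
  classical
  have h1 : (monSum K s (Fin.cons a lam : Fin (r + 1) → ℕ) : MvPolynomial (I × κ) K) =
      ∑ f : Fin r ↪ κ, ∑ i : {i // i ∉ Set.range f},
        MvPolynomial.X (s, i.1) ^ a * ∏ j, MvPolynomial.X (s, f j) ^ lam j := by
    rw [monSum, ← Fintype.sum_sigma', ← (Equiv.embeddingFinSucc r κ).symm.sum_comp]
    refine Finset.sum_congr (by congr) fun f _ => ?_
    rw [Fin.prod_univ_succ]
    simp
  have h2 : (∑ j, monSum K s (Function.update lam j (lam j + a)) : MvPolynomial (I × κ) K) =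
      ∑ f : Fin r ↪ κ, ∑ j, MvPolynomial.X (s, f j) ^ a *
        ∏ j, MvPolynomial.X (s, f j) ^ lam j := by
    simp only [monSum]
    rw [Finset.sum_comm]
    refine Finset.sum_congr rfl fun f _ => Finset.sum_congr rfl fun j _ => ?_
    rw [← Finset.mul_prod_erase _ _ (Finset.mem_univ j),
      ← Finset.mul_prod_erase Finset.univ (fun j => MvPolynomial.X (s, f j) ^ lam j)
        (Finset.mem_univ j), ← mul_assoc, Function.update_self, ← pow_add, add_comm a]
    congr 1
    refine Finset.prod_congr rfl fun i hi => ?_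
    rw [Function.update_of_ne (Finset.ne_of_mem_erase hi)]
  rw [h1, h2, ← Finset.sum_add_distrib, blockPsum, monSum, Finset.mul_sum]
  refine Finset.sum_congr (by congr) fun f _ => ?_
  rw [← Finset.sum_mul, ← Finset.sum_mul, ← add_mul]
  congr 1
  rw [← Fintype.sum_subtype_add_sum_subtype (fun i => i ∈ Set.range f), add_comm]
  congr 1
  have h3 : (∑ i : Set.range f, MvPolynomial.X (s, i.1) ^ a : MvPolynomial (I × κ) K) =
      ∑ j, MvPolynomial.X (s, f j) ^ a :=
    (Fintype.sum_equiv (Equiv.ofInjective f f.injective) _ _ fun _ => rfl).symm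
  rw [← h3]
  exact Finset.sum_congr (by ext; simp) fun _ _ => rfl

/-- The product formula expresses a monomial sum with `r + 1` variables through sums with `r`
variables and the same total exponent, so no power sum of exponent above `d` is used. -/
theorem monSum_mem (s : I) {r : ℕ} (lam : Fin r → ℕ) {d : ℕ} (h : ∑ j, lam j ≤ d) :
    (monSum K s lam : MvPolynomial (I × κ) K) ∈ psumAlgebra K I κ d := by
  induction r with
  | zero => simp [monSum]
  | succ r ih =>
    rw [← Fin.cons_self_tail lam] at h ⊢
    rw [Fin.sum_cons] at h
    rw [← add_sub_cancel_right (monSum K s (Fin.cons (lam 0) (Fin.tail lam) : Fin (r + 1) → ℕ))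
      (∑ j, monSum K s (Function.update (Fin.tail lam) j (Fin.tail lam j + lam 0))),
      ← blockPsum_mul_monSum]
    refine sub_mem (mul_mem (blockPsum_mem s (by omega)) (ih _ (by omega)))
      (sum_mem fun j _ => ih _ ?_)
    rw [Finset.sum_update_of_mem (Finset.mem_univ j)]
    have := Finset.add_sum_erase Finset.univ (Fin.tail lam) (Finset.mem_univ j)
    rw [Finset.sdiff_singleton_eq_erase]
    omega

/-- The sum of a monomial over all permutations of the variables in a block. -/
theorem sum_perm_mem [DecidableEq κ] (s : I) (m : κ → ℕ) {d : ℕ} (h : ∑ j, m j ≤ d) :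
    (∑ σ : Equiv.Perm κ, ∏ i, MvPolynomial.X (s, σ i) ^ m i : MvPolynomial (I × κ) K) ∈
      psumAlgebra K I κ d := by
  let ε := (Fintype.equivFin κ).symm
  have h1 : (∑ σ : Equiv.Perm κ, ∏ i, MvPolynomial.X (s, σ i) ^ m i : MvPolynomial (I × κ) K) =
      monSum K s (m ∘ ε) := by
    unfold monSum
    let F : Equiv.Perm κ ≃ (Fin (Fintype.card κ) ↪ κ) :=
      (Equiv.embeddingEquivOfFinite κ).symm.trans (Equiv.embeddingCongr ε.symm (Equiv.refl κ))
    rw [← F.sum_comp]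
    refine Finset.sum_congr (by congr) fun σ _ => ?_
    rw [← ε.prod_comp]
    refine Finset.prod_congr rfl fun i _ => ?_
    rfl
  rw [h1]
  refine monSum_mem s _ ?_
  simpa only [Function.comp_apply, ε.sum_comp m] using h

/-- The action of a family of permutations on the variables. -/
def blockPerm (π : I → Equiv.Perm κ) (b : I × κ) : I × κ := (b.1, π b.1 b.2)

variable [DecidableEq I] [DecidableEq κ] [Fintype I]

theorem rename_blockPerm {P : MvPolynomial (I × κ) K}
    (hP : ∀ s k l, MvPolynomial.rename (Equiv.swap (s, k) (s, l)) P = P)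
    (π : I → Equiv.Perm κ) : MvPolynomial.rename (blockPerm π) P = P := by
  let J : Subgroup (I → Equiv.Perm κ) :=
    { carrier := {π | MvPolynomial.rename (blockPerm π) P = P}
      one_mem' := by
        change MvPolynomial.rename (blockPerm 1) P = P
        exact MvPolynomial.rename_id_apply P
      mul_mem' := fun {π ρ} h1 h2 => by
        change MvPolynomial.rename (blockPerm (π * ρ)) P = P
        have : blockPerm (π * ρ) = blockPerm π ∘ blockPerm ρ := rfl
        rw [this, ← MvPolynomial.rename_rename, h2, h1]
      inv_mem' := fun {π} h => by
        change MvPolynomial.rename (blockPerm π⁻¹) P = P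
        have h' : MvPolynomial.rename (blockPerm π) P = P := h
        conv_lhs => rw [← h', MvPolynomial.rename_rename]
        have : blockPerm π⁻¹ ∘ blockPerm π = id := by
          funext b
          simp [blockPerm]
        rw [this, MvPolynomial.rename_id_apply] }
  have hJ : (Subgroup.pi Set.univ fun _ : I => (⊤ : Subgroup (Equiv.Perm κ))) ≤ J := by
    rw [Subgroup.pi_le_iff]
    rintro s _ ⟨σ, -, rfl⟩
    induction σ using Equiv.Perm.swap_induction_on with
    | one => rw [map_one]; exact one_mem J
    | swap_mul f x y hxy ih =>
      rw [map_mul]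
      refine mul_mem ?_ ih
      change MvPolynomial.rename (blockPerm _) P = P
      have : blockPerm (MonoidHom.mulSingle (fun _ : I => Equiv.Perm κ) s (Equiv.swap x y)) =
          Equiv.swap (s, x) (s, y) := by
        funext ⟨t, i⟩
        by_cases hts : t = s
        · subst hts
          simp only [blockPerm, MonoidHom.mulSingle_apply, Pi.mulSingle_eq_same,
            Equiv.swap_apply_def, Prod.mk.injEq, true_and]
          split_ifs <;> rfl
        · rw [Equiv.swap_apply_of_ne_of_ne] <;> simp [blockPerm, hts]
      rw [this]
      exact hP s x y
  exact hJ (by simp [Subgroup.mem_pi])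

/-- A polynomial which is symmetric in each block is a polynomial in the power sums. -/
theorem mem_psumAlgebra_of_symmetric [CharZero K] {P : MvPolynomial (I × κ) K}
    (hP : ∀ s k l, MvPolynomial.rename (Equiv.swap (s, k) (s, l)) P = P) {d : ℕ}
    (hd : P.totalDegree ≤ d) : P ∈ psumAlgebra K I κ d := by
  -- Symmetrizing multiplies `P` by the group order, which is invertible in characteristic zero.
  have h1 : (Fintype.card (I → Equiv.Perm κ)) • P ∈ psumAlgebra K I κ d := by
    have h2 : (Fintype.card (I → Equiv.Perm κ)) • P =
        ∑ π : I → Equiv.Perm κ, MvPolynomial.rename (blockPerm π) P := by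
      simp [rename_blockPerm hP]
    rw [h2]
    have h3 : ∀ π : I → Equiv.Perm κ, MvPolynomial.rename (blockPerm π) P =
        ∑ m ∈ P.support, P.coeff m • ∏ s, ∏ i, MvPolynomial.X (s, π s i) ^ m (s, i) := by
      intro π
      conv_lhs => rw [P.as_sum, map_sum]
      refine Finset.sum_congr rfl fun m _ => ?_
      rw [MvPolynomial.monomial_eq, map_mul, MvPolynomial.rename_C, MvPolynomial.smul_eq_C_mul,
        Finsupp.prod_fintype _ _ (by simp), map_prod, Fintype.prod_prod_type]
      simp [blockPerm]
    simp only [h3]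
    rw [Finset.sum_comm]
    refine sum_mem fun m hm => ?_
    rw [← Finset.smul_sum]
    refine Subalgebra.smul_mem _ ?_ _
    -- For a fixed exponent the sum over families of permutations factors into one sum for each
    -- block.
    have h4 := Finset.prod_univ_sum (fun _ : I => (Finset.univ : Finset (Equiv.Perm κ)))
      (fun s σ => (∏ i, MvPolynomial.X (s, σ i) ^ m (s, i) : MvPolynomial (I × κ) K))
    rw [Fintype.piFinset_univ] at h4
    rw [← h4]
    refine prod_mem fun s _ => sum_perm_mem s _ ?_
    refine le_trans ?_ ((MvPolynomial.le_totalDegree hm).trans hd)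
    rw [Finsupp.sum_fintype _ _ (by simp), Fintype.sum_prod_type]
    exact Finset.single_le_sum (f := fun s => ∑ i, m (s, i)) (by simp) (Finset.mem_univ s)
  have h5 : (Fintype.card (I → Equiv.Perm κ) : K) ≠ 0 := Nat.cast_ne_zero.2 Fintype.card_ne_zero
  have h6 := Subalgebra.smul_mem _ h1 ((Fintype.card (I → Equiv.Perm κ) : K)⁻¹)
  rwa [← Nat.cast_smul_eq_nsmul K, smul_smul, inv_mul_cancel₀ h5, one_smul] at h6

omit [Fintype I] in
theorem rename_swap_blockPsum (t s : I) (k l : κ) (m : ℕ) :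
    MvPolynomial.rename (Equiv.swap (s, k) (s, l)) (blockPsum K t m) = blockPsum K t m := by
  simp only [blockPsum, map_sum, map_pow, MvPolynomial.rename_X]
  by_cases hts : t = s
  · subst hts
    refine Fintype.sum_equiv (Equiv.swap k l) _ _ fun i => ?_
    congr 2
    simp only [Equiv.swap_apply_def, Prod.mk.injEq, true_and]
    split_ifs <;> rfl
  · refine Finset.sum_congr rfl fun i _ => ?_
    rw [Equiv.swap_apply_of_ne_of_ne] <;> simp [hts]

end Symmetric

/-! ### The image of the centre -/

section Shift

variable {K B : Type*} [Field K] (c : B → K)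

theorem totalDegree_shift_le (P : MvPolynomial B K) :
    (MvPolynomial.aeval (fun b => MvPolynomial.X b - MvPolynomial.C (c b)) P :
      MvPolynomial B K).totalDegree ≤ P.totalDegree := by
  conv_lhs => rw [P.as_sum, map_sum]
  refine MvPolynomial.totalDegree_finsetSum_le fun m hm => ?_
  rw [MvPolynomial.aeval_monomial]
  refine (MvPolynomial.totalDegree_mul _ _).trans ?_
  rw [MvPolynomial.algebraMap_eq, MvPolynomial.totalDegree_C, zero_add, Finsupp.prod]
  refine (MvPolynomial.totalDegree_finsetProd _ _).trans ?_
  refine le_trans (Finset.sum_le_sum fun b _ => ?_) (MvPolynomial.le_totalDegree hm)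
  refine (MvPolynomial.totalDegree_pow _ _).trans ?_
  refine le_trans (Nat.mul_le_mul_left _ (?_ : _ ≤ 1)) (mul_one _).le
  exact (MvPolynomial.totalDegree_sub_C_le _ _).trans (MvPolynomial.totalDegree_X _).le

theorem totalDegree_shift_pow_sub_le (b : B) (a : K) (k : ℕ) :
    ((MvPolynomial.X b - MvPolynomial.C a) ^ (k + 1) - MvPolynomial.X b ^ (k + 1) :
      MvPolynomial B K).totalDegree ≤ k := by
  induction k with
  | zero => simp
  | succ k ih =>
    rw [show ((MvPolynomial.X b - MvPolynomial.C a) ^ (k + 1 + 1) - MvPolynomial.X b ^ (k + 1 + 1) :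
      MvPolynomial B K) = ((MvPolynomial.X b - MvPolynomial.C a) ^ (k + 1) -
        MvPolynomial.X b ^ (k + 1)) * (MvPolynomial.X b - MvPolynomial.C a) -
        MvPolynomial.X b ^ (k + 1) * MvPolynomial.C a by ring]
    refine (MvPolynomial.totalDegree_sub _ _).trans (max_le ?_ ?_)
    · refine (MvPolynomial.totalDegree_mul _ _).trans (add_le_add ih ?_)
      exact (MvPolynomial.totalDegree_sub_C_le _ _).trans (MvPolynomial.totalDegree_X _).le
    · refine (MvPolynomial.totalDegree_mul _ _).trans ?_
      rw [MvPolynomial.totalDegree_C, add_zero, MvPolynomial.totalDegree_X_pow]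

theorem shift_eq_zero {P : MvPolynomial B K}
    (h : (MvPolynomial.aeval (fun b => MvPolynomial.X b - MvPolynomial.C (c b)) P :
      MvPolynomial B K) = 0) : P = 0 := by
  have h1 := congrArg (MvPolynomial.aeval
    (fun b => (MvPolynomial.X b + MvPolynomial.C (c b) : MvPolynomial B K))) h
  rw [← AlgHom.comp_apply, map_zero] at h1
  have h2 : (MvPolynomial.aeval (fun b => (MvPolynomial.X b + MvPolynomial.C (c b) :
      MvPolynomial B K))).comp (MvPolynomial.aeval
        (fun b => (MvPolynomial.X b - MvPolynomial.C (c b) : MvPolynomial B K))) =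
      AlgHom.id K _ := by
    ext b
    simp
  rwa [h2] at h1

theorem eval_shift (mu : B → K) (P : MvPolynomial B K) :
    MvPolynomial.eval mu (MvPolynomial.aeval
      (fun b => (MvPolynomial.X b - MvPolynomial.C (c b) : MvPolynomial B K)) P) =
      MvPolynomial.eval (fun b => mu b - c b) P := by
  induction P using MvPolynomial.induction_on with
  | C a => simp
  | add p q hp hq => simp only [map_add, hp, hq]
  | mul_X p b h => simp only [map_mul, h]; simp

end Shift

namespace MatrixUnits

section Image

variable {K 𝔤 I κ : Type*} [Field K] [CharZero K] [LieRing 𝔤] [LieAlgebra K 𝔤] [DecidableEq I]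
  [DecidableEq κ] [Fintype I] [Fintype κ] (M : MatrixUnits K 𝔤 I κ)
  {p : κ → ℕ} (hp : Function.Injective p)
  {T : MvPolynomial (I × κ) K →ₐ[K] UniversalEnvelopingAlgebra K 𝔤}
  (hT : ∀ s i, T (MvPolynomial.X (s, i)) = M.e (s, i, i)) {d : ℕ → K}
  {γ : Subalgebra.center K (UniversalEnvelopingAlgebra K 𝔤) →ₐ[K] MvPolynomial (I × κ) K}
  (hγ : ∀ z : Subalgebra.center K (UniversalEnvelopingAlgebra K 𝔤), ∃ P,
    (z : UniversalEnvelopingAlgebra K 𝔤) - T P ∈ (M.lower p).nil ∧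
    γ z = MvPolynomial.aeval (fun b => MvPolynomial.X b - MvPolynomial.C (d (p b.2))) P)

include hγ in
theorem normalized_injective : Function.Injective γ := by
  rw [injective_iff_map_eq_zero]
  intro z hz
  obtain ⟨P, hP, hPz⟩ := hγ z
  rw [hz] at hPz
  obtain rfl := shift_eq_zero _ hPz.symm
  rw [map_zero, sub_zero] at hP
  exact Subtype.ext (M.eq_zero_of_mem_center_of_mem_nil z.2 hP)

variable (hd : ∀ m, d (m + 1) = d m + 1) (hseg : ∀ i, ∀ m < p i, ∃ j, p j = m)

include hp hT hγ hd hseg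

theorem rename_swap_normalized (z : Subalgebra.center K (UniversalEnvelopingAlgebra K 𝔤))
    (s : I) (k l : κ) : MvPolynomial.rename (Equiv.swap (s, k) (s, l)) (γ z) = γ z := by
  obtain ⟨P, hP, hPz⟩ := hγ z
  rw [hPz]
  refine MvPolynomial.funext fun mu => ?_
  rw [MvPolynomial.eval_rename, eval_shift, eval_shift]
  exact M.eval_swap hp hT z.2 hP d hd hseg s k l mu

/-- The image of the normalized Harish-Chandra homomorphism. -/
theorem normalized_range :
    γ.range = Algebra.adjoin K (Set.range fun b : I × ℕ => blockPsum K b.1 b.2) := by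
  have hle : ∀ D, psumAlgebra K I κ D ≤
      Algebra.adjoin K (Set.range fun b : I × ℕ => blockPsum K b.1 b.2) := fun D =>
    Algebra.adjoin_mono (by rintro _ ⟨s, k, -, rfl⟩; exact ⟨(s, k), rfl⟩)
  refine le_antisymm ?_ (Algebra.adjoin_le ?_)
  · rintro _ ⟨z, rfl⟩
    exact hle _ (mem_psumAlgebra_of_symmetric
      (M.rename_swap_normalized hp hT hγ hd hseg z) le_rfl)
  rintro _ ⟨⟨s, k⟩, rfl⟩
  change blockPsum K s k ∈ γ.range
  induction k using Nat.strong_induction_on generalizing s with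
  | _ k ih =>
    cases k with
    | zero =>
      have : (blockPsum K s 0 : MvPolynomial (I × κ) K) =
          algebraMap K _ (Fintype.card κ : K) := by simp [blockPsum]
      rw [this]
      exact Subalgebra.algebraMap_mem _ _
    | succ k =>
      obtain ⟨z, hz, P, hP, hdeg⟩ := M.exists_central_leading_psum hp hT s k
      obtain ⟨Q, hQ, hQz⟩ := hγ ⟨z, hz⟩
      have hQP : Q = P := by
        rw [← sub_eq_zero]
        refine M.eq_zero_of_torus_mem_nil hp hT ?_
        rw [map_sub, ← sub_sub_sub_cancel_left _ _ z]
        exact sub_mem hP hQ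
      subst hQP
      -- The shift does not affect leading terms, so the difference is symmetric of degree at most
      -- `k`. It needs only power sums of exponent at most `k`, which lie in the image by induction;
      -- this is the reason for tracking degrees in `psumAlgebra`.
      have h1 : γ ⟨z, hz⟩ - blockPsum K s (k + 1) ∈ psumAlgebra K I κ k := by
        refine mem_psumAlgebra_of_symmetric (fun t i j => ?_) ?_
        · rw [map_sub, M.rename_swap_normalized hp hT hγ hd hseg, rename_swap_blockPsum]
        · rw [hQz, show Q = (Q - ∑ i, MvPolynomial.X (s, i) ^ (k + 1)) +
            ∑ i, MvPolynomial.X (s, i) ^ (k + 1) by ring, map_add, add_sub_assoc]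
          refine (MvPolynomial.totalDegree_add _ _).trans (max_le ?_ ?_)
          · exact (totalDegree_shift_le _ _).trans hdeg
          · rw [map_sum, blockPsum, ← Finset.sum_sub_distrib]
            refine MvPolynomial.totalDegree_finsetSum_le fun i _ => ?_
            rw [map_pow, MvPolynomial.aeval_X]
            exact totalDegree_shift_pow_sub_le _ _ _
      have h2 : psumAlgebra K I κ k ≤ γ.range := Algebra.adjoin_le (by
        rintro _ ⟨t, m, hm, rfl⟩
        exact ih m (by omega) t)
      rw [← sub_sub_cancel (γ ⟨z, hz⟩) (blockPsum K s (k + 1))]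
      exact sub_mem ⟨_, rfl⟩ (h2 h1)

end Image

end MatrixUnits

/-! ### Embeddings and places -/

section Places

variable {p : ℕ} [Fact p.Prime] {F L : Type*} [Field F] [NumberField F]
  [Field L] [CharZero L] [Algebra ℚ_[p] L] [FiniteDimensional ℚ_[p] L]

-- Since `ℤ_[p]` is integrally closed, the minimal polynomial over `ℚ_[p]` has coefficients in
-- `ℤ_[p]`.
omit [CharZero L] [FiniteDimensional ℚ_[p] L] in
theorem spectralNorm_le_one_of_isIntegral {x : L} (hx : IsIntegral ℤ x) :
    spectralNorm ℚ_[p] L x ≤ 1 := by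
  let _ : Algebra ℤ_[p] L := ((algebraMap ℚ_[p] L).comp (algebraMap ℤ_[p] ℚ_[p])).toAlgebra
  have : IsScalarTower ℤ_[p] ℚ_[p] L := IsScalarTower.of_algebraMap_eq fun _ => rfl
  have hx' : IsIntegral ℤ_[p] x := hx.tower_top
  rw [spectralNorm, spectralValue_le_one_iff (minpoly.monic hx'.tower_top)]
  intro n
  rw [minpoly.isIntegrallyClosed_eq_field_fractions' ℚ_[p] hx', Polynomial.coeff_map]
  exact PadicInt.norm_le_one _

/-- The place of `F` induced by an embedding `F → L`. -/
def placeOf (p : ℕ) [Fact p.Prime] {F L : Type*} [Field F] [NumberField F] [Field L] [CharZero L]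
    [Algebra ℚ_[p] L] [FiniteDimensional ℚ_[p] L] (σ : F →+* L) : Ideal (𝓞 F) where
  carrier := {x | spectralNorm ℚ_[p] L (σ x) < 1}
  zero_mem' := by simp [spectralNorm_zero]
  add_mem' {x y} hx hy := by
    change spectralNorm ℚ_[p] L (σ ((x : F) + y)) < 1
    rw [map_add]
    exact (isNonarchimedean_spectralNorm _ _).trans_lt (max_lt hx hy)
  smul_mem' r x hx := by
    have h := spectralAlgNorm_mul (K := ℚ_[p]) (σ r) (σ x)
    simp only [spectralAlgNorm_def] at h
    change spectralNorm ℚ_[p] L (σ ((r : F) * x)) < 1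
    rw [map_mul, h]
    exact (mul_le_of_le_one_left (spectralNorm_nonneg _) (spectralNorm_le_one_of_isIntegral
      ((NumberField.RingOfIntegers.isIntegral_coe r).map σ.toIntAlgHom))).trans_lt hx

theorem mem_placeOf {σ : F →+* L} {x : 𝓞 F} :
    x ∈ placeOf p σ ↔ spectralNorm ℚ_[p] L (σ x) < 1 :=
  Iff.rfl

theorem placeOf_mem_placesAbove (σ : F →+* L) : placeOf p σ ∈ placesAbove p F := by
  refine ⟨⟨?_, fun {x y} h => ?_⟩, ?_⟩
  · rw [Ne, Ideal.eq_top_iff_one, mem_placeOf]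
    change ¬ spectralNorm ℚ_[p] L (σ 1) < 1
    rw [map_one, spectralNorm_one]
    exact lt_irrefl _
  · have h' := spectralAlgNorm_mul (K := ℚ_[p]) (σ x) (σ y)
    simp only [spectralAlgNorm_def] at h'
    replace h : spectralNorm ℚ_[p] L (σ ((x : F) * y)) < 1 := h
    rw [map_mul, h'] at h
    by_contra! hc
    simp only [mem_placeOf, not_lt] at hc
    exact absurd h (not_lt.2 (one_le_mul_of_one_le_of_one_le hc.1 hc.2))
  · rw [mem_placeOf]
    have : σ ((p : 𝓞 F) : F) = algebraMap ℚ_[p] L (p : ℚ_[p]) := by simp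
    rw [this, spectralNorm_extends]
    exact Padic.norm_p_lt_one

theorem mem_embeddingsOver {S : Set (Ideal (𝓞 F))} {σ : F →+* L} :
    σ ∈ embeddingsOver p L S ↔ placeOf p σ ∈ S := by
  classical
  rw [embeddingsOver, Finset.mem_filter_univ]
  constructor
  · rintro ⟨P, hP, h⟩
    rwa [show placeOf p σ = P from Ideal.ext fun x => (h x).symm]
  · exact fun h => ⟨_, h, fun x => Iff.rfl⟩

variable [NumberField.IsCMField F]

theorem conj_conj (x : F) : conj F (conj F x) = x :=
  NumberField.IsCMField.complexConj_apply_apply F x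

theorem conj_comp_conj : (conj F).comp (conj F) = RingHom.id F :=
  RingHom.ext conj_conj

theorem mem_conjPlace {P : Ideal (𝓞 F)} {x : 𝓞 F} :
    x ∈ conjPlace P ↔ NumberField.IsCMField.ringOfIntegersComplexConj F x ∈ P := by
  have hc : ∀ y : 𝓞 F, NumberField.IsCMField.ringOfIntegersComplexConj F
      (NumberField.IsCMField.ringOfIntegersComplexConj F y) = y := fun y =>
    NumberField.RingOfIntegers.ext (NumberField.IsCMField.complexConj_apply_apply F _)
  rw [conjPlace, Ideal.mem_map_iff_of_surjective
    (NumberField.IsCMField.ringOfIntegersComplexConj F : 𝓞 F →+* 𝓞 F)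
    (NumberField.IsCMField.ringOfIntegersComplexConj F).surjective]
  constructor
  · rintro ⟨y, hy, rfl⟩
    exact (hc y).symm ▸ hy
  · exact fun h => ⟨_, h, hc x⟩

theorem conjPlace_conjPlace (P : Ideal (𝓞 F)) : conjPlace (conjPlace P) = P := by
  ext x
  rw [mem_conjPlace, mem_conjPlace]
  exact iff_of_eq (congrArg (· ∈ P) (NumberField.RingOfIntegers.ext
    (NumberField.IsCMField.complexConj_apply_apply F _)))

theorem placeOf_comp_conj (σ : F →+* L) :
    placeOf p (σ.comp (conj F)) = conjPlace (placeOf p σ) := by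
  ext x
  rw [mem_conjPlace]
  rfl

/-- Exactly one of `σ` and `σ ∘ c` induces a place in `S`. -/
theorem comp_conj_mem_embeddingsOver_iff {S : Set (Ideal (𝓞 F))}
    (hS : S ∪ conjPlace '' S = placesAbove p F) (hSc : Disjoint S (conjPlace '' S))
    (σ : F →+* L) :
    σ.comp (conj F) ∈ embeddingsOver p L S ↔ σ ∉ embeddingsOver p L S := by
  rw [mem_embeddingsOver, mem_embeddingsOver, placeOf_comp_conj]
  constructor
  · exact fun h h' => Set.disjoint_left.1 hSc h ⟨_, h', rfl⟩
  · intro h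
    have h1 := placeOf_mem_placesAbove (p := p) σ
    rw [← hS] at h1
    rcases h1 with h1 | ⟨Q, hQ, h1⟩
    · exact absurd h1 h
    · rwa [← h1, conjPlace_conjPlace]

end Places

/-! ### Idempotents of `L ⊗ F` -/

section Idempotents

variable {F L : Type*} [Field F] [NumberField F] [Field L] [CharZero L]

/-- The map `L ⊗ F → L` induced by an embedding of `F`. -/
def embEval (σ : F →+* L) : L ⊗[ℚ] F →ₗ[L] L :=
  LinearMap.liftBaseChange L (σ.toRatAlgHom : F →ₗ[ℚ] L)

theorem embEval_tmul (σ : F →+* L) (l : L) (f : F) : embEval σ (l ⊗ₜ f) = l * σ f := rfl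

variable (hL : Nat.card (F →+* L) = Module.finrank ℚ F)

include hL

/-- A linear functional vanishing on the image would be a linear relation between distinct
embeddings, which Dedekind's theorem excludes; `hL` makes the dimensions equal. -/
theorem embEval_bijective :
    Function.Bijective (LinearMap.pi (fun σ : F →+* L => embEval σ)) := by
  have hdim : Module.finrank L (L ⊗[ℚ] F) = Module.finrank L ((F →+* L) → L) := by
    rw [Module.finrank_baseChange, Module.finrank_fintype_fun_eq_card, ← hL,
      Nat.card_eq_fintype_card]
  have hsurj : Function.Surjective (LinearMap.pi (fun σ : F →+* L => embEval σ)) := by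
    rw [← LinearMap.range_eq_top]
    by_contra hne
    obtain ⟨φ, hφ, hle⟩ := Submodule.exists_le_ker_of_lt_top _ (lt_top_iff_ne_top.2 hne)
    classical
    have hli := (linearIndependent_monoidHom F L).comp (fun σ : F →+* L => (σ : F →* L))
      (fun a b h => RingHom.ext fun x => DFunLike.congr_fun h x)
    have h0 := Fintype.linearIndependent_iff.1 hli (fun σ => φ (Pi.single σ 1)) (by
      funext f
      have h1 : φ (LinearMap.pi (fun σ : F →+* L => embEval σ) (1 ⊗ₜ f)) = 0 :=
        hle ⟨_, rfl⟩
      rw [pi_eq_sum_univ' (LinearMap.pi (fun σ : F →+* L => embEval σ) (1 ⊗ₜ f)), map_sum] at h1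
      rw [Finset.sum_apply, Pi.zero_apply, ← h1]
      refine Finset.sum_congr rfl fun σ _ => ?_
      rw [map_smul, LinearMap.pi_apply, embEval_tmul, one_mul, smul_eq_mul, mul_comm, Pi.smul_apply,
        smul_eq_mul]
      rfl)
    exact hφ (LinearMap.pi_ext' fun σ => LinearMap.ext_ring (by simpa using h0 σ))
  exact ⟨(LinearMap.injective_iff_surjective_of_finrank_eq_finrank hdim).2 hsurj, hsurj⟩

open Classical in
theorem exists_idempotents : ∃ a : (F →+* L) → L ⊗[ℚ] F,
    (∀ σ τ, embEval σ (a τ) = if σ = τ then 1 else 0) ∧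
      ∀ f : F, (1 : L) ⊗ₜ[ℚ] f = ∑ σ, σ f • a σ := by
  have hb := embEval_bijective hL
  choose a ha using fun τ : F →+* L => hb.2 (Pi.single τ 1)
  have ha' : ∀ σ τ, embEval σ (a τ) = if σ = τ then 1 else 0 := fun σ τ => by
    rw [← Pi.single_apply, ← ha τ]
    rfl
  refine ⟨a, ha', fun f => hb.1 (funext fun σ => ?_)⟩
  rw [LinearMap.pi_apply, LinearMap.pi_apply, embEval_tmul, map_sum]
  simp [ha']

end Idempotents

/-! ### Matrix coordinates on the base change of a Lie algebra -/

/-- The `L`-linear extension of a homomorphism to a matrix Lie algebra. -/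
def extendMat {L 𝔤 κ : Type*} [Field L] [CharZero L] [LieRing 𝔤] [LieAlgebra ℚ 𝔤] [Fintype κ]
    [DecidableEq κ] (f : 𝔤 →ₗ⁅ℚ⁆ Matrix κ κ L) : L ⊗[ℚ] 𝔤 →ₗ[L] Matrix κ κ L :=
  LinearMap.liftBaseChange L (f : 𝔤 →ₗ[ℚ] Matrix κ κ L)

theorem extendMat_tmul {L 𝔤 κ : Type*} [Field L] [CharZero L] [LieRing 𝔤] [LieAlgebra ℚ 𝔤]
    [Fintype κ] [DecidableEq κ] (f : 𝔤 →ₗ⁅ℚ⁆ Matrix κ κ L) (l : L) (X : 𝔤) :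
    extendMat f (l ⊗ₜ X) = l • f X := rfl

/-- Coordinates which identify `L ⊗ 𝔤` with a product of matrix algebras. -/
structure Coordinates (L 𝔤 I κ : Type*) [Field L] [CharZero L] [LieRing 𝔤] [LieAlgebra ℚ 𝔤]
    [Fintype I] [Fintype κ] [DecidableEq I] [DecidableEq κ] where
  /-- The projections to the factors. -/
  coord : I → 𝔤 →ₗ⁅ℚ⁆ Matrix κ κ L
  /-- The matrix units. -/
  unit : I × κ × κ → L ⊗[ℚ] 𝔤
  coord_unit : ∀ s t i j, extendMat (coord s) (unit (t, i, j)) =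
    if s = t then Matrix.single i j 1 else 0
  one_tmul : ∀ X : 𝔤, (1 : L) ⊗ₜ[ℚ] X = ∑ b, coord b.1 X b.2.1 b.2.2 • unit b

namespace Coordinates

variable {L 𝔤 I κ : Type*} [Field L] [CharZero L] [LieRing 𝔤] [LieAlgebra ℚ 𝔤]
  [Fintype I] [Fintype κ] [DecidableEq I] [DecidableEq κ] (C : Coordinates L 𝔤 I κ)

/-- The projections of `L ⊗ 𝔤` to the matrix algebras. -/
def proj (s : I) : L ⊗[ℚ] 𝔤 →ₗ[L] Matrix κ κ L :=
  extendMat (C.coord s)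

theorem proj_tmul (s : I) (l : L) (X : 𝔤) : C.proj s (l ⊗ₜ X) = l • C.coord s X := rfl

theorem proj_unit (s t : I) (i j : κ) :
    C.proj s (C.unit (t, i, j)) = if s = t then Matrix.single i j 1 else 0 :=
  C.coord_unit s t i j

theorem proj_lie (s : I) (x y : L ⊗[ℚ] 𝔤) : C.proj s ⁅x, y⁆ = ⁅C.proj s x, C.proj s y⁆ := by
  induction x using TensorProduct.induction_on with
  | zero => simp
  | add a b ha hb => rw [add_lie, map_add, ha, hb, map_add, add_lie]
  | tmul a X =>
    induction y using TensorProduct.induction_on with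
    | zero => simp
    | add a b ha hb => rw [lie_add, map_add, ha, hb, map_add, lie_add]
    | tmul b Y =>
      rw [LieAlgebra.ExtendScalars.bracket_tmul, proj_tmul, proj_tmul, proj_tmul, LieHom.map_lie,
        smul_lie, lie_smul, smul_smul]

theorem eq_sum (x : L ⊗[ℚ] 𝔤) : x = ∑ b, C.proj b.1 x b.2.1 b.2.2 • C.unit b := by
  induction x using TensorProduct.induction_on with
  | zero => simp
  | add a b ha hb =>
    conv_lhs => rw [ha, hb, ← Finset.sum_add_distrib]
    simp only [map_add, Matrix.add_apply, add_smul]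
  | tmul a X =>
    have h : a ⊗ₜ[ℚ] X = a • ((1 : L) ⊗ₜ[ℚ] X) := by
      rw [TensorProduct.smul_tmul', smul_eq_mul, mul_one]
    simp only [proj_tmul, Matrix.smul_apply, smul_assoc, ← Finset.smul_sum]
    rw [h, C.one_tmul]

theorem ext_proj {x y : L ⊗[ℚ] 𝔤} (h : ∀ s, C.proj s x = C.proj s y) : x = y := by
  rw [C.eq_sum x, C.eq_sum y]
  simp only [h]

/-- The basis of `L ⊗ 𝔤` given by the matrix units. -/
def basis : Module.Basis (I × κ × κ) L (L ⊗[ℚ] 𝔤) :=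
  Module.Basis.ofEquivFun
    { toFun := fun x b => C.proj b.1 x b.2.1 b.2.2
      map_add' := fun x y => by funext b; simp
      map_smul' := fun a x => by funext b; simp
      invFun := fun v => ∑ b, v b • C.unit b
      left_inv := fun x => (C.eq_sum x).symm
      right_inv := fun v => by
        funext ⟨s, i, j⟩
        change C.proj s (∑ b, v b • C.unit b) i j = v (s, i, j)
        rw [map_sum, Matrix.sum_apply, Finset.sum_eq_single (s, i, j)]
        · simp [proj_unit]
        · rintro ⟨t, k, l⟩ - h
          rw [map_smul, proj_unit]
          by_cases hst : s = t
          · subst hst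
            have : ¬ (k = i ∧ l = j) := fun h' => h (by rw [h'.1, h'.2])
            simp [this]
          · simp [hst]
        · simp }

theorem basis_apply (b : I × κ × κ) : C.basis b = C.unit b := by
  rw [basis, Module.Basis.coe_ofEquivFun]
  change ∑ b', (Pi.single b 1 : I × κ × κ → L) b' • C.unit b' = C.unit b
  rw [Finset.sum_eq_single b] <;> simp +contextual

/-- The matrix units of `L ⊗ 𝔤`. -/
def matrixUnits : MatrixUnits L (L ⊗[ℚ] 𝔤) I κ where
  basis := C.basis
  lie_basis s i j t k l := by
    simp only [basis_apply]
    refine C.ext_proj fun r => ?_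
    rw [proj_lie, proj_unit, proj_unit]
    by_cases hst : s = t
    · subst hst
      rw [if_pos rfl, map_sub, apply_ite (C.proj r), apply_ite (C.proj r), map_zero, proj_unit,
        proj_unit]
      by_cases hrs : r = s
      · simp only [hrs, if_true, LieRing.of_associative_ring_bracket]
        congr 1
        · split_ifs with h
          · rw [h, Matrix.single_mul_single_same, one_mul]
          · exact Matrix.single_mul_single_of_ne _ _ _ _ h _
        · split_ifs with h
          · rw [h, Matrix.single_mul_single_same, one_mul]
          · exact Matrix.single_mul_single_of_ne _ _ _ _ h _
      · simp [hrs]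
    · rw [if_neg hst, map_zero]
      by_cases hrs : r = s
      · subst hrs
        simp [hst]
      · simp [hrs]

theorem matrixUnits_basis (b : I × κ × κ) : C.matrixUnits.basis b = C.unit b :=
  C.basis_apply b

theorem tmul_mem_span {P : I × κ × κ → Prop} {X : 𝔤}
    (h : ∀ s i j, ¬ P (s, i, j) → C.coord s X i j = 0) (l : L) :
    l ⊗ₜ[ℚ] X ∈ Submodule.span L (C.matrixUnits.basis '' {b | P b}) := by
  rw [C.eq_sum (l ⊗ₜ X)]
  refine sum_mem fun b _ => ?_
  by_cases hb : P b
  · exact Submodule.smul_mem _ _ (Submodule.subset_span ⟨b, hb, C.matrixUnits_basis b⟩)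
  · rw [proj_tmul, Matrix.smul_apply, h _ _ _ hb, smul_zero, zero_smul]
    exact zero_mem _

/-- The left ideal generated by a subspace spanned by the matrix units of positive weight. -/
theorem leftIdeal_eq (r : κ → ℤ) {𝔲 : Submodule ℚ 𝔤}
    (h1 : ∀ X ∈ 𝔲, ∀ s i j, r i ≤ r j → C.coord s X i j = 0)
    (h2 : ∀ s i j, r j < r i → C.unit (s, i, j) ∈ 𝔲.baseChange L) :
    leftIdeal L 𝔲 = (C.matrixUnits.weight r).nil := by
  refine le_antisymm (Ideal.span_le.2 ?_) (Ideal.span_le.2 ?_)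
  · rintro _ ⟨x, hx, rfl⟩
    refine (C.matrixUnits.weight r).span_le_nil ?_
    rw [SetLike.mem_coe, Submodule.baseChange_eq_span] at hx
    have hx' : x ∈ Submodule.span L (C.matrixUnits.basis ''
        {b | 0 < (C.matrixUnits.weight r).w b}) := by
      refine Submodule.span_le.2 ?_ hx
      rintro _ ⟨X, hX, rfl⟩
      exact C.tmul_mem_span (fun s i j h => h1 X hX s i j (sub_nonpos.1 (not_lt.1 h))) 1
    have := Submodule.mem_map_of_mem (f := (UniversalEnvelopingAlgebra.ι L :
      (L ⊗[ℚ] 𝔤) →ₗ⁅L⁆ U L 𝔤).toLinearMap) hx'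
    rwa [Submodule.map_span, ← Set.image_comp] at this
  · rintro _ ⟨⟨s, i, j⟩, hb, rfl⟩
    refine Ideal.subset_span ⟨_, h2 s i j (sub_pos.1 hb), ?_⟩
    rw [← C.matrixUnits_basis]
    rfl

theorem range_lieBaseChange (r : κ → ℤ) {𝔪 : Type*} [LieRing 𝔪] [LieAlgebra ℚ 𝔪]
    {j : 𝔪 →ₗ⁅ℚ⁆ 𝔤} (h1 : ∀ X s i k, r i ≠ r k → C.coord s (j X) i k = 0)
    (h2 : ∀ s i k, r i = r k →
      C.unit (s, i, k) ∈ LinearMap.range (LinearMap.baseChange L (j : 𝔪 →ₗ[ℚ] 𝔤))) :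
    LinearMap.range (lieBaseChange L j : L ⊗[ℚ] 𝔪 →ₗ[L] L ⊗[ℚ] 𝔤) =
      Submodule.span L ((C.matrixUnits.weight r).basis ''
        {b | (C.matrixUnits.weight r).w b = 0}) := by
  refine le_antisymm ?_ (Submodule.span_le.2 ?_)
  · rintro _ ⟨x, rfl⟩
    induction x using TensorProduct.induction_on with
    | zero => rw [map_zero]; exact zero_mem _
    | add a b ha hb => rw [map_add]; exact add_mem ha hb
    | tmul a X =>
      exact C.tmul_mem_span (P := fun b => (C.matrixUnits.weight r).w b = 0)
        (fun s i k h => h1 X s i k fun h' => h (sub_eq_zero.2 h')) a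
  · rintro _ ⟨⟨s, i, k⟩, hb, rfl⟩
    have h := h2 s i k (sub_eq_zero.1 hb)
    rw [← C.matrixUnits_basis] at h
    exact h

end Coordinates

theorem lieBaseChange_injective {L : Type*} [Field L] [CharZero L] {𝔪 𝔤 : Type*} [LieRing 𝔪]
    [LieAlgebra ℚ 𝔪] [LieRing 𝔤] [LieAlgebra ℚ 𝔤] {j : 𝔪 →ₗ⁅ℚ⁆ 𝔤} (hj : Function.Injective j) :
    Function.Injective (lieBaseChange L j) :=
  Module.Flat.lTensor_preserves_injective_linearMap (M := L) (j : 𝔪 →ₗ[ℚ] 𝔤) hj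

theorem baseChange_apply_mem {L V W : Type*} [Field L] [CharZero L] [AddCommGroup V] [Module ℚ V]
    [AddCommGroup W] [Module ℚ W] {f : V →ₗ[ℚ] W} {N : Submodule ℚ W} (h : ∀ v, f v ∈ N)
    (x : L ⊗[ℚ] V) : f.baseChange L x ∈ N.baseChange L := by
  induction x using TensorProduct.induction_on with
  | zero => rw [map_zero]; exact zero_mem _
  | add a b ha hb => rw [map_add]; exact add_mem ha hb
  | tmul a v => exact Submodule.tmul_mem_baseChange_of_mem a (h v)

/-! ### Coordinates on the general linear Lie algebra -/

/-- The homomorphism of matrix Lie algebras induced by an embedding. -/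
def matMap {F L : Type*} [Field F] [NumberField F] [Field L] [CharZero L] (κ : Type*) [Fintype κ]
    [DecidableEq κ] (σ : F →+* L) : Matrix κ κ F →ₗ⁅ℚ⁆ Matrix κ κ L :=
  (σ.toRatAlgHom.mapMatrix : Matrix κ κ F →ₐ[ℚ] Matrix κ κ L).toLieHom

section CM

variable {F L : Type*} [Field F] [NumberField F] [NumberField.IsCMField F] [Field L] [CharZero L]
  {Φ : Finset (F →+* L)}

/-- The embeddings `σ ∘ c` and `σ` for `σ ∈ Φ`. -/
def embOf (Φ : Finset (F →+* L)) (b : Φ × Bool) : F →+* L :=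
  if b.2 then b.1.1 else b.1.1.comp (conj F)

omit [CharZero L] in
theorem comp_conj_comp_conj (σ : F →+* L) : (σ.comp (conj F)).comp (conj F) = σ := by
  rw [RingHom.comp_assoc, conj_comp_conj, RingHom.comp_id]

-- This is the form in which the choice of one embedding from each conjugate pair is used: `Φ ×
-- Bool` indexes all embeddings.
omit [CharZero L] in
theorem embOf_bijective (hΦ : ∀ σ, σ.comp (conj F) ∈ Φ ↔ σ ∉ Φ) :
    Function.Bijective (embOf Φ) := by
  constructor
  · rintro ⟨⟨σ, hσ⟩, b⟩ ⟨⟨τ, hτ⟩, b'⟩ h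
    cases b <;> cases b' <;> simp only [embOf, if_true, Bool.false_eq_true, if_false] at h
    · have h' := congrArg (fun f => f.comp (conj F)) h
      simp only [comp_conj_comp_conj] at h'
      subst h'
      rfl
    · subst h
      exact absurd hσ ((hΦ σ).1 hτ)
    · subst h
      exact absurd hτ ((hΦ τ).1 hσ)
    · subst h
      rfl
  · intro σ
    by_cases hσ : σ ∈ Φ
    · exact ⟨(⟨σ, hσ⟩, true), rfl⟩
    · exact ⟨(⟨σ.comp (conj F), (hΦ σ).2 hσ⟩, false), comp_conj_comp_conj σ⟩

omit [NumberField.IsCMField F] in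
theorem extendMat_matMap {κ : Type*} [Fintype κ] [DecidableEq κ] (σ : F →+* L) (i j : κ)
    (x : L ⊗[ℚ] F) :
    extendMat (matMap κ σ)
      ((Matrix.singleLinearMap ℚ i j).baseChange L x) = Matrix.single i j (embEval σ x) := by
  induction x using TensorProduct.induction_on with
  | zero => simp
  | add a b ha hb => simp only [map_add, ha, hb, Matrix.single_add]
  | tmul l f =>
    ext k m
    rw [LinearMap.baseChange_tmul, extendMat_tmul, embEval_tmul, Matrix.smul_apply]
    change l * σ (Matrix.single i j f k m) = _
    simp only [Matrix.single_apply]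
    split_ifs <;> simp

open Classical in
/-- The coordinates on `L ⊗ 𝔤𝔩(F)` given by the embeddings of `F`. -/
def glCoordinates (κ : Type*) [Fintype κ] [DecidableEq κ]
    (hΦ : ∀ σ, σ.comp (conj F) ∈ Φ ↔ σ ∉ Φ) {a : (F →+* L) → L ⊗[ℚ] F}
    (ha : ∀ σ τ, embEval σ (a τ) = if σ = τ then 1 else 0)
    (ha' : ∀ f : F, (1 : L) ⊗ₜ[ℚ] f = ∑ σ, σ f • a σ) :
    Coordinates L (Matrix κ κ F) (Φ × Bool) κ where
  coord b := matMap κ (embOf Φ b)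
  unit b := (Matrix.singleLinearMap ℚ b.2.1 b.2.2).baseChange L (a (embOf Φ b.1))
  coord_unit s t i j := by
    rw [extendMat_matMap, ha]
    simp only [(embOf_bijective hΦ).1.eq_iff]
    split_ifs <;> simp
  one_tmul X := by
    have h1 : (1 : L) ⊗ₜ[ℚ] X = ∑ i, ∑ j, (Matrix.singleLinearMap ℚ i j).baseChange L
        ((1 : L) ⊗ₜ[ℚ] X i j) := by
      conv_lhs => rw [Matrix.matrix_eq_sum_single X]
      simp [TensorProduct.tmul_sum]
    rw [h1]
    simp only [ha', map_sum, map_smul]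
    rw [← Fintype.sum_prod_type' (fun i j => ∑ σ : F →+* L, σ (X i j) •
      (Matrix.singleLinearMap ℚ i j).baseChange L (a σ)), Finset.sum_comm,
      ← (Equiv.ofBijective _ (embOf_bijective hΦ)).sum_comp]
    conv_rhs => rw [Fintype.sum_prod_type]
    rfl

/-! ### Coordinates on the unitary Lie algebra -/

/-- The reversal of the index set of a block matrix. -/
def revIdx {n : ℕ} : Fin n ⊕ Fin n → Fin n ⊕ Fin n
  | Sum.inl i => Sum.inr i.rev
  | Sum.inr i => Sum.inl i.rev

theorem revIdx_revIdx {n : ℕ} (i : Fin n ⊕ Fin n) : revIdx (revIdx i) = i := by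
  cases i <;> simp [revIdx]

theorem pos_revIdx {n : ℕ} (i : Fin n ⊕ Fin n) : pos (revIdx i) + pos i + 1 = 2 * n := by
  cases i <;> simp [revIdx, pos, Fin.val_rev] <;> omega

theorem pos_injective {n : ℕ} : Function.Injective (pos : Fin n ⊕ Fin n → ℕ) := by
  rintro (i | i) (j | j) h <;> simp only [pos] at h
  · rw [Fin.ext h]
  · omega
  · omega
  · rw [Fin.ext (Nat.add_left_cancel h)]

/-- The sign of a row of `J_n`. -/
def rowSign {n : ℕ} : Fin n ⊕ Fin n → ℤ
  | Sum.inl _ => 1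
  | Sum.inr _ => -1

theorem rowSign_mul_self {n : ℕ} (i : Fin n ⊕ Fin n) : rowSign i * rowSign i = 1 := by
  cases i <;> rfl

theorem rowSign_revIdx {n : ℕ} (i : Fin n ⊕ Fin n) : rowSign (revIdx i) = -rowSign i := by
  cases i <;> rfl

omit [NumberField.IsCMField F] in
theorem formJ_apply {n : ℕ} (i j : Fin n ⊕ Fin n) :
    formJ n F i j = if j = revIdx i then (rowSign i : F) else 0 := by
  rcases i with i | i <;> rcases j with j | j <;>
    simp [formJ, antidiag, revIdx, rowSign, apply_ite]

/-- Every row of `J_n` has one non-zero entry, a sign in the reversed column, so the defining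
equation relates entries in pairs. Solving for `X i j` uses that signs square to one. -/
theorem mem_unitaryLie_iff {n : ℕ} {X : Matrix (Fin n ⊕ Fin n) (Fin n ⊕ Fin n) F} :
    X ∈ unitaryLie n F ↔
      ∀ i j, X i j = -((rowSign i * rowSign j : ℤ) * conj F (X (revIdx j) (revIdx i))) := by
  have key : ∀ i j, (X.transpose * formJ n F + formJ n F * conjM X) j (revIdx i) =
      rowSign i * X i j + rowSign j * conj F (X (revIdx j) (revIdx i)) := by
    intro i j
    rw [Matrix.add_apply, Matrix.mul_apply, Matrix.mul_apply]
    congr 1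
    · rw [Finset.sum_eq_single i]
      · simp [formJ_apply, mul_comm]
      · intro k _ hk
        rw [formJ_apply, if_neg, mul_zero]
        exact fun h => hk (by rw [← revIdx_revIdx i, h, revIdx_revIdx])
      · simp
    · rw [Finset.sum_eq_single (revIdx j)]
      · simp [formJ_apply, conjM]
      · intro k _ hk
        rw [formJ_apply, if_neg hk, zero_mul]
      · simp
  have hs : ∀ i : Fin n ⊕ Fin n, (rowSign i : F) * rowSign i = 1 := fun i => by
    rw [← Int.cast_mul, rowSign_mul_self, Int.cast_one]
  constructor
  · intro h i j
    have h' : rowSign i * X i j + rowSign j * conj F (X (revIdx j) (revIdx i)) = 0 := by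
      rw [← key, show X.transpose * formJ n F + formJ n F * conjM X = 0 from h, Matrix.zero_apply]
    push_cast
    linear_combination (rowSign i : F) * h' - X i j * hs i
  · intro h
    change X.transpose * formJ n F + formJ n F * conjM X = 0
    ext i j
    rw [← revIdx_revIdx j, key, h (revIdx j) i, revIdx_revIdx, Matrix.zero_apply]
    push_cast
    linear_combination (-(rowSign i : F) * conj F (X (revIdx i) j)) * hs (revIdx j)

/-- The matrix `Y + J_n ᵗ(Y^c) J_n`. -/
def symmMatrix {n : ℕ} (Y : Matrix (Fin n ⊕ Fin n) (Fin n ⊕ Fin n) F) :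
    Matrix (Fin n ⊕ Fin n) (Fin n ⊕ Fin n) F :=
  Matrix.of fun i j => Y i j - (rowSign i * rowSign j : ℤ) * conj F (Y (revIdx j) (revIdx i))

theorem symmMatrix_apply {n : ℕ} (Y : Matrix (Fin n ⊕ Fin n) (Fin n ⊕ Fin n) F)
    (i j : Fin n ⊕ Fin n) : symmMatrix Y i j =
      Y i j - (rowSign i * rowSign j : ℤ) * conj F (Y (revIdx j) (revIdx i)) := rfl

theorem symmMatrix_mem {n : ℕ} (Y : Matrix (Fin n ⊕ Fin n) (Fin n ⊕ Fin n) F) :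
    symmMatrix Y ∈ unitaryLie n F := by
  rw [mem_unitaryLie_iff]
  intro i j
  rw [symmMatrix_apply, symmMatrix_apply, revIdx_revIdx, revIdx_revIdx, rowSign_revIdx,
    rowSign_revIdx, map_sub, map_mul, map_intCast, conj_conj]
  have hs : ∀ i : Fin n ⊕ Fin n, (rowSign i : F) * rowSign i = 1 := fun i => by
    rw [← Int.cast_mul, rowSign_mul_self, Int.cast_one]
  push_cast
  linear_combination (-Y i j) * (hs i * (rowSign j : F) ^ 2 + hs j)

/-- The projection of matrices to the unitary Lie algebra. -/
def symmLinear (n : ℕ) (F : Type*) [Field F] [NumberField F] [NumberField.IsCMField F] :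
    Matrix (Fin n ⊕ Fin n) (Fin n ⊕ Fin n) F →ₗ[ℚ] unitaryLie n F :=
  AddMonoidHom.toRatLinearMap
    { toFun := fun Y => ⟨symmMatrix Y, symmMatrix_mem Y⟩
      map_zero' := Subtype.ext (by ext i j; simp [symmMatrix_apply])
      map_add' := fun Y Y' => Subtype.ext (by
        ext i j
        change symmMatrix (Y + Y') i j = symmMatrix Y i j + symmMatrix Y' i j
        simp only [symmMatrix_apply, Matrix.add_apply, map_add]
        ring) }

/-- The element of the unitary Lie algebra with entry `f` at `(i, j)`. -/
def unitarySingle {n : ℕ} (F : Type*) [Field F] [NumberField F] [NumberField.IsCMField F]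
    (i j : Fin n ⊕ Fin n) : F →ₗ[ℚ] unitaryLie n F :=
  symmLinear n F ∘ₗ Matrix.singleLinearMap ℚ i j

theorem unitarySingle_apply {n : ℕ} (i j k l : Fin n ⊕ Fin n) (f : F) :
    (unitarySingle F i j f).1 k l = (if i = k ∧ j = l then f else 0) -
      (rowSign k * rowSign l : ℤ) * conj F (if i = revIdx l ∧ j = revIdx k then f else 0) := by
  change symmMatrix (Matrix.single i j f) k l = _
  rw [symmMatrix_apply, Matrix.single_apply, Matrix.single_apply]

/-- The projection of the unitary Lie algebra to a matrix algebra over `L`. -/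
def unitaryCoord (n : ℕ) (σ : F →+* L) :
    unitaryLie n F →ₗ⁅ℚ⁆ Matrix (Fin n ⊕ Fin n) (Fin n ⊕ Fin n) L :=
  (matMap _ σ).comp (unitaryLie n F).incl

theorem extendMat_unitaryCoord {n : ℕ} (σ : F →+* L) (i j k l : Fin n ⊕ Fin n)
    (x : L ⊗[ℚ] F) :
    extendMat (unitaryCoord n σ)
      ((unitarySingle F i j).baseChange L x) k l =
      (if i = k ∧ j = l then embEval σ x else 0) -
        (rowSign k * rowSign l : ℤ) * (if i = revIdx l ∧ j = revIdx k then
          embEval (σ.comp (conj F)) x else 0) := by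
  induction x using TensorProduct.induction_on with
  | zero => simp
  | add a b ha hb =>
    rw [map_add, map_add, Matrix.add_apply, ha, hb, map_add, map_add]
    split_ifs <;> ring
  | tmul a f =>
    rw [LinearMap.baseChange_tmul, extendMat_tmul, Matrix.smul_apply]
    change a * σ ((unitarySingle F i j f).1 k l) = _
    rw [unitarySingle_apply, embEval_tmul, embEval_tmul, map_sub, map_mul, map_intCast,
      apply_ite σ, apply_ite (conj F), apply_ite σ, map_zero, map_zero, map_zero,
      RingHom.comp_apply]
    split_ifs <;> ring

theorem extendMat_incl {n : ℕ} (σ : F →+* L) (x : L ⊗[ℚ] unitaryLie n F) :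
    extendMat (matMap (Fin n ⊕ Fin n) σ)
      (lieBaseChange L (unitaryLie n F).incl x) =
      extendMat (unitaryCoord n σ) x := by
  induction x using TensorProduct.induction_on with
  | zero => simp
  | add a b ha hb => simp only [map_add, ha, hb]
  | tmul a X => rfl

/-- On the unitary Lie algebra the coordinates at `σ ∘ c` are determined by those at `σ`, which is
why half of the embeddings suffice. -/
theorem extendMat_comp_conj {n : ℕ} (σ : F →+* L) (x : L ⊗[ℚ] unitaryLie n F)
    (i j : Fin n ⊕ Fin n) :
    extendMat (unitaryCoord n (σ.comp (conj F))) x i j =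
      -((rowSign i * rowSign j : ℤ) * extendMat (unitaryCoord n σ) x (revIdx j) (revIdx i)) := by
  induction x using TensorProduct.induction_on with
  | zero => simp
  | add a b ha hb => simp only [map_add, Matrix.add_apply, ha, hb]; ring
  | tmul a X =>
    rw [extendMat_tmul, extendMat_tmul, Matrix.smul_apply,
      Matrix.smul_apply]
    change a * σ (conj F (X.1 i j)) = -(_ * (a * σ (X.1 _ _)))
    rw [mem_unitaryLie_iff.1 X.2 i j, map_neg, map_mul, map_intCast, conj_conj, map_neg, map_mul,
      map_intCast]
    ring

open Classical in
/-- The coordinates on `L ⊗ 𝔤̃` given by the embeddings in `Φ`. -/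
def unitaryCoordinates (n : ℕ)
    (hΦ : ∀ σ, σ.comp (conj F) ∈ Φ ↔ σ ∉ Φ) {a : (F →+* L) → L ⊗[ℚ] F}
    (ha : ∀ σ τ, embEval σ (a τ) = if σ = τ then 1 else 0)
    (ha' : ∀ f : F, (1 : L) ⊗ₜ[ℚ] f = ∑ σ, σ f • a σ) :
    Coordinates L (unitaryLie n F) Φ (Fin n ⊕ Fin n) :=
  have hcu : ∀ (s t : Φ) (i j : Fin n ⊕ Fin n),
      extendMat (unitaryCoord n s.1)
        ((unitarySingle F i j).baseChange L (a t.1)) =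
        if s = t then Matrix.single i j 1 else 0 := fun s t i j => by
    ext k l
    -- The conjugate term evaluates the idempotent of `t` at an embedding outside `Φ`, where it
    -- vanishes; only the matrix unit survives.
    have hst : s.1.comp (conj F) ≠ t.1 := fun h =>
      (hΦ s.1).1 (h ▸ t.2) s.2
    rw [extendMat_unitaryCoord, ha, ha, if_neg hst]
    simp only [Subtype.ext_iff]
    split_ifs <;> simp_all
  { coord := fun σ => unitaryCoord n σ.1
    unit := fun b => (unitarySingle F b.2.1 b.2.2).baseChange L (a b.1.1)
    coord_unit := hcu
    one_tmul := fun X => by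
      -- The expansion is verified in `L ⊗ 𝔤𝔩_{2n}(F)`, where all embeddings are available: those in
      -- `Φ` directly, their conjugates by the symmetry of coordinates.
      refine lieBaseChange_injective (j := (unitaryLie n F).incl) Subtype.val_injective
        ((glCoordinates (Fin n ⊕ Fin n) hΦ ha ha').ext_proj ?_)
      have key : ∀ σ : Φ, extendMat (unitaryCoord n σ.1)
          ((1 : L) ⊗ₜ X) = extendMat (unitaryCoord n σ.1)
            (∑ b : Φ × (Fin n ⊕ Fin n) × (Fin n ⊕ Fin n), unitaryCoord n b.1.1 X b.2.1 b.2.2 •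
              (unitarySingle F b.2.1 b.2.2).baseChange L (a b.1.1)) := by
        intro σ
        rw [map_sum, Fintype.sum_prod_type, Finset.sum_eq_single σ]
        · simp only [map_smul, hcu, if_true, Fintype.sum_prod_type, extendMat_tmul,
            one_smul]
          conv_lhs => rw [Matrix.matrix_eq_sum_single (unitaryCoord n σ.1 X)]
          simp
        · intro τ _ hτ
          simp only [map_smul, hcu, if_neg (Ne.symm hτ), smul_zero, Finset.sum_const_zero]
        · simp
      rintro ⟨σ, b⟩
      change extendMat (matMap (Fin n ⊕ Fin n) (embOf Φ (σ, b))) _ =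
        extendMat (matMap (Fin n ⊕ Fin n) (embOf Φ (σ, b))) _
      rw [extendMat_incl, extendMat_incl]
      cases b
      · ext i j
        change extendMat (unitaryCoord n (σ.1.comp (conj F))) _ i j =
          extendMat (unitaryCoord n (σ.1.comp (conj F))) _ i j
        rw [extendMat_comp_conj, extendMat_comp_conj, key]
      · exact key σ }

/-! ### Triangular decompositions -/

theorem baseChange_mem_range {V W M : Type*} [AddCommGroup V] [Module ℚ V] [AddCommGroup W]
    [Module ℚ W] [AddCommGroup M] [Module ℚ M] {f : V →ₗ[ℚ] W} {j : M →ₗ[ℚ] W}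
    (h : ∀ v, ∃ m, j m = f v) (x : L ⊗[ℚ] V) :
    f.baseChange L x ∈ LinearMap.range (j.baseChange L) := by
  induction x using TensorProduct.induction_on with
  | zero => rw [map_zero]; exact zero_mem _
  | add a b ha hb => rw [map_add]; exact add_mem ha hb
  | tmul a v =>
    obtain ⟨m, hm⟩ := h v
    exact ⟨a ⊗ₜ m, by rw [LinearMap.baseChange_tmul, LinearMap.baseChange_tmul, hm]⟩

section Subspaces

open Classical

variable {a : (F →+* L) → L ⊗[ℚ] F} (hΦ : ∀ σ, σ.comp (conj F) ∈ Φ ↔ σ ∉ Φ)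

variable (ha : ∀ σ τ, embEval σ (a τ) = if σ = τ then 1 else 0)
  (ha' : ∀ f : F, (1 : L) ⊗ₜ[ℚ] f = ∑ σ, σ f • a σ)

theorem leftIdeal_lowerGl (n : ℕ) : leftIdeal L (lowerGl n F) =
    ((glCoordinates (Fin n) hΦ ha ha').matrixUnits.lower Fin.val).nil := by
  refine (glCoordinates (Fin n) hΦ ha ha').leftIdeal_eq _ (fun X hX s i j h => ?_)
    fun s i j h => baseChange_apply_mem (fun f => ?_) _
  · change embOf Φ s (X i j) = 0
    rw [hX i j (by exact_mod_cast h), map_zero]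
  · intro k l hkl
    change Matrix.single i j f k l = 0
    rw [Matrix.single_apply, if_neg]
    rintro ⟨rfl, rfl⟩
    have : j < i := by exact_mod_cast h
    exact absurd hkl (not_le.2 this)

theorem range_torusGl (n : ℕ) :
    LinearMap.range (lieBaseChange L (torusGl n F).incl : L ⊗[ℚ] torusGl n F →ₗ[L] _) =
      Submodule.span L (((glCoordinates (Fin n) hΦ ha ha').matrixUnits.lower Fin.val).basis ''
        {b | ((glCoordinates (Fin n) hΦ ha ha').matrixUnits.lower Fin.val).w b = 0}) := by
  refine (glCoordinates (Fin n) hΦ ha ha').range_lieBaseChange _ (fun X s i k h => ?_)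
    fun s i k h => baseChange_mem_range (fun f => ⟨⟨Matrix.single i k f, ?_⟩, rfl⟩) _
  · change embOf Φ s (X.1 i k) = 0
    rw [X.2 (fun h' => h (by rw [h'])), map_zero]
  · obtain rfl : i = k := Fin.ext (by exact_mod_cast h)
    intro p q hpq
    rw [Matrix.single_apply, if_neg]
    rintro ⟨rfl, rfl⟩
    exact hpq rfl

theorem pos_le_of_eq_revIdx {n : ℕ} {i j k l : Fin n ⊕ Fin n} (h : pos k ≤ pos l) (hi : i = revIdx l)
    (hj : j = revIdx k) : pos i ≤ pos j := by
  have h1 := pos_revIdx k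
  have h2 := pos_revIdx l
  rw [hi, hj]
  omega

theorem leftIdeal_lowerUnitary (n : ℕ) : leftIdeal L (lowerUnitary n F) =
    ((unitaryCoordinates n hΦ ha ha').matrixUnits.lower pos).nil := by
  refine (unitaryCoordinates n hΦ ha ha').leftIdeal_eq _ (fun X hX s i j h => ?_)
    fun s i j h => baseChange_apply_mem (fun f => ?_) _
  · change s.1 (X.1 i j) = 0
    rw [hX i j (by exact_mod_cast h), map_zero]
  · intro k l hkl
    have h' : pos j < pos i := by exact_mod_cast h
    rw [unitarySingle_apply, if_neg, if_neg]
    · simp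
    · rintro ⟨h1, h2⟩
      exact absurd (pos_le_of_eq_revIdx hkl h1 h2) (not_le.2 h')
    · rintro ⟨rfl, rfl⟩
      exact absurd hkl (not_le.2 h')

theorem range_torusUnitary (n : ℕ) :
    LinearMap.range (lieBaseChange L (torusUnitary n F).incl : L ⊗[ℚ] torusUnitary n F →ₗ[L] _) =
      Submodule.span L (((unitaryCoordinates n hΦ ha ha').matrixUnits.lower pos).basis ''
        {b | ((unitaryCoordinates n hΦ ha ha').matrixUnits.lower pos).w b = 0}) := by
  refine (unitaryCoordinates n hΦ ha ha').range_lieBaseChange _ (fun X s i k h => ?_)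
    fun s i k h => baseChange_mem_range (fun f => ⟨⟨unitarySingle F i k f, ?_⟩, rfl⟩) _
  · change s.1 (X.1.1 i k) = 0
    rw [X.2 (fun h' => h (by rw [h'])), map_zero]
  · have : pos i = pos k := by exact_mod_cast h
    obtain rfl := pos_injective this
    intro p q hpq
    rw [unitarySingle_apply, if_neg, if_neg]
    · simp
    · rintro ⟨h1, h2⟩
      exact hpq (by rw [← revIdx_revIdx p, ← h2, h1, revIdx_revIdx])
    · rintro ⟨rfl, rfl⟩
      exact hpq rfl

/-- The weights of the grading of `𝔤̃` defined by the Siegel parabolic. -/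
def siegelWeight {n : ℕ} : Fin n ⊕ Fin n → ℤ := Sum.elim 0 1

theorem leftIdeal_siegelNilradicalOpp (n : ℕ) : leftIdeal L (siegelNilradicalOpp n F) =
    ((unitaryCoordinates n hΦ ha ha').matrixUnits.weight siegelWeight).nil := by
  refine (unitaryCoordinates n hΦ ha ha').leftIdeal_eq _ (fun X hX s i j h => ?_)
    fun s i j h => baseChange_apply_mem (fun f => ?_) _
  · change s.1 (X.1 i j) = 0
    have : X.1 i j = 0 := by
      rcases i with i | i <;> rcases j with j | j
      · exact congrFun (congrFun hX.1 i) j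
      · exact congrFun (congrFun hX.2.1 i) j
      · simp [siegelWeight] at h
      · exact congrFun (congrFun hX.2.2 i) j
    rw [this, map_zero]
  · rcases i with i | i <;> rcases j with j | j
    · simp [siegelWeight] at h
    · simp [siegelWeight] at h
    · refine ⟨?_, ?_, ?_⟩ <;> ext k l <;>
        simp [Matrix.toBlocks₁₁, Matrix.toBlocks₁₂, Matrix.toBlocks₂₂, unitarySingle_apply, revIdx]
    · simp [siegelWeight] at h

theorem leviMatrix_inl {n : ℕ} (D : glLie n F) (i j : Fin n) :
    leviMatrix D (Sum.inl i) (Sum.inl j) = -conj F (D j.rev i.rev) := by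
  simp only [leviMatrix, Matrix.fromBlocks_apply₁₁, Matrix.neg_apply, Matrix.mul_apply, antidiag,
    Matrix.of_apply]
  rw [Finset.sum_eq_single j.rev, Finset.sum_eq_single i.rev]
  · simp
  · intro b _ hb
    simp [hb]
  · simp
  · intro b _ hb
    rw [if_neg, mul_zero]
    rintro rfl
    simp at hb
  · simp

/-- The unitary condition determines the upper left block from the lower right one, so the latter is
the preimage. -/
theorem exists_leviEmbedding_eq {n : ℕ} (X : unitaryLie n F)
    (hX : ∀ i j, siegelWeight i ≠ siegelWeight j → X.1 i j = 0) :
    ∃ D, leviEmbedding n F D = X := by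
  refine ⟨X.1.toBlocks₂₂, Subtype.ext ?_⟩
  change leviMatrix _ = X.1
  ext i j
  rcases i with i | i <;> rcases j with j | j
  · rw [mem_unitaryLie_iff.1 X.2]
    simp [leviMatrix_inl, rowSign, revIdx, Matrix.toBlocks₂₂]
  · rw [hX _ _ (by simp [siegelWeight])]
    rfl
  · rw [hX _ _ (by simp [siegelWeight])]
    rfl
  · rfl

theorem range_leviEmbedding (n : ℕ) :
    LinearMap.range (lieBaseChange L (leviEmbedding n F) : L ⊗[ℚ] glLie n F →ₗ[L] _) =
      Submodule.span L (((unitaryCoordinates n hΦ ha ha').matrixUnits.weight siegelWeight).basis ''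
        {b | ((unitaryCoordinates n hΦ ha ha').matrixUnits.weight siegelWeight).w b = 0}) := by
  refine (unitaryCoordinates n hΦ ha ha').range_lieBaseChange _ (fun D s i k h => ?_)
    fun s i k h => baseChange_mem_range (fun f => exists_leviEmbedding_eq _ fun p q hpq => ?_) _
  · change s.1 (leviMatrix D i k) = 0
    rcases i with i | i <;> rcases k with k | k
    · exact absurd rfl h
    · exact map_zero _
    · exact map_zero _
    · exact absurd rfl h
  · change (unitarySingle F i k f).1 p q = 0
    rw [unitarySingle_apply, if_neg, if_neg]
    · simp
    · rintro ⟨rfl, rfl⟩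
      rcases p with p | p <;> rcases q with q | q <;> simp [siegelWeight, revIdx] at h hpq
    · rintro ⟨rfl, rfl⟩
      exact hpq h

theorem leviEmbedding_injective (n : ℕ) (F : Type*) [Field F] [NumberField F]
    [NumberField.IsCMField F] : Function.Injective (leviEmbedding n F) := fun D D' h => by
  have h' := congrArg (fun X : unitaryLie n F => X.1.toBlocks₂₂) h
  simpa [leviEmbedding, leviMatrix] using h'

end Subspaces

end CM

/-! ### The symmetric algebra of the torus -/

theorem MatrixUnits.exists_torus {K 𝔤 I κ : Type*} [Field K] [LieRing 𝔤] [LieAlgebra K 𝔤]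
    [DecidableEq I] [DecidableEq κ] (M : MatrixUnits K 𝔤 I κ) :
    ∃ T : MvPolynomial (I × κ) K →ₐ[K] UniversalEnvelopingAlgebra K 𝔤,
      ∀ s i, T (MvPolynomial.X (s, i)) = M.e (s, i, i) := by
  set S : Set (UniversalEnvelopingAlgebra K 𝔤) :=
    Set.range fun b : I × κ => M.e (b.1, b.2, b.2) with hS
  have hcomm : ∀ a ∈ S, ∀ b ∈ S, a * b = b * a := by
    rintro _ ⟨⟨s, i⟩, rfl⟩ _ ⟨⟨t, j⟩, rfl⟩
    rw [← sub_eq_zero, ← LieRing.of_associative_ring_bracket]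
    change ⁅UniversalEnvelopingAlgebra.ι K (M.basis (s, i, i)),
      UniversalEnvelopingAlgebra.ι K (M.basis (t, j, j))⁆ = 0
    rw [← LieHom.map_lie, M.lie_basis]
    by_cases h : s = t
    · subst h
      by_cases hij : i = j
      · subst hij
        simp
      · simp [hij, Ne.symm hij]
    · simp [h]
  -- Evaluation of polynomials needs a commutative target; the diagonal matrix units commute, hence
  -- so does the algebra they generate.
  let _ : CommRing (Algebra.adjoin K S) :=
    { (inferInstance : Ring (Algebra.adjoin K S)) with
      mul_comm := (Algebra.isMulCommutative_adjoin K hcomm).is_comm.comm }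
  refine ⟨(Algebra.adjoin K S).val.comp (MvPolynomial.aeval fun b : I × κ =>
    (⟨M.e (b.1, b.2, b.2), Algebra.subset_adjoin ⟨b, rfl⟩⟩ : Algebra.adjoin K S)), fun s i => ?_⟩
  rw [AlgHom.comp_apply, MvPolynomial.aeval_X]
  rfl

section Torus

variable {L : Type*} [Field L] [CharZero L]

theorem evalTorus_ι {𝔱 : Type*} [LieRing 𝔱] [LieAlgebra ℚ 𝔱] [IsLieAbelian 𝔱] {A : Type*}
    [CommRing A] [Algebra L A] [Algebra ℚ A] [IsScalarTower ℚ L A] (f : 𝔱 →ₗ[ℚ] A)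
    (x : L ⊗[ℚ] 𝔱) :
    evalTorus L f (UniversalEnvelopingAlgebra.ι L x) = LinearMap.liftBaseChange L f x := by
  rw [evalTorus, UniversalEnvelopingAlgebra.lift_ι_apply]
  rfl

theorem mapU_ι {𝔪 𝔤 : Type*} [LieRing 𝔪] [LieAlgebra ℚ 𝔪] [LieRing 𝔤] [LieAlgebra ℚ 𝔤]
    (j : 𝔪 →ₗ⁅ℚ⁆ 𝔤) (x : L ⊗[ℚ] 𝔪) :
    mapU L j (UniversalEnvelopingAlgebra.ι L x) =
      UniversalEnvelopingAlgebra.ι L (lieBaseChange L j x) := by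
  rw [mapU, UniversalEnvelopingAlgebra.lift_ι_apply]
  rfl

/-- Homomorphisms from `U(𝔤_L)` are determined by their values on `𝔤`. -/
theorem algHom_ext_tmul {𝔤 A : Type*} [LieRing 𝔤] [LieAlgebra ℚ 𝔤] [Ring A] [Algebra L A]
    {f g : U L 𝔤 →ₐ[L] A}
    (h : ∀ X : 𝔤, f (UniversalEnvelopingAlgebra.ι L ((1 : L) ⊗ₜ X)) =
      g (UniversalEnvelopingAlgebra.ι L ((1 : L) ⊗ₜ X))) : f = g := by
  refine UniversalEnvelopingAlgebra.hom_ext L (LieHom.ext fun x => ?_)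
  change f (UniversalEnvelopingAlgebra.ι L x) = g (UniversalEnvelopingAlgebra.ι L x)
  induction x using TensorProduct.induction_on with
  | zero => simp
  | add a b ha hb => simp only [map_add, ha, hb]
  | tmul a X =>
    have : a ⊗ₜ[ℚ] X = a • ((1 : L) ⊗ₜ[ℚ] X) := by
      rw [TensorProduct.smul_tmul', smul_eq_mul, mul_one]
    rw [this, map_smul, map_smul, map_smul, h]

theorem mapU_comp {𝔱 𝔪 𝔤 : Type*} [LieRing 𝔱] [LieAlgebra ℚ 𝔱] [LieRing 𝔪] [LieAlgebra ℚ 𝔪]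
    [LieRing 𝔤] [LieAlgebra ℚ 𝔤] (j : 𝔪 →ₗ⁅ℚ⁆ 𝔤) (i : 𝔱 →ₗ⁅ℚ⁆ 𝔪) :
    (mapU L j).comp (mapU L i) = mapU L (j.comp i) := by
  refine algHom_ext_tmul fun X => ?_
  rw [AlgHom.comp_apply, mapU_ι, mapU_ι, mapU_ι]
  rfl

/-- The image in `U(𝔤_L)` of an element of `U(𝔱_L)`, as a polynomial in the diagonal matrix
units. -/
theorem Coordinates.exists_poly {𝔤 I κ : Type*} [LieRing 𝔤] [LieAlgebra ℚ 𝔤]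
    [Fintype I] [Fintype κ] [DecidableEq I] [DecidableEq κ] (C : Coordinates L 𝔤 I κ)
    {𝔱 : Type*} [LieRing 𝔱] [LieAlgebra ℚ 𝔱] [IsLieAbelian 𝔱] {j : 𝔱 →ₗ⁅ℚ⁆ 𝔤} {A : Type*}
    [CommRing A] [Algebra L A] [Algebra ℚ A] [IsScalarTower ℚ L A] {f : 𝔱 →ₗ[ℚ] A}
    {Ψ : MvPolynomial (I × κ) L →ₐ[L] A}
    {T : MvPolynomial (I × κ) L →ₐ[L] U L 𝔤}
    (hT : ∀ s i, T (MvPolynomial.X (s, i)) = C.matrixUnits.e (s, i, i))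
    (hj : ∀ X s i k, i ≠ k → C.coord s (j X) i k = 0)
    (hf : ∀ X, f X = ∑ b : I × κ, C.coord b.1 (j X) b.2 b.2 • Ψ (MvPolynomial.X b))
    (u : U L 𝔱) : ∃ Q, mapU L j u = T Q ∧ evalTorus L f u = Ψ Q := by
  have hu : u ∈ Algebra.adjoin L (Set.range (UniversalEnvelopingAlgebra.ι L :
      (L ⊗[ℚ] 𝔱) → U L 𝔱)) := by
    rw [adjoin_range_ι]; trivial
  induction hu using Algebra.adjoin_induction with
  | mem u hu =>
    obtain ⟨x, rfl⟩ := hu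
    rw [mapU_ι, evalTorus_ι]
    induction x using TensorProduct.induction_on with
    | zero => exact ⟨0, by simp⟩
    | add a b ha hb =>
      obtain ⟨P, hP, hP'⟩ := ha
      obtain ⟨Q, hQ, hQ'⟩ := hb
      exact ⟨P + Q, by simp only [map_add, hP, hQ], by simp only [map_add, hP', hQ']⟩
    | tmul a X =>
      refine ⟨a • ∑ b : I × κ, C.coord b.1 (j X) b.2 b.2 • MvPolynomial.X b, ?_, ?_⟩
      · have h1 : lieBaseChange L j (a ⊗ₜ X) =
            a • ∑ b : I × κ, C.coord b.1 (j X) b.2 b.2 • C.unit (b.1, b.2, b.2) := by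
          change a ⊗ₜ[ℚ] (j X) = _
          rw [show a ⊗ₜ[ℚ] j X = a • ((1 : L) ⊗ₜ[ℚ] j X) by
            rw [TensorProduct.smul_tmul', smul_eq_mul, mul_one], C.one_tmul]
          congr 1
          simp only [Fintype.sum_prod_type]
          refine Finset.sum_congr rfl fun s _ => Finset.sum_congr rfl fun i _ => ?_
          rw [Finset.sum_eq_single i (fun k _ hk => by rw [hj X s i k (Ne.symm hk), zero_smul])
            (by simp)]
        rw [h1, map_smul, map_smul, map_sum, map_sum]
        congr 1
        refine Finset.sum_congr rfl fun b _ => ?_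
        rw [map_smul, map_smul, hT, ← C.matrixUnits_basis]
        rfl
      · rw [LinearMap.liftBaseChange_tmul, hf, map_smul, map_sum]
        simp only [map_smul]
  | algebraMap a => exact ⟨MvPolynomial.C a, by simp [MvPolynomial.algHom_C]⟩
  | add x y _ _ hx hy =>
    obtain ⟨P, hP, hP'⟩ := hx
    obtain ⟨Q, hQ, hQ'⟩ := hy
    exact ⟨P + Q, by simp only [map_add, hP, hQ], by simp only [map_add, hP', hQ']⟩
  | mul x y _ _ hx hy =>
    obtain ⟨P, hP, hP'⟩ := hx
    obtain ⟨Q, hQ, hQ'⟩ := hy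
    exact ⟨P * Q, by simp only [map_mul, hP, hQ], by simp only [map_mul, hP', hQ']⟩

/-- Uniqueness holds because two candidates differ by an element of the Levi enveloping algebra
whose image lies in the left ideal. -/
theorem WeightBasis.exists_isHarishChandra_iff {𝔪 𝔤 B : Type*} [LieRing 𝔪] [LieAlgebra ℚ 𝔪]
    [LieRing 𝔤] [LieAlgebra ℚ 𝔤] [Fintype B] (W : WeightBasis L (L ⊗[ℚ] 𝔤) B) {j : 𝔪 →ₗ⁅ℚ⁆ 𝔤}
    (hj : Function.Injective j)
    (hr : LinearMap.range (lieBaseChange L j : L ⊗[ℚ] 𝔪 →ₗ[L] L ⊗[ℚ] 𝔤) =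
      Submodule.span L (W.basis '' {b | W.w b = 0}))
    {𝔲 : Submodule ℚ 𝔤} (hn : leftIdeal L 𝔲 = W.nil) :
    ∃ f, ∀ f', IsHarishChandra L j 𝔲 f' ↔ f' = f := by
  obtain ⟨f, hf⟩ := W.exists_harishChandra (lieBaseChange_injective hj) hr
  have hf' : IsHarishChandra L j 𝔲 f := fun z => by rw [hn]; exact hf z
  refine ⟨f, fun f' => ⟨fun h => ?_, fun h => h ▸ hf'⟩⟩
  refine AlgHom.ext fun z => Subtype.ext ?_
  rw [← sub_eq_zero]
  refine W.eq_zero_of_mapEnv_mem_nil (lieBaseChange_injective hj) hr ?_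
  rw [← hn]
  change mapU L j _ ∈ _
  rw [map_sub, ← sub_sub_sub_cancel_left _ _ (z : U L 𝔤)]
  exact sub_mem (hf' z) (h z)

end Torus

/-! ### Power sums -/

section PowerSums

variable {L A ι : Type*} [Field L] [CommRing A] [Algebra L A] [Fintype ι]

theorem sum_affine_pow_mem {R : Subalgebra L A} {u : ι → A} (hu : ∀ k, ∑ i, u i ^ k ∈ R)
    (c d : L) (k : ℕ) : ∑ i, (c • u i + algebraMap L A d) ^ k ∈ R := by
  simp only [add_pow]
  rw [Finset.sum_comm]
  refine sum_mem fun m _ => ?_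
  have : ∑ i, (c • u i) ^ m * algebraMap L A d ^ (k - m) * (k.choose m : A) =
      (c ^ m * d ^ (k - m) * (k.choose m : L)) • ∑ i, u i ^ m := by
    rw [Finset.smul_sum]
    refine Finset.sum_congr rfl fun i _ => ?_
    rw [Algebra.smul_def, Algebra.smul_def]
    simp only [map_mul, map_pow, map_natCast]
    ring
  rw [this]
  exact R.smul_mem (hu m) _

/-- The power sums of `u` and `v` lie in any subalgebra which contains the power sums of `u ∪ v` and
those of `(u - 1) ∪ (v + 1)`. -/
theorem sum_pow_mem_of_twist [CharZero L] {R : Subalgebra L A} {u v : ι → A}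
    (h0 : ∀ k, ∑ i, u i ^ k + ∑ i, v i ^ k ∈ R)
    (h1 : ∀ k, ∑ i, (u i - 1) ^ k + ∑ i, (v i + 1) ^ k ∈ R) (k : ℕ) :
    ∑ i, u i ^ k ∈ R ∧ ∑ i, v i ^ k ∈ R := by
  induction k using Nat.strong_induction_on with
  | _ k ih =>
    -- The exponent `k + 1` is used to reach `p_k`: the terms of exponent `k + 1` cancel against
    -- `h0`, and the shifts by `-1` and `1` make `p_k(u)` and `p_k(v)` appear with opposite signs.
    have hU : ∑ i, (u i - 1) ^ (k + 1) = ∑ i, u i ^ (k + 1) - (k + 1 : L) • ∑ i, u i ^ k +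
        ∑ m ∈ Finset.range k, ((-1) ^ (k + 1 - m) * ((k + 1).choose m : L)) • ∑ i, u i ^ m := by
      simp only [sub_eq_add_neg (_ : A) 1, add_pow]
      rw [Finset.sum_comm, Finset.sum_range_succ, Finset.sum_range_succ]
      have : ∀ m ∈ Finset.range k, ∑ i, u i ^ m * (-1) ^ (k + 1 - m) * ((k + 1).choose m : A) =
          ((-1) ^ (k + 1 - m) * ((k + 1).choose m : L)) • ∑ i, u i ^ m := fun m _ => by
        rw [Finset.smul_sum]
        refine Finset.sum_congr rfl fun i _ => ?_
        rw [Algebra.smul_def]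
        simp only [map_mul, map_pow, map_natCast, map_neg, map_one]
        ring
      rw [Finset.sum_congr rfl this, Algebra.smul_def, Finset.mul_sum]
      simp [mul_comm]
      ring
    have hV : ∑ i, (v i + 1) ^ (k + 1) = ∑ i, v i ^ (k + 1) + (k + 1 : L) • ∑ i, v i ^ k +
        ∑ m ∈ Finset.range k, ((k + 1).choose m : L) • ∑ i, v i ^ m := by
      simp only [add_pow]
      rw [Finset.sum_comm, Finset.sum_range_succ, Finset.sum_range_succ]
      have : ∀ m ∈ Finset.range k, ∑ i, v i ^ m * 1 ^ (k + 1 - m) * ((k + 1).choose m : A) =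
          ((k + 1).choose m : L) • ∑ i, v i ^ m := fun m _ => by
        rw [Finset.smul_sum]
        refine Finset.sum_congr rfl fun i _ => ?_
        rw [Algebra.smul_def]
        simp only [map_natCast]
        ring
      rw [Finset.sum_congr rfl this, Algebra.smul_def, Finset.mul_sum]
      simp [mul_comm]
      ring
    have hdiff : (k + 1 : L) • (∑ i, v i ^ k - ∑ i, u i ^ k) ∈ R := by
      have h2 := sub_mem (sub_mem (sub_mem (h1 (k + 1)) (h0 (k + 1)))
        (sum_mem fun m (hm : m ∈ Finset.range k) => R.smul_mem (ih m (Finset.mem_range.1 hm)).1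
          ((-1) ^ (k + 1 - m) * ((k + 1).choose m : L))))
        (sum_mem fun m (hm : m ∈ Finset.range k) => R.smul_mem (ih m (Finset.mem_range.1 hm)).2
          ((k + 1).choose m : L))
      rw [hU, hV] at h2
      convert h2 using 1
      rw [smul_sub]
      ring
    have hk : (k + 1 : L) ≠ 0 := by exact_mod_cast k.succ_ne_zero
    -- Together with the sum `h0 k`, this difference gives both power sums after division by two.
    have hd : ∑ i, v i ^ k - ∑ i, u i ^ k ∈ R := by
      have := R.smul_mem hdiff (k + 1 : L)⁻¹
      rwa [smul_smul, inv_mul_cancel₀ hk, one_smul] at this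
    have h2 : (2 : L) ≠ 0 := two_ne_zero
    constructor
    · have := R.smul_mem (sub_mem (h0 k) hd) (2 : L)⁻¹
      rwa [show ∑ i, u i ^ k + ∑ i, v i ^ k - (∑ i, v i ^ k - ∑ i, u i ^ k) =
        (2 : L) • ∑ i, u i ^ k by rw [two_smul]; ring, smul_smul, inv_mul_cancel₀ h2,
        one_smul] at this
    · have := R.smul_mem (add_mem (h0 k) hd) (2 : L)⁻¹
      rwa [show ∑ i, u i ^ k + ∑ i, v i ^ k + (∑ i, v i ^ k - ∑ i, u i ^ k) =
        (2 : L) • ∑ i, v i ^ k by rw [two_smul]; ring, smul_smul, inv_mul_cancel₀ h2,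
        one_smul] at this

end PowerSums

/-! ### The normalized Harish-Chandra homomorphisms -/

theorem delta_succ (L : Type*) [Field L] (N m : ℕ) : delta L N (m + 1) = delta L N m + 1 := by
  rw [delta, delta, Nat.cast_add, Nat.cast_one, add_assoc]

theorem exists_pos_eq {n : ℕ} (i : Fin n ⊕ Fin n) (m : ℕ) (hm : m < pos i) :
    ∃ j : Fin n ⊕ Fin n, pos j = m := by
  by_cases h : m < n
  · exact ⟨Sum.inl ⟨m, h⟩, rfl⟩
  · have : pos i < 2 * n := by have := pos_revIdx i; omega
    exact ⟨Sum.inr ⟨m - n, by omega⟩, by simp only [pos]; omega⟩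

section Normalized

variable {F L : Type*} [Field F] [NumberField F] [NumberField.IsCMField F] [Field L] [CharZero L]
  {Φ : Finset (F →+* L)}

/-- The blocks of variables of the polynomial ring which belong to the embeddings `σ ∘ c` and
`σ`. -/
def blockEquiv (n : ℕ) (Φ : Finset (F →+* L)) : (Φ × Bool) × Fin n ≃ Φ × (Fin n ⊕ Fin n) where
  toFun b := (b.1.1, if b.1.2 then Sum.inr b.2 else Sum.inl b.2)
  invFun b := Sum.elim (fun i => ((b.1, false), i)) (fun i => ((b.1, true), i)) b.2
  left_inv := by rintro ⟨⟨σ, _ | _⟩, i⟩ <;> rfl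
  right_inv := by rintro ⟨σ, i | i⟩ <;> rfl

omit [NumberField F] [NumberField.IsCMField F] [CharZero L] in
theorem image_rename_blockPsum (n : ℕ) (Φ : Finset (F →+* L)) :
    (MvPolynomial.rename (blockEquiv n Φ) : _ → Poly n Φ) ''
      (Set.range fun b : (Φ × Bool) × ℕ => blockPsum L b.1 b.2) =
      (Set.range fun b : Φ × ℕ => ∑ i, MvPolynomial.X (b.1, Sum.inl i) ^ b.2) ∪
        Set.range fun b : Φ × ℕ => ∑ i, MvPolynomial.X (b.1, Sum.inr i) ^ b.2 := by
  have h1 : ∀ σ k, MvPolynomial.rename (blockEquiv n Φ) (blockPsum L (σ, false) k) =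
      ∑ i, MvPolynomial.X (σ, Sum.inl i) ^ k := fun σ k => by simp [blockPsum, blockEquiv]
  have h2 : ∀ σ k, MvPolynomial.rename (blockEquiv n Φ) (blockPsum L (σ, true) k) =
      ∑ i, MvPolynomial.X (σ, Sum.inr i) ^ k := fun σ k => by simp [blockPsum, blockEquiv]
  refine Set.Subset.antisymm ?_ (Set.union_subset ?_ ?_)
  · rintro _ ⟨_, ⟨⟨⟨σ, _ | _⟩, k⟩, rfl⟩, rfl⟩
    · exact Or.inl ⟨(σ, k), (h1 σ k).symm⟩
    · exact Or.inr ⟨(σ, k), (h2 σ k).symm⟩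
  · rintro _ ⟨⟨σ, k⟩, rfl⟩
    exact ⟨_, ⟨((σ, false), k), rfl⟩, h1 σ k⟩
  · rintro _ ⟨⟨σ, k⟩, rfl⟩
    exact ⟨_, ⟨((σ, true), k), rfl⟩, h2 σ k⟩

variable (hL : Nat.card (F →+* L) = Module.finrank ℚ F)
  (hΦ : ∀ σ, σ.comp (conj F) ∈ Φ ↔ σ ∉ Φ)

include hL hΦ

theorem exists_isNormalizedHCUnitary (n : ℕ) :
    ∃ γt : Z L (unitaryLie n F) →ₐ[L] Poly n Φ,
      (∀ f, IsNormalizedHCUnitary n Φ f ↔ f = γt) ∧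
      γt.range = Algebra.adjoin L (Set.range fun b : Φ × ℕ => blockPsum L b.1 b.2) := by
  classical
  obtain ⟨a, ha, ha'⟩ := exists_idempotents hL
  obtain ⟨f, hf⟩ := WeightBasis.exists_isHarishChandra_iff _
    (j := (torusUnitary n F).incl) Subtype.val_injective
    (range_torusUnitary hΦ ha ha' n) (leftIdeal_lowerUnitary hΦ ha ha' n)
  have hf0 := (hf f).2 rfl
  obtain ⟨T, hT⟩ := (unitaryCoordinates n hΦ ha ha').matrixUnits.exists_torus
  refine ⟨(evalTorus L (torusUnitaryPoly n Φ)).comp ((Z L (torusUnitary n F)).val.comp f),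
    fun g => ⟨?_, ?_⟩, ?_⟩
  · rintro ⟨f', hf', hg⟩
    rw [(hf f').1 hf'] at hg
    exact AlgHom.ext hg
  · rintro rfl
    exact ⟨f, hf0, fun z => rfl⟩
  · refine MatrixUnits.normalized_range _ pos_injective hT (d := delta L (2 * n)) (fun z => ?_)
      (delta_succ L _) exists_pos_eq
    obtain ⟨Q, hQ, hQ'⟩ := (unitaryCoordinates n hΦ ha ha').exists_poly
      (j := (torusUnitary n F).incl) (f := torusUnitaryPoly n Φ)
      (Ψ := MvPolynomial.aeval fun b =>
        MvPolynomial.X b - MvPolynomial.C (delta L (2 * n) (pos b.2)))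
      hT
      (fun X s i k hik => by
        change s.1 (X.1.1 i k) = 0
        rw [X.2 hik, map_zero])
      (fun X => by
        change ∑ σ : Φ, ∑ k : Fin n ⊕ Fin n, _ = _
        rw [Fintype.sum_prod_type]
        refine Finset.sum_congr rfl fun s _ => Finset.sum_congr rfl fun i _ => ?_
        rw [MvPolynomial.aeval_X, MvPolynomial.smul_eq_C_mul]
        rfl) (f z : U L (torusUnitary n F))
    refine ⟨Q, ?_, hQ'⟩
    rw [← hQ, ← leftIdeal_lowerUnitary hΦ ha ha' n]
    exact hf0 z

theorem exists_isNormalizedHCGl (n : ℕ) :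
    ∃ γ : Z L (glLie n F) →ₐ[L] Poly n Φ,
      (∀ f, IsNormalizedHCGl n Φ f ↔ f = γ) ∧ Function.Injective γ ∧
      γ.range = Algebra.adjoin L ((Set.range fun b : Φ × ℕ =>
          ∑ i, MvPolynomial.X (b.1, Sum.inl i) ^ b.2) ∪
        Set.range fun b : Φ × ℕ => ∑ i, MvPolynomial.X (b.1, Sum.inr i) ^ b.2) := by
  classical
  obtain ⟨a, ha, ha'⟩ := exists_idempotents hL
  obtain ⟨f, hf⟩ := WeightBasis.exists_isHarishChandra_iff _
    (j := (torusGl n F).incl) Subtype.val_injective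
    (range_torusGl hΦ ha ha' n) (leftIdeal_lowerGl hΦ ha ha' n)
  have hf0 := (hf f).2 rfl
  obtain ⟨T, hT⟩ := (glCoordinates (Fin n) hΦ ha ha').matrixUnits.exists_torus
  set γ := (evalTorus L (torusGlPoly n Φ)).comp ((Z L (torusGl n F)).val.comp f) with hγ
  -- The general theorem has one block of `n` variables for each of the embeddings `σ ∘ c` and `σ`;
  -- `ρ` regroups them as `x_1, …, x_{2n}`.
  set ρ := MvPolynomial.renameEquiv L (blockEquiv n Φ)
  set γ' : Z L (glLie n F) →ₐ[L] MvPolynomial ((Φ × Bool) × Fin n) L :=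
    (ρ.symm : Poly n Φ →ₐ[L] _).comp γ with hγ'
  have hγρ : (ρ : _ →ₐ[L] Poly n Φ).comp γ' = γ := AlgHom.ext fun z => ρ.apply_symm_apply _
  have key : ∀ z : Z L (glLie n F), ∃ P : MvPolynomial ((Φ × Bool) × Fin n) L,
      (z : U L (glLie n F)) - T P ∈
        ((glCoordinates (Fin n) hΦ ha ha').matrixUnits.lower Fin.val).nil ∧
      γ' z = MvPolynomial.aeval
        (fun b => MvPolynomial.X b - MvPolynomial.C (delta L n (b.2 : ℕ))) P := by
    intro z
    obtain ⟨Q, hQ, hQ'⟩ := (glCoordinates (Fin n) hΦ ha ha').exists_poly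
      (j := (torusGl n F).incl) (f := torusGlPoly n Φ)
      (Ψ := (ρ : _ →ₐ[L] Poly n Φ).comp (MvPolynomial.aeval
        fun b => MvPolynomial.X b - MvPolynomial.C (delta L n (b.2 : ℕ))))
      hT
      (fun X s i k hik => by
        change embOf Φ s (X.1 i k) = 0
        rw [X.2 hik, map_zero])
      (fun X => by
        change ∑ σ : Φ, ∑ i : Fin n, _ = _
        rw [Fintype.sum_prod_type, Fintype.sum_prod_type]
        refine Finset.sum_congr rfl fun s _ => ?_
        rw [Fintype.sum_bool, Finset.sum_add_distrib, add_comm]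
        congr 1 <;> refine Finset.sum_congr rfl fun i _ => ?_ <;>
        · rw [AlgHom.comp_apply, MvPolynomial.aeval_X, map_sub]
          change _ = _ • (MvPolynomial.rename (blockEquiv n Φ) (MvPolynomial.X _) -
            MvPolynomial.rename (blockEquiv n Φ) (MvPolynomial.C _))
          rw [MvPolynomial.rename_X, MvPolynomial.rename_C, MvPolynomial.smul_eq_C_mul]
          rfl) (f z : U L (torusGl n F))
    refine ⟨Q, ?_, ?_⟩
    · rw [← hQ, ← leftIdeal_lowerGl hΦ ha ha' n]
      exact hf0 z
    · exact (congrArg ρ.symm hQ').trans (ρ.symm_apply_apply _)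
  refine ⟨γ, fun g => ⟨?_, ?_⟩, ?_, ?_⟩
  · rintro ⟨f', hf', hg⟩
    rw [(hf f').1 hf'] at hg
    exact AlgHom.ext hg
  · rintro rfl
    exact ⟨f, hf0, fun z => rfl⟩
  · rw [← hγρ]
    exact ρ.injective.comp (MatrixUnits.normalized_injective _ key)
  · have h := MatrixUnits.normalized_range _ Fin.val_injective hT key (delta_succ L _)
      (fun i m hm => ⟨⟨m, hm.trans i.2⟩, rfl⟩)
    rw [← hγρ, AlgHom.range_comp, h, AlgHom.map_adjoin]
    exact congrArg (Algebra.adjoin L) (image_rename_blockPsum n Φ)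

end Normalized

/-! ### Compatibility of the Harish-Chandra homomorphisms -/

theorem leftIdeal_mono {L 𝔤 : Type*} [Field L] [CharZero L] [LieRing 𝔤] [LieAlgebra ℚ 𝔤]
    {𝔲 𝔲' : Submodule ℚ 𝔤} (h : 𝔲 ≤ 𝔲') : leftIdeal L 𝔲 ≤ leftIdeal L 𝔲' :=
  Ideal.span_mono (Set.image_mono (by
    rw [Submodule.baseChange_eq_span, Submodule.baseChange_eq_span]
    exact Submodule.span_mono (Submodule.map_mono h)))

theorem mapU_mem_leftIdeal {L 𝔪 𝔤 : Type*} [Field L] [CharZero L] [LieRing 𝔪] [LieAlgebra ℚ 𝔪]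
    [LieRing 𝔤] [LieAlgebra ℚ 𝔤] {j : 𝔪 →ₗ⁅ℚ⁆ 𝔤} {𝔲 : Submodule ℚ 𝔪} {𝔲' : Submodule ℚ 𝔤}
    (h : ∀ X ∈ 𝔲, j X ∈ 𝔲') {x : U L 𝔪} (hx : x ∈ leftIdeal L 𝔲) :
    mapU L j x ∈ leftIdeal L 𝔲' := by
  refine Submodule.span_induction (p := fun x _ => mapU L j x ∈ leftIdeal L 𝔲') ?_ ?_ ?_ ?_ hx
  · rintro _ ⟨y, hy, rfl⟩
    rw [mapU_ι]
    refine Ideal.subset_span ⟨_, ?_, rfl⟩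
    rw [SetLike.mem_coe, Submodule.baseChange_eq_span] at hy
    refine Submodule.span_induction
      (p := fun y _ => lieBaseChange L j y ∈ 𝔲'.baseChange L) ?_ ?_ ?_ ?_ hy
    · rintro _ ⟨X, hX, rfl⟩
      exact Submodule.tmul_mem_baseChange_of_mem 1 (h X hX)
    · rw [map_zero]; exact zero_mem _
    · intro a b _ _ ha hb
      rw [map_add]; exact add_mem ha hb
    · intro c a _ ha
      rw [map_smul]; exact Submodule.smul_mem _ c ha
  · rw [map_zero]; exact zero_mem _
  · intro a b _ _ ha hb
    rw [map_add]; exact add_mem ha hb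
  · intro c a _ ha
    rw [smul_eq_mul, map_mul]; exact Ideal.mul_mem_left _ _ ha

section CM

variable {F L : Type*} [Field F] [NumberField F] [NumberField.IsCMField F] [Field L] [CharZero L]
  {Φ : Finset (F →+* L)}

theorem leviMatrix_isDiag {n : ℕ} {D : glLie n F} (hD : D.IsDiag) : (leviMatrix D).IsDiag := by
  rintro (i | i) (j | j) hij
  · rw [leviMatrix_inl, hD, map_zero, neg_zero]
    exact fun h => hij (by rw [Fin.rev_inj.1 h])
  · rfl
  · rfl
  · exact hD (fun h => hij (by rw [h]))

/-- The restriction of the Levi embedding to the diagonal tori. -/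
def torusLevi (n : ℕ) (F : Type*) [Field F] [NumberField F] [NumberField.IsCMField F] :
    torusGl n F →ₗ⁅ℚ⁆ torusUnitary n F where
  toFun D := ⟨leviEmbedding n F D.1, leviMatrix_isDiag D.2⟩
  map_add' X Y := Subtype.ext (map_add (leviEmbedding n F) X.1 Y.1)
  map_smul' r X := Subtype.ext (map_smul (leviEmbedding n F) r X.1)
  map_lie' {X Y} := Subtype.ext (LieHom.map_lie (leviEmbedding n F) X.1 Y.1)

theorem leviEmbedding_mem_lowerUnitary {n : ℕ} {D : glLie n F} (hD : D ∈ lowerGl n F) :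
    leviEmbedding n F D ∈ lowerUnitary n F := by
  rintro (i | i) (j | j) hij
  · change leviMatrix D _ _ = 0
    have hij' : i ≤ j := hij
    rw [leviMatrix_inl, hD _ _ (Fin.rev_le_rev.2 hij'), map_zero, neg_zero]
  · rfl
  · rfl
  · exact hD i j (Fin.le_def.2 (Nat.le_of_add_le_add_left hij))

theorem siegelNilradicalOpp_le (n : ℕ) (F : Type*) [Field F] [NumberField F]
    [NumberField.IsCMField F] : siegelNilradicalOpp n F ≤ lowerUnitary n F := by
  rintro X ⟨h1, h2, h3⟩ (i | i) (j | j) hij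
  · exact congrFun (congrFun h1 i) j
  · exact congrFun (congrFun h2 i) j
  · simp only [pos] at hij
    omega
  · exact congrFun (congrFun h3 i) j

/-- The substitution `x_i ↦ -x_{n+1-i} - n/2`, `x_{n+i} ↦ x_{n+i} + n/2`. -/
def siegelSubst (n : ℕ) (Φ : Finset (F →+* L)) : Poly n Φ →ₐ[L] Poly n Φ :=
  MvPolynomial.aeval fun s => match s with
    | (σ, Sum.inl i) => -MvPolynomial.X (σ, Sum.inl i.rev) - MvPolynomial.C ((n : L) / 2)
    | (σ, Sum.inr i) => MvPolynomial.X (σ, Sum.inr i) + MvPolynomial.C ((n : L) / 2)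

/-- The sign and the reversal come from the block `-Ψ ᵗ(D^c) Ψ` of the Levi embedding, the constants
`n/2` from comparing the vectors `δ` of the two algebras. -/
theorem siegelSubst_torusUnitaryPoly (n : ℕ) (X : torusGl n F) :
    siegelSubst n Φ (torusUnitaryPoly n Φ (torusLevi n F X)) = torusGlPoly n Φ X := by
  change siegelSubst n Φ (∑ σ : Φ, ∑ k, MvPolynomial.C (σ.1 (leviMatrix X.1 k k)) *
    (MvPolynomial.X (σ, k) - MvPolynomial.C (delta L (2 * n) (pos k)))) = ∑ σ : Φ, ∑ i, _
  rw [map_sum]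
  refine Finset.sum_congr rfl fun σ _ => ?_
  rw [map_sum, Fintype.sum_sum_type, Finset.sum_add_distrib]
  congr 1
  · refine Fintype.sum_equiv Fin.revPerm _ _ fun i => ?_
    rw [map_mul, map_sub, leviMatrix_inl, Fin.revPerm_apply, MvPolynomial.algHom_C,
      MvPolynomial.algHom_C, siegelSubst, MvPolynomial.aeval_X, map_neg, map_neg]
    -- Reversal negates the `δ` of `𝔤𝔩_n`, and the first half of the `δ` of `𝔤𝔩_{2n}` is that of
    -- `𝔤𝔩_n` lowered by `n/2`.
    have h : delta L n (i.rev : ℕ) =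
        -(delta L (2 * n) (pos (Sum.inl i : Fin n ⊕ Fin n)) + n / 2) := by
      have hi : ((i.rev : ℕ) : L) = n - 1 - (i : ℕ) := by
        rw [Fin.val_rev, Nat.cast_sub (by omega)]
        push_cast
        ring
      simp only [delta, pos, hi]
      push_cast
      ring
    rw [h]
    simp only [MvPolynomial.algebraMap_eq, map_neg, map_add]
    ring
  · refine Finset.sum_congr rfl fun i _ => ?_
    rw [map_mul, map_sub, MvPolynomial.algHom_C, MvPolynomial.algHom_C, siegelSubst,
      MvPolynomial.aeval_X]
    have h : delta L n (i : ℕ) = delta L (2 * n) (pos (Sum.inr i : Fin n ⊕ Fin n)) - n / 2 := by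
      simp only [delta, pos]
      push_cast
      ring
    rw [h]
    simp only [MvPolynomial.algebraMap_eq, map_sub]
    change MvPolynomial.C (σ.1 (X.1 i i)) * _ = _
    ring

theorem siegelSubst_evalTorus (n : ℕ) (u : U L (torusGl n F)) :
    siegelSubst n Φ (evalTorus L (torusUnitaryPoly n Φ) (mapU L (torusLevi n F) u)) =
      evalTorus L (torusGlPoly n Φ) u := by
  have h : ((siegelSubst n Φ).comp (evalTorus L (torusUnitaryPoly n Φ))).comp
      (mapU L (torusLevi n F)) = evalTorus L (torusGlPoly n Φ) := by
    refine algHom_ext_tmul fun X => ?_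
    rw [AlgHom.comp_apply, AlgHom.comp_apply, mapU_ι, evalTorus_ι, evalTorus_ι]
    change siegelSubst n Φ (LinearMap.liftBaseChange L _ ((1 : L) ⊗ₜ torusLevi n F X)) = _
    rw [LinearMap.liftBaseChange_tmul, LinearMap.liftBaseChange_tmul, one_smul, one_smul,
      siegelSubst_torusUnitaryPoly]
  exact AlgHom.congr_fun h u

/-- Transitivity: projecting first to the Levi factor and then to its torus is the projection to the
torus, since the lower triangular part of `𝔤̃` contains both the Siegel nilradical and the image of
the lower triangular part of `𝔤𝔩_n`. -/
theorem normalized_siegelHC (hL : Nat.card (F →+* L) = Module.finrank ℚ F)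
    (hΦ : ∀ σ, σ.comp (conj F) ∈ Φ ↔ σ ∉ Φ) {n : ℕ}
    {γt : Z L (unitaryLie n F) →ₐ[L] Poly n Φ} (hγt : IsNormalizedHCUnitary n Φ γt)
    {γ : Z L (glLie n F) →ₐ[L] Poly n Φ} (hγ : IsNormalizedHCGl n Φ γ)
    {f : Z L (unitaryLie n F) →ₐ[L] Z L (glLie n F)} (hf : IsSiegelHC n F L f)
    (z : Z L (unitaryLie n F)) : γ (f z) = siegelSubst n Φ (γt z) := by
  classical
  obtain ⟨a, ha, ha'⟩ := exists_idempotents hL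
  obtain ⟨ft, hft, hft'⟩ := hγt
  obtain ⟨fg, hfg, hfg'⟩ := hγ
  have h1 : (z : U L (unitaryLie n F)) - mapU L (torusUnitary n F).incl
      (mapU L (torusLevi n F) (fg (f z) : U L (torusGl n F))) ∈
        leftIdeal L (lowerUnitary n F) := by
    have h2 := leftIdeal_mono (siegelNilradicalOpp_le n F) (hf z)
    have h3 := mapU_mem_leftIdeal (j := leviEmbedding n F)
      (fun D hD => leviEmbedding_mem_lowerUnitary hD) (hfg (f z))
    have h4 := add_mem h2 h3
    rw [map_sub, sub_add_sub_cancel] at h4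
    have h5 : mapU L (leviEmbedding n F) (mapU L (torusGl n F).incl
        (fg (f z) : U L (torusGl n F))) = mapU L (torusUnitary n F).incl
          (mapU L (torusLevi n F) (fg (f z) : U L (torusGl n F))) := by
      have h6 := AlgHom.congr_fun ((mapU_comp (L := L) (leviEmbedding n F) (torusGl n F).incl).trans
        (mapU_comp (torusUnitary n F).incl (torusLevi n F)).symm)
      exact h6 _
    rwa [h5] at h4
  -- Both sides are torus components of `z` modulo the same left ideal, which meets the torus
  -- algebra in zero.
  have h6 : (ft z : U L (torusUnitary n F)) = mapU L (torusLevi n F) (fg (f z)) := by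
    rw [← sub_eq_zero]
    refine WeightBasis.eq_zero_of_mapEnv_mem_nil _
      (lieBaseChange_injective (j := (torusUnitary n F).incl) Subtype.val_injective)
      (range_torusUnitary hΦ ha ha' n) ?_
    rw [← leftIdeal_lowerUnitary hΦ ha ha' n]
    change mapU L (torusUnitary n F).incl _ ∈ _
    rw [map_sub, ← sub_sub_sub_cancel_left _ _ (z : U L (unitaryLie n F))]
    exact sub_mem h1 (hft z)
  rw [hft' z, hfg' (f z), h6, siegelSubst_evalTorus]

theorem exists_isSiegelHC (hL : Nat.card (F →+* L) = Module.finrank ℚ F)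
    (hΦ : ∀ σ, σ.comp (conj F) ∈ Φ ↔ σ ∉ Φ) (n : ℕ) :
    ∃ f, ∀ f', IsSiegelHC n F L f' ↔ f' = f := by
  classical
  obtain ⟨a, ha, ha'⟩ := exists_idempotents hL
  exact WeightBasis.exists_isHarishChandra_iff _ (leviEmbedding_injective n F)
    (range_leviEmbedding hΦ ha ha' n) (leftIdeal_siegelNilradicalOpp hΦ ha ha' n)

/-! ### The twisted homomorphism and surjectivity -/

-- The reversal of indices in `siegelSubst` disappears in a sum over all variables, which makes the
-- result comparable with `twistSubst`.
omit [NumberField F] [NumberField.IsCMField F] [CharZero L] in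
theorem siegelSubst_blockPsum (n : ℕ) (σ : Φ) (k : ℕ) :
    siegelSubst n Φ (blockPsum L σ k) =
      ∑ i, (-MvPolynomial.X (σ, Sum.inl i) - MvPolynomial.C ((n : L) / 2)) ^ k +
        ∑ i, (MvPolynomial.X (σ, Sum.inr i) + MvPolynomial.C ((n : L) / 2)) ^ k := by
  rw [blockPsum, map_sum, Fintype.sum_sum_type]
  congr 1
  · refine Fintype.sum_equiv Fin.revPerm _ _ fun i => ?_
    rw [map_pow, siegelSubst, MvPolynomial.aeval_X, Fin.revPerm_apply]
  · refine Finset.sum_congr rfl fun i _ => ?_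
    rw [map_pow, siegelSubst, MvPolynomial.aeval_X]

omit [NumberField F] [NumberField.IsCMField F] [CharZero L] in
theorem twistSubst_blockPsum (n : ℕ) (σ : Φ) (k : ℕ) :
    twistSubst n Φ (twistVector n Φ) (blockPsum L σ k) =
      ∑ i, (-MvPolynomial.X (σ, Sum.inl i) - MvPolynomial.C ((n : L) / 2) - 1) ^ k +
        ∑ i, (MvPolynomial.X (σ, Sum.inr i) + MvPolynomial.C ((n : L) / 2) + 1) ^ k := by
  rw [blockPsum, map_sum, Fintype.sum_sum_type]
  congr 1 <;> refine Finset.sum_congr rfl fun i _ => ?_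
  · rw [map_pow, twistSubst, MvPolynomial.aeval_X]
    simp [twistVector, sub_eq_add_neg]
  · rw [map_pow, twistSubst, MvPolynomial.aeval_X]
    simp [twistVector]

/-- The algebra generated by the power sums of the variables `x_1, …, x_n` and of the variables
`x_{n+1}, …, x_{2n}` in each factor. -/
def leviPsumAlgebra (n : ℕ) (Φ : Finset (F →+* L)) : Subalgebra L (Poly n Φ) :=
  Algebra.adjoin L ((Set.range fun b : Φ × ℕ => ∑ i, MvPolynomial.X (b.1, Sum.inl i) ^ b.2) ∪
    Set.range fun b : Φ × ℕ => ∑ i, MvPolynomial.X (b.1, Sum.inr i) ^ b.2)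

omit [NumberField F] [NumberField.IsCMField F] [CharZero L] in
theorem twistSubst_blockPsum_mem (n : ℕ) (σ : Φ) (k : ℕ) :
    twistSubst n Φ (twistVector n Φ) (blockPsum L σ k) ∈ leviPsumAlgebra n Φ := by
  rw [twistSubst_blockPsum]
  refine add_mem ?_ ?_
  · have := sum_affine_pow_mem (R := leviPsumAlgebra n Φ)
      (u := fun i => MvPolynomial.X (σ, Sum.inl i))
      (fun m => Algebra.subset_adjoin (Or.inl ⟨(σ, m), rfl⟩)) (-1 : L) (-((n : L) / 2) - 1) k
    convert this using 3 with i
    rw [neg_smul, one_smul, MvPolynomial.algebraMap_eq, map_sub, map_neg, map_one]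
    ring
  · have := sum_affine_pow_mem (R := leviPsumAlgebra n Φ)
      (u := fun i => MvPolynomial.X (σ, Sum.inr i))
      (fun m => Algebra.subset_adjoin (Or.inr ⟨(σ, m), rfl⟩)) (1 : L) ((n : L) / 2 + 1) k
    convert this using 3 with i
    rw [one_smul, MvPolynomial.algebraMap_eq, map_add, map_one]
    ring

-- With `u_i = -x_i - n/2` and `v_i = x_{n+i} + n/2` the hypotheses are those of
-- `sum_pow_mem_of_twist`; inverting the affine changes of variable passes from power sums of `u`
-- and `v` to those of the `x`.
omit [NumberField F] [NumberField.IsCMField F] in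
theorem leviPsumAlgebra_le {n : ℕ} {R : Subalgebra L (Poly n Φ)}
    (h0 : ∀ σ k, siegelSubst n Φ (blockPsum L σ k) ∈ R)
    (h1 : ∀ σ k, twistSubst n Φ (twistVector n Φ) (blockPsum L σ k) ∈ R) :
    leviPsumAlgebra n Φ ≤ R := by
  have key : ∀ (σ : Φ) (k : ℕ),
      ∑ i, (-MvPolynomial.X (σ, Sum.inl i) - MvPolynomial.C ((n : L) / 2)) ^ k ∈ R ∧
        ∑ i, (MvPolynomial.X (σ, Sum.inr i) + MvPolynomial.C ((n : L) / 2)) ^ k ∈ R := fun σ =>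
    sum_pow_mem_of_twist (fun k => by rw [← siegelSubst_blockPsum]; exact h0 σ k)
      (fun k => by rw [← twistSubst_blockPsum]; exact h1 σ k)
  refine Algebra.adjoin_le (Set.union_subset ?_ ?_)
  · rintro _ ⟨⟨σ, k⟩, rfl⟩
    have := sum_affine_pow_mem (fun m => (key σ m).1) (-1 : L) (-((n : L) / 2)) k
    change ∑ i, MvPolynomial.X (σ, Sum.inl i) ^ k ∈ R
    convert this using 3 with i
    rw [neg_smul, one_smul, MvPolynomial.algebraMap_eq, map_neg]
    ring
  · rintro _ ⟨⟨σ, k⟩, rfl⟩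
    have := sum_affine_pow_mem (fun m => (key σ m).2) (1 : L) (-((n : L) / 2)) k
    change ∑ i, MvPolynomial.X (σ, Sum.inr i) ^ k ∈ R
    convert this using 3 with i
    rw [one_smul, MvPolynomial.algebraMap_eq, map_neg]
    ring

end CM

/-- The Harish-Chandra homomorphisms, for a set `Φ` of representatives of the embeddings of `F`
modulo complex conjugation. -/
theorem exists_harishChandra_surjective {F L : Type*} [Field F] [NumberField F]
    [NumberField.IsCMField F] [Field L] [CharZero L] {Φ : Finset (F →+* L)}
    (hL : Nat.card (F →+* L) = Module.finrank ℚ F)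
    (hΦ : ∀ σ, σ.comp (conj F) ∈ Φ ↔ σ ∉ Φ) (n : ℕ) :
    ∃ (γt : Z L (unitaryLie n F) →ₐ[L] Poly n Φ) (γ : Z L (glLie n F) →ₐ[L] Poly n Φ)
      (HC HCa : Z L (unitaryLie n F) →ₐ[L] Z L (glLie n F)),
      (∀ f, IsNormalizedHCUnitary n Φ f ↔ f = γt) ∧
      (∀ f, IsNormalizedHCGl n Φ f ↔ f = γ) ∧
      (∀ f, IsSiegelHC n F L f ↔ f = HC) ∧
      (∀ f : Z L (unitaryLie n F) →ₐ[L] Z L (glLie n F),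
        γ.comp f = (twistSubst n Φ (twistVector n Φ)).comp γt ↔ f = HCa) ∧
      Function.Surjective (Algebra.TensorProduct.productMap HC HCa) := by
  obtain ⟨γt, hγt, hγtr⟩ := exists_isNormalizedHCUnitary hL hΦ n
  obtain ⟨γ, hγ, hγi, hγr⟩ := exists_isNormalizedHCGl hL hΦ n
  obtain ⟨HC, hHC⟩ := exists_isSiegelHC hL hΦ n
  change γ.range = leviPsumAlgebra n Φ at hγr
  -- It is enough to treat the generators of the image of `γt`, whose twists are power sums of
  -- affine functions of the two groups of variables. Injectivity of `γ` then defines `HCa` by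
  -- inverting `γ` on its range.
  have hmem : ∀ z, (twistSubst n Φ (twistVector n Φ)).comp γt z ∈ γ.range := by
    have hle : γt.range ≤ γ.range.comap (twistSubst n Φ (twistVector n Φ)) := by
      rw [hγtr, hγr]
      refine Algebra.adjoin_le ?_
      rintro _ ⟨⟨σ, k⟩, rfl⟩
      exact twistSubst_blockPsum_mem n σ k
    exact fun z => hle ⟨z, rfl⟩
  let e := AlgEquiv.ofInjective γ hγi
  let HCa : Z L (unitaryLie n F) →ₐ[L] Z L (glLie n F) :=
    (e.symm : γ.range →ₐ[L] _).comp
      (((twistSubst n Φ (twistVector n Φ)).comp γt).codRestrict γ.range hmem)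
  have hHCa : γ.comp HCa = (twistSubst n Φ (twistVector n Φ)).comp γt :=
    AlgHom.ext fun z => congrArg Subtype.val (e.apply_symm_apply _)
  refine ⟨γt, γ, HC, HCa, hγt, hγ, hHC, fun f => ⟨fun h => ?_, fun h => h ▸ hHCa⟩, ?_⟩
  · refine AlgHom.ext fun z => hγi ?_
    exact AlgHom.congr_fun (h.trans hHCa.symm) z
  · rw [← AlgHom.range_eq_top, Algebra.TensorProduct.productMap_range, eq_top_iff]
    intro w _
    have hpsum : ∀ (σ : Φ) k, ∃ z, γt z = blockPsum L σ k := fun σ k => by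
      have : blockPsum L σ k ∈ γt.range := by
        rw [hγtr]
        exact Algebra.subset_adjoin ⟨(σ, k), rfl⟩
      exact this
    -- Surjectivity is tested after the injective map `γ`. The power sums of all `2n` variables lift
    -- to the centre through `γt`, and their images under `HC` and `HCa` supply the two hypotheses
    -- of `leviPsumAlgebra_le`.
    have hle : leviPsumAlgebra n Φ ≤ (HC.range ⊔ HCa.range).map γ := by
      refine leviPsumAlgebra_le (fun σ k => ?_) fun σ k => ?_
      · obtain ⟨z, hz⟩ := hpsum σ k
        exact ⟨HC z, (le_sup_left : HC.range ≤ _) ⟨z, rfl⟩, by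
          rw [← hz]
          exact normalized_siegelHC hL hΦ ((hγt γt).2 rfl) ((hγ γ).2 rfl) ((hHC HC).2 rfl) z⟩
      · obtain ⟨z, hz⟩ := hpsum σ k
        exact ⟨HCa z, (le_sup_right : HCa.range ≤ _) ⟨z, rfl⟩, by
          rw [← hz]
          exact AlgHom.congr_fun hHCa z⟩
    rw [← hγr] at hle
    obtain ⟨w', hw', h⟩ := hle ⟨w, rfl⟩
    exact hγi h ▸ hw'

end HCSurj

end

open HCSurj in
theorem mainTheorem7 (p : ℕ) [Fact p.Prime] (n : ℕ)
    (F : Type*) [Field F] [NumberField F] [NumberField.IsCMField F]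
    (L : Type*) [Field L] [CharZero L] [Algebra ℚ_[p] L] [FiniteDimensional ℚ_[p] L]
    (hL : Nat.card (F →+* L) = Module.finrank ℚ F)
    (S : Set (Ideal (𝓞 F))) (hS : S ∪ conjPlace '' S = placesAbove p F)
    (hSc : Disjoint S (conjPlace '' S)) :
    ∃ (γt : Z L (unitaryLie n F) →ₐ[L] Poly n (embeddingsOver p L S))
      (γ : Z L (glLie n F) →ₐ[L] Poly n (embeddingsOver p L S))
      (HC HCa : Z L (unitaryLie n F) →ₐ[L] Z L (glLie n F)),
      (∀ f, IsNormalizedHCUnitary n (embeddingsOver p L S) f ↔ f = γt) ∧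
      (∀ f, IsNormalizedHCGl n (embeddingsOver p L S) f ↔ f = γ) ∧
      (∀ f, IsSiegelHC n F L f ↔ f = HC) ∧
      (∀ f : Z L (unitaryLie n F) →ₐ[L] Z L (glLie n F),
        γ.comp f = (twistSubst n (embeddingsOver p L S)
          (twistVector n (embeddingsOver p L S))).comp γt ↔ f = HCa) ∧
      Function.Surjective (Algebra.TensorProduct.productMap HC HCa) :=
  exists_harishChandra_surjective hL (comp_conj_mem_embeddingsOver_iff hS hSc) n
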